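/- All manifolds are smooth, finite-dimensional, Hausdorff and second countable. **Setting.** Let $\mathcal G=(G\rightrightarrows M)$ be a Lie groupoid with source $s$, target $t$ (surjective submersions), unit map $e$ and composition $g\circ h$ defined for $s(g)=t(h)$. Its Lie algebroid $\mathfrak g\to M$ is $e^*\ker(\mathrm dt)$, with anchor $\rho=\mathrm ds|_{\mathfrak g}$ and the bracket for which $\nu\mapsto\nu_l$, $\nu_l|_g=\mathrm dL_g(\nu_{s(g)})$, is a morphism to left-invariant vector fields. A *Cartan connection* on $\mathcal G$ is a distribution $\mathcal H\subset TG$ with $T_gG=\mathcal H_g\oplus\ker(\mathrm dt)_g$ for all $g\in G$ such that $(\mathcal H\rightrightarrows TM)$ is a subgroupoid of the tangent groupoid $(TG\rightrightarrows TM)$. It induces a vector bundle connection on $\mathfrak g$ by $(\nabla_V\nu)|_x=[\mathsf{hor}_{\mathcal H}(V),\nu_l]|_{e_x}$, where $\mathsf{hor}_{\mathcal H}(V)|_g\in\mathcal H_g$ is the lift of $V_{t(g)}$ along $\mathrm dt$. For a connection $\nabla$ on $\mathfrak g$ put, for $\nu,\mu,\nu_i\in\Gamma(\mathfrak g)$ and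 $V\in\mathfrak X(M)$, $$\nabla^{\rm bas}_\nu\mu=\nabla_{\rho(\mu)}\nu+[\nu,\mu],\qquad \nabla^{\rm bas}_\nu V=\rho(\nabla_V\nu)+[\rho(\nu),V],$$ $$R^{\rm bas}_\nabla(\nu_1,\nu_2)(V)=\nabla_V[\nu_1,\nu_2]-[\nabla_V\nu_1,\nu_2]-[\nu_1,\nabla_V\nu_2]-\nabla_{\nabla^{\rm bas}_{\nu_2}V}\nu_1+\nabla_{\nabla^{\rm bas}_{\nu_1}V}\nu_2 .$$ A *covariant adjustment* of $\mathfrak g$ is a pair $(\nabla,\zeta)$ of a connection $\nabla$ on $\mathfrak g$ with $R^{\rm bas}_\nabla=0$ and a two-form $\zeta\in\Omega^2(M,\mathfrak g)$ such that for all $V,W\in\mathfrak X(M)$ and $\nu\in\Gamma(\mathfrak g)$ $$R_\nabla(V,W)\nu+(\nabla^{\rm bas}_\nu\zeta)(V,W)=0,$$ where $R_\nabla$ is the curvature of $\nabla$ and $(\nabla^{\rm bas}_\nu\zeta)(V,W)=\nabla^{\rm bas}_\nu(\zeta(V,W))-\zeta(\nabla^{\rm bas}_\nu V,W)-\zeta(V,\nabla^{\rm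 bas}_\nu W)$. Let $\mathcal G$ act smoothly from the right on a manifold $N$ along $\psi\colon N\to M$, that is, $n\triangleleft g\in N$ is defined for $\psi(n)=t(g)$, with $\psi(n\triangleleft g)=s(g)$, $n\triangleleft e_{\psi(n)}=n$ and $(n\triangleleft g)\triangleleft h=n\triangleleft(g\circ h)$. The action groupoid $\mathcal K=(N\times_{\psi,t}G\rightrightarrows N)$ has target $(n,g)\mapsto n$, source $(n,g)\mapsto n\triangleleft g$, composition $(n,g)\circ(n\triangleleft g,h)=(n,g\circ h)$, units $(n,e_{\psi(n)})$ and inverses $(n\triangleleft g,g^{-1})$. The fibre $\mathfrak k_n$ of its Lie algebroid $\mathfrak k$ is canonically identified with $\mathfrak g_{\psi(n)}$ by the differential of $g\mapsto(n,g)$, so that $\mathfrak k\cong\psi^*\mathfrak g$ as vector bundles. **Proposition.** Let $\mathcal G$ act on $N$ from the right along a submersion $\psi$, let $\mathcal H$ be a Cartan connection on $\mathcal G$, and let $(\nabla,\zeta)$ be a covariant adjustment of $\mathfrak g$ such that $\nabla$ is the connection induced by $\mathcal H$. Then $\mathcal K$ is a Lie groupoid, and $$\hat{\mathcal H}_{(n,g)}=\{\xi\in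 T_{(n,g)}(N\times_{\psi,t}G):\ \mathrm d\,\mathrm{pr}_G(\xi)\in\mathcal H_g\}$$ is a Cartan connection on $\mathcal K$. The connection $\nabla_{\mathfrak k}$ on $\mathfrak k$ that it induces is the pullback connection $\psi^*\nabla$. Moreover $(\nabla_{\mathfrak k},\psi^!\zeta)$ is a covariant adjustment of $\mathfrak k$, where $\psi^!\zeta\in\Omega^2(N,\mathfrak k)$ is the pullback of $\zeta$ as a form, $(\psi^!\zeta)_n(X,Y)=\zeta_{\psi(n)}(\mathrm d\psi X,\mathrm d\psi Y)\in\mathfrak g_{\psi(n)}\cong\mathfrak k_n$. -/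

import Mathlib

open Set
open scoped Manifold ContDiff Topology

set_option linter.unusedSectionVars false

noncomputable section

/-! ### Fibre products of manifolds along a submersion -/

/-- The fibre product `N ×_{f,t} G`, with the subspace topology. -/
abbrev FiberProduct {N G M : Type*} (f : N → M) (t : G → M) : Type _ :=
  {p : N × G // f p.1 = t p.2}

/-- The standard complement of the model space of the base of a submersion. -/
abbrev FiberModel (EG EM : Type*) [NormedAddCommGroup EG] [NormedSpace ℝ EG]
    [NormedAddCommGroup EM] [NormedSpace ℝ EM] : Type :=
  EuclideanSpace ℝ (Fin (Module.finrank ℝ EG - Module.finrank ℝ EM))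

namespace FiberProduct

variable {EN EG EM : Type*}
  [NormedAddCommGroup EN] [NormedSpace ℝ EN]
  [NormedAddCommGroup EG] [NormedSpace ℝ EG] [FiniteDimensional ℝ EG]
  [NormedAddCommGroup EM] [NormedSpace ℝ EM] [FiniteDimensional ℝ EM]
  {N G M : Type*}
  [TopologicalSpace N] [ChartedSpace EN N]
  [TopologicalSpace G] [ChartedSpace EG G]
  [TopologicalSpace M] [ChartedSpace EM M]
  {f : N → M} {t : G → M}

theorem submersionAt_fiberModel
    (ht : Manifold.IsSubmersion 𝓘(ℝ, EG) 𝓘(ℝ, EM) ∞ t) (g : G) :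
    Manifold.IsSubmersionAtOfComplement (FiberModel EG EM) 𝓘(ℝ, EG) 𝓘(ℝ, EM) ∞ t g := by
  have h := ht.isSubmersionAt g
  have e := h.equiv
  have : FiniteDimensional ℝ (EM × h.complement) := e.toLinearEquiv.finiteDimensional
  have : FiniteDimensional ℝ h.complement :=
    FiniteDimensional.of_surjective (LinearMap.snd ℝ EM h.complement) LinearMap.snd_surjective
  refine h.isSubmersionAtOfComplement_complement.trans_F
    (ContinuousLinearEquiv.ofFinrankEq ?_)
  have h1 := e.toLinearEquiv.finrank_eq
  rw [Module.finrank_prod] at h1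
  rw [finrank_euclideanSpace_fin]
  omega

section chart

variable (ht : Manifold.IsSubmersion 𝓘(ℝ, EG) 𝓘(ℝ, EM) ∞ t) (p₀ : FiberProduct f t)

/-- A chart of `G` around the second component, straightening `t`. -/
def totChart : OpenPartialHomeomorph G EG := (submersionAt_fiberModel ht p₀.1.2).domChart

/-- A chart of `M` around the common image, straightening `t`. -/
def baseChart : OpenPartialHomeomorph M EM := (submersionAt_fiberModel ht p₀.1.2).codChart

/-- The linear splitting in which `t` becomes the first projection. -/
def split : EG ≃L[ℝ] EM × FiberModel EG EM := (submersionAt_fiberModel ht p₀.1.2).equiv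

/-- The coordinates `(n, g) ↦ (x(n), fibre coordinate of g)`. -/
def coord (p : N × G) : EN × FiberModel EG EM :=
  (chartAt EN p₀.1.1 p.1, (split ht p₀ (totChart ht p₀ p.2)).2)

/-- The `EG`-coordinates of the second component with prescribed coordinates. -/
def totCoord (z : EN × FiberModel EG EM) : EG :=
  (split ht p₀).symm (baseChart ht p₀ (f ((chartAt EN p₀.1.1).symm z.1)), z.2)

/-- The parametrization inverse to `coord`, with values in `N × G`. -/
def param (z : EN × FiberModel EG EM) : N × G :=
  ((chartAt EN p₀.1.1).symm z.1, (totChart ht p₀).symm (totCoord (EN := EN) ht p₀ z))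

/-- The domain of `param`. -/
def paramDomain : Set (EN × FiberModel EG EM) :=
  {z | z.1 ∈ (chartAt EN p₀.1.1).target ∧
    f ((chartAt EN p₀.1.1).symm z.1) ∈ (baseChart ht p₀).source ∧
    totCoord (EN := EN) ht p₀ z ∈ (totChart ht p₀).target}

variable (EN) in
/-- The domain of `coord`. -/
def coordDomain : Set (N × G) :=
  (chartAt EN p₀.1.1).source ×ˢ (totChart ht p₀).source

theorem base_of_mem {g : G} (hg : g ∈ (totChart ht p₀).source) :
    t g ∈ (baseChart ht p₀).source ∧
      baseChart ht p₀ (t g) = (split ht p₀ (totChart ht p₀ g)).1 := by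
  refine ⟨(submersionAt_fiberModel ht p₀.1.2).source_subset_preimage_source hg, ?_⟩
  have h1 : totChart ht p₀ g ∈
      ((submersionAt_fiberModel ht p₀.1.2).domChart.extend 𝓘(ℝ, EG)).target := by
    have h0 : totChart ht p₀ g ∈ (submersionAt_fiberModel ht p₀.1.2).domChart.target :=
      (totChart ht p₀).map_source hg
    simpa [OpenPartialHomeomorph.extend_target] using h0
  have h := (submersionAt_fiberModel ht p₀.1.2).writtenInCharts h1
  have h2 : (submersionAt_fiberModel ht p₀.1.2).domChart.symm (totChart ht p₀ g) = g :=
    (totChart ht p₀).left_inv hg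
  simp only [Function.comp_apply, OpenPartialHomeomorph.extend_coe,
    OpenPartialHomeomorph.extend_coe_symm, modelWithCornersSelf_coe,
    modelWithCornersSelf_coe_symm, id_eq, h2] at h
  exact h

theorem param_mem {z : EN × FiberModel EG EM} (hz : z ∈ paramDomain (EN := EN) ht p₀) :
    f (param (EN := EN) ht p₀ z).1 = t (param (EN := EN) ht p₀ z).2 := by
  obtain ⟨-, h2, h3⟩ := hz
  have hs := (totChart ht p₀).map_target h3
  obtain ⟨h4, h5⟩ := base_of_mem ht p₀ hs
  refine (baseChart ht p₀).injOn h2 h4 ?_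
  change baseChart ht p₀ _ = baseChart ht p₀ (t ((totChart ht p₀).symm _))
  rw [h5, (totChart ht p₀).right_inv h3, totCoord]
  simp

theorem totCoord_coord {p : N × G} (hp : f p.1 = t p.2) (hc : p ∈ coordDomain EN ht p₀) :
    totCoord (EN := EN) ht p₀ (coord (EN := EN) ht p₀ p) = totChart ht p₀ p.2 := by
  obtain ⟨h1, h2⟩ := hc
  obtain ⟨-, h5⟩ := base_of_mem ht p₀ h2
  simp only [totCoord, coord]
  rw [(chartAt EN p₀.1.1).left_inv h1, hp, h5]
  simp

theorem coord_mem {p : N × G} (hp : f p.1 = t p.2) (hc : p ∈ coordDomain EN ht p₀) :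
    coord (EN := EN) ht p₀ p ∈ paramDomain (EN := EN) ht p₀ := by
  refine ⟨(chartAt EN p₀.1.1).map_source hc.1, ?_, ?_⟩
  · have : (chartAt EN p₀.1.1).symm (coord (EN := EN) ht p₀ p).1 = p.1 :=
      (chartAt EN p₀.1.1).left_inv hc.1
    rw [this, hp]
    exact (base_of_mem ht p₀ hc.2).1
  · rw [totCoord_coord ht p₀ hp hc]
    exact (totChart ht p₀).map_source hc.2

theorem param_coord {p : N × G} (hp : f p.1 = t p.2) (hc : p ∈ coordDomain EN ht p₀) :
    param (EN := EN) ht p₀ (coord (EN := EN) ht p₀ p) = p := by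
  refine Prod.ext ((chartAt EN p₀.1.1).left_inv hc.1) ?_
  simp only [param]
  rw [totCoord_coord ht p₀ hp hc, (totChart ht p₀).left_inv hc.2]

theorem param_mem_coordDomain {z : EN × FiberModel EG EM} (hz : z ∈ paramDomain (EN := EN) ht p₀) :
    param (EN := EN) ht p₀ z ∈ coordDomain EN ht p₀ :=
  ⟨(chartAt EN p₀.1.1).map_target hz.1, (totChart ht p₀).map_target hz.2.2⟩

theorem coord_param {z : EN × FiberModel EG EM} (hz : z ∈ paramDomain (EN := EN) ht p₀) :
    coord (EN := EN) ht p₀ (param (EN := EN) ht p₀ z) = z := by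
  refine Prod.ext ((chartAt EN p₀.1.1).right_inv hz.1) ?_
  simp only [coord, param]
  rw [(totChart ht p₀).right_inv hz.2.2, totCoord]
  simp

theorem isOpen_coordDomain : IsOpen (coordDomain EN ht p₀) :=
  (chartAt EN p₀.1.1).open_source.prod (totChart ht p₀).open_source

theorem continuousOn_coord : ContinuousOn (coord (EN := EN) ht p₀) (coordDomain EN ht p₀) := by
  refine ContinuousOn.prodMk ?_ ?_
  · exact (chartAt EN p₀.1.1).continuousOn.comp continuousOn_fst fun p hp => hp.1
  · refine continuous_snd.comp_continuousOn ((split ht p₀).continuous.comp_continuousOn ?_)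
    exact (totChart ht p₀).continuousOn.comp continuousOn_snd fun p hp => hp.2

/-- The part of `paramDomain` where `totCoord` is regular. -/
def preDomain : Set (EN × FiberModel EG EM) :=
  {z | z.1 ∈ (chartAt EN p₀.1.1).target ∧
    f ((chartAt EN p₀.1.1).symm z.1) ∈ (baseChart ht p₀).source}

theorem isOpen_preDomain (hf : ContMDiff 𝓘(ℝ, EN) 𝓘(ℝ, EM) ∞ f) : IsOpen (preDomain (f := f) (EN := EN) ht p₀) := by
  have h : IsOpen ((chartAt EN p₀.1.1).target ∩
      (f ∘ (chartAt EN p₀.1.1).symm) ⁻¹' (baseChart ht p₀).source) :=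
    (hf.continuous.comp_continuousOn (chartAt EN p₀.1.1).symm.continuousOn).isOpen_inter_preimage
      (chartAt EN p₀.1.1).open_target (baseChart ht p₀).open_source
  exact h.preimage continuous_fst

theorem continuousOn_totCoord (hf : ContMDiff 𝓘(ℝ, EN) 𝓘(ℝ, EM) ∞ f) : ContinuousOn (totCoord (EN := EN) ht p₀) (preDomain (EN := EN) ht p₀) := by
  refine (split ht p₀).symm.continuous.comp_continuousOn (ContinuousOn.prodMk ?_ continuousOn_snd)
  refine (baseChart ht p₀).continuousOn.comp (hf.continuous.comp_continuousOn ?_) fun z hz => hz.2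
  exact (chartAt EN p₀.1.1).symm.continuousOn.comp continuousOn_fst fun z hz => hz.1

theorem paramDomain_eq : paramDomain (EN := EN) ht p₀ =
    preDomain ht p₀ ∩ totCoord (EN := EN) ht p₀ ⁻¹' (totChart ht p₀).target := by
  ext z
  simp [paramDomain, preDomain, and_assoc]

theorem isOpen_paramDomain (hf : ContMDiff 𝓘(ℝ, EN) 𝓘(ℝ, EM) ∞ f) : IsOpen (paramDomain (EN := EN) ht p₀) := by
  rw [paramDomain_eq]
  exact (continuousOn_totCoord ht p₀ hf).isOpen_inter_preimage (isOpen_preDomain ht p₀ hf)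
    (totChart ht p₀).open_target

theorem continuousOn_param (hf : ContMDiff 𝓘(ℝ, EN) 𝓘(ℝ, EM) ∞ f) : ContinuousOn (param (EN := EN) ht p₀) (paramDomain (EN := EN) ht p₀) := by
  refine ContinuousOn.prodMk ?_ ?_
  · exact (chartAt EN p₀.1.1).symm.continuousOn.comp continuousOn_fst fun z hz => hz.1
  · refine (totChart ht p₀).symm.continuousOn.comp ((continuousOn_totCoord ht p₀ hf).mono ?_)
      fun z hz => hz.2.2
    exact fun z hz => ⟨hz.1, hz.2.1⟩

open Classical in
/-- The chart of `N ×_{f,t} G` around `p₀`. -/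
def chart (hf : ContMDiff 𝓘(ℝ, EN) 𝓘(ℝ, EM) ∞ f) : OpenPartialHomeomorph (FiberProduct f t) (EN × FiberModel EG EM) where
  toFun p := coord (EN := EN) ht p₀ p.1
  invFun z := if hz : z ∈ paramDomain (EN := EN) ht p₀ then ⟨param (EN := EN) ht p₀ z, param_mem ht p₀ hz⟩ else p₀
  source := Subtype.val ⁻¹' coordDomain EN ht p₀
  target := paramDomain (EN := EN) ht p₀
  map_source' p hp := coord_mem ht p₀ p.2 hp
  map_target' z hz := by
    rw [dif_pos hz]
    exact param_mem_coordDomain ht p₀ hz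
  left_inv' p hp := by
    rw [dif_pos (coord_mem ht p₀ p.2 hp)]
    exact Subtype.ext (param_coord ht p₀ p.2 hp)
  right_inv' z hz := by
    rw [dif_pos hz]
    exact coord_param ht p₀ hz
  open_source := (isOpen_coordDomain ht p₀).preimage continuous_subtype_val
  open_target := isOpen_paramDomain ht p₀ hf
  continuousOn_toFun :=
    (continuousOn_coord ht p₀).comp continuous_subtype_val.continuousOn fun _ hp => hp
  continuousOn_invFun := by
    refine (Topology.IsInducing.subtypeVal (t := {p : N × G | f p.1 = t p.2})).continuousOn_iff.2 ?_
    refine (continuousOn_param ht p₀ hf).congr fun z hz => ?_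
    simp [hz]

theorem chart_symm_val (hf : ContMDiff 𝓘(ℝ, EN) 𝓘(ℝ, EM) ∞ f) {z : EN × FiberModel EG EM} (hz : z ∈ paramDomain (EN := EN) ht p₀) :
    ((chart ht p₀ hf).symm z).1 = param (EN := EN) ht p₀ z := by
  simp [chart, hz]

/-- The smooth atlas of the fibre product. -/
abbrev chartedSpace (hf : ContMDiff 𝓘(ℝ, EN) 𝓘(ℝ, EM) ∞ f) : ChartedSpace (EN × FiberModel EG EM) (FiberProduct f t) where
  atlas := range fun p => chart ht p hf
  chartAt p := chart ht p hf
  mem_chart_source p := show p.1 ∈ coordDomain EN ht p from ⟨mem_chart_source EN p.1.1,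
    (submersionAt_fiberModel ht p.1.2).mem_domChart_source⟩
  chart_mem_atlas p := ⟨p, rfl⟩

section smooth

variable [IsManifold 𝓘(ℝ, EN) ∞ N] [IsManifold 𝓘(ℝ, EG) ∞ G] [IsManifold 𝓘(ℝ, EM) ∞ M]

theorem contMDiffOn_coord :
    ContMDiffOn (𝓘(ℝ, EN).prod 𝓘(ℝ, EG)) 𝓘(ℝ, EN × FiberModel EG EM) ∞
      (coord (EN := EN) ht p₀) (coordDomain EN ht p₀) := by
  refine ContMDiffOn.prodMk_space ?_ ?_
  · exact (contMDiffOn_chart (I := 𝓘(ℝ, EN)) (n := ∞)).comp contMDiffOn_fst fun p hp => hp.1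
  · have h1 : ContMDiff 𝓘(ℝ, EG) 𝓘(ℝ, FiberModel EG EM) ∞ fun z : EG => (split ht p₀ z).2 :=
      (contDiff_snd.comp (split ht p₀).contDiff).contMDiff
    refine h1.comp_contMDiffOn ?_
    exact (contMDiffOn_of_mem_maximalAtlas
      (submersionAt_fiberModel ht p₀.1.2).domChart_mem_maximalAtlas).comp contMDiffOn_snd
      fun p hp => hp.2

theorem contMDiffOn_param (hf : ContMDiff 𝓘(ℝ, EN) 𝓘(ℝ, EM) ∞ f) :
    ContMDiffOn 𝓘(ℝ, EN × FiberModel EG EM) (𝓘(ℝ, EN).prod 𝓘(ℝ, EG)) ∞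
      (param (EN := EN) ht p₀) (paramDomain (EN := EN) ht p₀) := by
  have hfst : ContMDiff 𝓘(ℝ, EN × FiberModel EG EM) 𝓘(ℝ, EN) ∞
      (fun z : EN × FiberModel EG EM => z.1) := contDiff_fst.contMDiff
  have hsnd : ContMDiff 𝓘(ℝ, EN × FiberModel EG EM) 𝓘(ℝ, FiberModel EG EM) ∞
      (fun z : EN × FiberModel EG EM => z.2) := contDiff_snd.contMDiff
  have h1 : ContMDiffOn 𝓘(ℝ, EN × FiberModel EG EM) 𝓘(ℝ, EN) ∞
      (fun z => (chartAt EN p₀.1.1).symm z.1) (paramDomain (EN := EN) ht p₀) :=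
    (contMDiffOn_chart_symm (I := 𝓘(ℝ, EN)) (n := ∞)).comp hfst.contMDiffOn fun z hz => hz.1
  refine ContMDiffOn.prodMk h1 ?_
  refine (contMDiffOn_symm_of_mem_maximalAtlas
      (submersionAt_fiberModel ht p₀.1.2).domChart_mem_maximalAtlas).comp ?_ fun z hz => hz.2.2
  have h2 : ContMDiff 𝓘(ℝ, EM × FiberModel EG EM) 𝓘(ℝ, EG) ∞ (split ht p₀).symm :=
    (split ht p₀).symm.contDiff.contMDiff
  refine h2.comp_contMDiffOn (ContMDiffOn.prodMk_space ?_ hsnd.contMDiffOn)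
  exact (contMDiffOn_of_mem_maximalAtlas
    (submersionAt_fiberModel ht p₀.1.2).codChart_mem_maximalAtlas).comp
    (hf.comp_contMDiffOn h1) fun z hz => hz.2.1

theorem isManifold (hf : ContMDiff 𝓘(ℝ, EN) 𝓘(ℝ, EM) ∞ f) :
    @IsManifold ℝ _ (EN × FiberModel EG EM) _ _ (EN × FiberModel EG EM) _
      𝓘(ℝ, EN × FiberModel EG EM) ∞ (FiberProduct f t) _ (chartedSpace ht hf) := by
  let _ := chartedSpace ht hf
  refine isManifold_of_contDiffOn _ _ _ ?_
  rintro _ _ ⟨p, rfl⟩ ⟨q, rfl⟩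
  simp only [modelWithCornersSelf_coe, modelWithCornersSelf_coe_symm, Function.id_comp,
    Function.comp_id, preimage_id, range_id, inter_univ]
  rw [← contMDiffOn_iff_contDiffOn]
  have hs : ∀ z ∈ ((chart ht p hf).symm ≫ₕ chart ht q hf).source,
      z ∈ paramDomain (EN := EN) ht p ∧ param (EN := EN) ht p z ∈ coordDomain EN ht q := by
    intro z hz
    rw [OpenPartialHomeomorph.trans_source] at hz
    refine ⟨hz.1, ?_⟩
    have h := hz.2
    rw [mem_preimage] at h
    change ((chart ht p hf).symm z).1 ∈ coordDomain EN ht q at h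
    rwa [chart_symm_val ht p hf hz.1] at h
  refine ((contMDiffOn_coord ht q).comp ((contMDiffOn_param ht p hf).mono fun z hz => (hs z hz).1)
    fun z hz => (hs z hz).2).congr fun z hz => ?_
  change coord (EN := EN) ht q ((chart ht p hf).symm z).1 = _
  rw [chart_symm_val ht p hf (hs z hz).1]
  rfl

end smooth

end chart

end FiberProduct

/-! ### Lie groupoids -/

/-- Vector fields (not necessarily smooth) on a manifold `M` modelled on `E`. -/
abbrev VecField (E M : Type*) [NormedAddCommGroup E] [NormedSpace ℝ E] [TopologicalSpace M]
    [ChartedSpace E M] : Type _ :=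
  ∀ x : M, TangentSpace 𝓘(ℝ, E) x

/-- Smoothness of a vector field on a set. -/
def VecField.SmoothOn {E M : Type*} [NormedAddCommGroup E] [NormedSpace ℝ E]
    [TopologicalSpace M] [ChartedSpace E M] [IsManifold 𝓘(ℝ, E) ∞ M]
    (X : VecField E M) (U : Set M) : Prop :=
  ContMDiffOn 𝓘(ℝ, E) 𝓘(ℝ, E).tangent ∞ (fun x => (⟨x, X x⟩ : TangentBundle 𝓘(ℝ, E) M)) U

/-- Smooth vector fields. -/
def VecField.Smooth {E M : Type*} [NormedAddCommGroup E] [NormedSpace ℝ E]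
    [TopologicalSpace M] [ChartedSpace E M] [IsManifold 𝓘(ℝ, E) ∞ M]
    (X : VecField E M) : Prop :=
  X.SmoothOn univ

/-- The derivative `V(f)` of a function along a vector field. -/
def VecField.deriv {E M : Type*} [NormedAddCommGroup E] [NormedSpace ℝ E]
    [TopologicalSpace M] [ChartedSpace E M] (V : VecField E M) (f : M → ℝ) : M → ℝ :=
  fun x => mfderiv 𝓘(ℝ, E) 𝓘(ℝ, ℝ) f x (V x)

/-- The structure maps of a groupoid with arrows `G` (a manifold modelled on `EG`) and objects `M`
(a manifold modelled on `EM`). The composition `mul g h` is meaningful only for composable arrows,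
i.e. if `src g = tgt h`. The laws and the smoothness are in `IsLieGroupoid`. -/
structure GroupoidMaps (EG EM G M : Type*)
    [NormedAddCommGroup EG] [NormedSpace ℝ EG] [NormedAddCommGroup EM] [NormedSpace ℝ EM]
    [TopologicalSpace G] [ChartedSpace EG G] [TopologicalSpace M] [ChartedSpace EM M] where
  src : G → M
  tgt : G → M
  one : M → G
  mul : G → G → G
  inv : G → G

section LieGroupoid

variable {EG EM G M : Type*}
  [NormedAddCommGroup EG] [NormedSpace ℝ EG] [NormedAddCommGroup EM] [NormedSpace ℝ EM]
  [TopologicalSpace G] [ChartedSpace EG G] [TopologicalSpace M] [ChartedSpace EM M]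

/-- The set of composable pairs of arrows. -/
def GroupoidMaps.composable (𝒢 : GroupoidMaps EG EM G M) : Set (G × G) :=
  {p | 𝒢.src p.1 = 𝒢.tgt p.2}

/-- Lie groupoids. The composable pairs form an embedded submanifold of `G × G` (as `tgt` is a
submersion), and smoothness of a map on an embedded submanifold is smoothness on it as a subset. -/
class IsLieGroupoid (𝒢 : GroupoidMaps EG EM G M) : Prop where
  src_one : ∀ m, 𝒢.src (𝒢.one m) = m
  tgt_one : ∀ m, 𝒢.tgt (𝒢.one m) = m
  src_mul : ∀ g h, 𝒢.src g = 𝒢.tgt h → 𝒢.src (𝒢.mul g h) = 𝒢.src h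
  tgt_mul : ∀ g h, 𝒢.src g = 𝒢.tgt h → 𝒢.tgt (𝒢.mul g h) = 𝒢.tgt g
  mul_assoc : ∀ g h k, 𝒢.src g = 𝒢.tgt h → 𝒢.src h = 𝒢.tgt k →
    𝒢.mul (𝒢.mul g h) k = 𝒢.mul g (𝒢.mul h k)
  one_mul : ∀ g, 𝒢.mul (𝒢.one (𝒢.tgt g)) g = g
  mul_one : ∀ g, 𝒢.mul g (𝒢.one (𝒢.src g)) = g
  src_inv : ∀ g, 𝒢.src (𝒢.inv g) = 𝒢.tgt g
  tgt_inv : ∀ g, 𝒢.tgt (𝒢.inv g) = 𝒢.src g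
  mul_inv : ∀ g, 𝒢.mul g (𝒢.inv g) = 𝒢.one (𝒢.tgt g)
  inv_mul : ∀ g, 𝒢.mul (𝒢.inv g) g = 𝒢.one (𝒢.src g)
  src_surjective : Function.Surjective 𝒢.src
  tgt_surjective : Function.Surjective 𝒢.tgt
  src_submersion : Manifold.IsSubmersion 𝓘(ℝ, EG) 𝓘(ℝ, EM) ∞ 𝒢.src
  tgt_submersion : Manifold.IsSubmersion 𝓘(ℝ, EG) 𝓘(ℝ, EM) ∞ 𝒢.tgt
  one_smooth : ContMDiff 𝓘(ℝ, EM) 𝓘(ℝ, EG) ∞ 𝒢.one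
  inv_smooth : ContMDiff 𝓘(ℝ, EG) 𝓘(ℝ, EG) ∞ 𝒢.inv
  mul_smooth : ContMDiffOn (𝓘(ℝ, EG).prod 𝓘(ℝ, EG)) 𝓘(ℝ, EG) ∞
    (fun p : G × G => 𝒢.mul p.1 p.2) 𝒢.composable

end LieGroupoid

namespace GroupoidMaps

variable {EG EM G M : Type*}
  [NormedAddCommGroup EG] [NormedSpace ℝ EG] [NormedAddCommGroup EM] [NormedSpace ℝ EM]
  [TopologicalSpace G] [ChartedSpace EG G] [TopologicalSpace M] [ChartedSpace EM M]
  (𝒢 : GroupoidMaps EG EM G M)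

/-! ### Cartan connections -/

/-- The vertical space `ker (d tgt)_g`. -/
def vertical (g : G) : Submodule ℝ (TangentSpace 𝓘(ℝ, EG) g) :=
  LinearMap.ker (mfderiv 𝓘(ℝ, EG) 𝓘(ℝ, EM) 𝒢.tgt g).toLinearMap

/-- The composition of the tangent groupoid: the differential of the composition at `(g, h)`,
evaluated at `(v, w)`. It is meaningful if `(g, h)` is composable and `d src v = d tgt w`, i.e. if
`(v, w)` is tangent to the submanifold of composable pairs; on such vectors the value of the
derivative within this set is uniquely determined. -/
def tangentMul {g h : G} (v : TangentSpace 𝓘(ℝ, EG) g) (w : TangentSpace 𝓘(ℝ, EG) h) :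
    TangentSpace 𝓘(ℝ, EG) (𝒢.mul g h) :=
  mfderivWithin (𝓘(ℝ, EG).prod 𝓘(ℝ, EG)) 𝓘(ℝ, EG) (fun p : G × G => 𝒢.mul p.1 p.2)
    𝒢.composable (g, h) (v, w)

/-- A family of tangent subspaces which is a smooth vector subbundle of the tangent bundle:
its rank is locally constant and each of its vectors extends to a local smooth section. -/
structure IsSmoothDistribution [IsManifold 𝓘(ℝ, EG) ∞ G]
    (H : ∀ g : G, Submodule ℝ (TangentSpace 𝓘(ℝ, EG) g)) : Prop where
  rank_locally_constant : ∀ g, ∀ᶠ g' in 𝓝 g, Module.finrank ℝ (H g') = Module.finrank ℝ (H g)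
  exists_local_section : ∀ g, ∀ v ∈ H g, ∃ U : Set G, IsOpen U ∧ g ∈ U ∧
    ∃ X : VecField EG G, X.SmoothOn U ∧ X g = v ∧ ∀ x ∈ U, X x ∈ H x

/-- A multiplicative distribution: a distribution on `G` that is a subgroupoid of the tangent
groupoid, with all of `TM` as objects. -/
structure IsMultiplicativeDistribution [IsManifold 𝓘(ℝ, EG) ∞ G]
    (H : ∀ g : G, Submodule ℝ (TangentSpace 𝓘(ℝ, EG) g)) : Prop where
  smooth : IsSmoothDistribution H
  one_mem : ∀ (m : M) (v : TangentSpace 𝓘(ℝ, EM) m),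
    mfderiv 𝓘(ℝ, EM) 𝓘(ℝ, EG) 𝒢.one m v ∈ H (𝒢.one m)
  inv_mem : ∀ (g : G), ∀ v ∈ H g, mfderiv 𝓘(ℝ, EG) 𝓘(ℝ, EG) 𝒢.inv g v ∈ H (𝒢.inv g)
  mul_mem : ∀ (g h : G), ∀ v ∈ H g, ∀ w ∈ H h,
    tangentMap 𝓘(ℝ, EG) 𝓘(ℝ, EM) 𝒢.src ⟨g, v⟩ = tangentMap 𝓘(ℝ, EG) 𝓘(ℝ, EM) 𝒢.tgt ⟨h, w⟩ →
    𝒢.tangentMul v w ∈ H (𝒢.mul g h)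

/-- A Cartan connection: a multiplicative distribution complementary to `ker (d tgt)`. -/
structure IsCartanConnection [IsManifold 𝓘(ℝ, EG) ∞ G]
    (H : ∀ g : G, Submodule ℝ (TangentSpace 𝓘(ℝ, EG) g)) : Prop where
  multiplicative : 𝒢.IsMultiplicativeDistribution H
  isCompl : ∀ g, IsCompl (H g) (𝒢.vertical g)

/-- The horizontal lift of a vector field `V` on `M`: its value at `g` is the vector in `H g`
(unique if `H` is complementary to `ker (d tgt)`) over `V (tgt g)`. -/
def horLift (H : ∀ g : G, Submodule ℝ (TangentSpace 𝓘(ℝ, EG) g)) (V : VecField EM M) :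
    VecField EG G := fun g =>
  Classical.epsilon fun γ : TangentSpace 𝓘(ℝ, EG) g =>
    γ ∈ H g ∧ mfderiv 𝓘(ℝ, EG) 𝓘(ℝ, EM) 𝒢.tgt g γ = V (𝒢.tgt g)

/-! ### The Lie algebroid -/

/-- Families of vectors in `T_{e(m)} G`, `m ∈ M`. -/
abbrev Sec : Type _ := ∀ m : M, TangentSpace 𝓘(ℝ, EG) (𝒢.one m)

/-- The smooth sections of the Lie algebroid, the vector bundle `e^* ker (d tgt)` over `M`. -/
structure IsSection [IsManifold 𝓘(ℝ, EG) ∞ G] (ν : 𝒢.Sec) : Prop where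
  mem_vertical : ∀ m, ν m ∈ 𝒢.vertical (𝒢.one m)
  smooth : ContMDiff 𝓘(ℝ, EM) 𝓘(ℝ, EG).tangent ∞
    (fun m => (⟨𝒢.one m, ν m⟩ : TangentBundle 𝓘(ℝ, EG) G))

/-- The left-invariant vector field of a section `ν`. Its value at `g` is `dL_g (ν (src g))`, where
`L_g` is defined on the fibre of `tgt` over `src g`; the derivative within this fibre is uniquely
determined on its tangent space `ker (d tgt)`. It is a tangent vector at `g ∘ e = g`. -/
def leftInvariant (ν : 𝒢.Sec) : VecField EG G := fun g =>
  mfderivWithin 𝓘(ℝ, EG) 𝓘(ℝ, EG) (fun h => 𝒢.mul g h) {h | 𝒢.tgt h = 𝒢.src g}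
    (𝒢.one (𝒢.src g)) (ν (𝒢.src g))

/-- The bracket of sections of the Lie algebroid. -/
def bracket (ν₁ ν₂ : 𝒢.Sec) : 𝒢.Sec := fun m =>
  VectorField.mlieBracket 𝓘(ℝ, EG) (𝒢.leftInvariant ν₁) (𝒢.leftInvariant ν₂) (𝒢.one m)

/-- The anchor of the Lie algebroid, the restriction of `d src`, on sections. Its value at `m` is a
tangent vector at `src (e m) = m`. -/
def anchor (ν : 𝒢.Sec) : VecField EM M := fun m =>
  mfderiv 𝓘(ℝ, EG) 𝓘(ℝ, EM) 𝒢.src (𝒢.one m) (ν m)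

/-! ### Connections on the Lie algebroid and adjustments

Operators are total; only their values on smooth vector fields and smooth sections matter. -/

/-- Operators `(V, ν) ↦ ∇_V ν`. -/
abbrev ConnOp : Type _ := VecField EM M → 𝒢.Sec → 𝒢.Sec

/-- Vector bundle connections on the Lie algebroid. -/
structure IsConnection [IsManifold 𝓘(ℝ, EG) ∞ G] [IsManifold 𝓘(ℝ, EM) ∞ M]
    (D : 𝒢.ConnOp) : Prop where
  isSection : ∀ V ν, V.Smooth → 𝒢.IsSection ν → 𝒢.IsSection (D V ν)
  add_left : ∀ V W ν, V.Smooth → W.Smooth → 𝒢.IsSection ν → D (V + W) ν = D V ν + D W ν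
  add_right : ∀ V ν μ, V.Smooth → 𝒢.IsSection ν → 𝒢.IsSection μ → D V (ν + μ) = D V ν + D V μ
  smul_left : ∀ (f : M → ℝ) V ν, ContMDiff 𝓘(ℝ, EM) 𝓘(ℝ, ℝ) ∞ f → V.Smooth → 𝒢.IsSection ν →
    D (fun m => f m • V m) ν = fun m => f m • D V ν m
  leibniz : ∀ (f : M → ℝ) V ν, ContMDiff 𝓘(ℝ, EM) 𝓘(ℝ, ℝ) ∞ f → V.Smooth → 𝒢.IsSection ν →
    D V (fun m => f m • ν m) =
      fun m => f m • D V ν m + V.deriv f m • ν m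

/-- The connection on the Lie algebroid induced by a Cartan connection,
`∇_V ν = [hor V, ν_l]` along the units. -/
def inducedConnection (H : ∀ g : G, Submodule ℝ (TangentSpace 𝓘(ℝ, EG) g)) : 𝒢.ConnOp :=
  fun V ν m =>
    VectorField.mlieBracket 𝓘(ℝ, EG) (𝒢.horLift H V) (𝒢.leftInvariant ν) (𝒢.one m)

/-- The basic connection `∇^bas_ν μ = ∇_{ρ μ} ν + [ν, μ]` on the Lie algebroid. -/
def basicSec (D : 𝒢.ConnOp) (ν μ : 𝒢.Sec) : 𝒢.Sec :=
  D (𝒢.anchor μ) ν + 𝒢.bracket ν μ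

/-- The basic connection `∇^bas_ν V = ρ (∇_V ν) + [ρ ν, V]` on the tangent bundle of `M`. -/
def basicVec (D : 𝒢.ConnOp) (ν : 𝒢.Sec) (V : VecField EM M) : VecField EM M :=
  𝒢.anchor (D V ν) + VectorField.mlieBracket 𝓘(ℝ, EM) (𝒢.anchor ν) V

/-- The basic curvature `R^bas(ν₁, ν₂)(V)`. -/
def basicCurvature (D : 𝒢.ConnOp) (ν₁ ν₂ : 𝒢.Sec) (V : VecField EM M) : 𝒢.Sec :=
  D V (𝒢.bracket ν₁ ν₂) - 𝒢.bracket (D V ν₁) ν₂ - 𝒢.bracket ν₁ (D V ν₂)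
    - D (𝒢.basicVec D ν₂ V) ν₁ + D (𝒢.basicVec D ν₁ V) ν₂

/-- The curvature `R(V, W) ν`. -/
def curvature (D : 𝒢.ConnOp) (V W : VecField EM M) (ν : 𝒢.Sec) : 𝒢.Sec :=
  D V (D W ν) - D W (D V ν) - D (VectorField.mlieBracket 𝓘(ℝ, EM) V W) ν

/-- Families of alternating bilinear maps `T_m M × T_m M → T_{e(m)} G`, `m ∈ M`. -/
abbrev Form2 : Type _ :=
  ∀ m : M, TangentSpace 𝓘(ℝ, EM) m [⋀^Fin 2]→ₗ[ℝ] TangentSpace 𝓘(ℝ, EG) (𝒢.one m)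

variable {𝒢} in
/-- The evaluation of a two-form on two vector fields. -/
def Form2.eval (ζ : 𝒢.Form2) (V W : VecField EM M) : 𝒢.Sec := fun m => ζ m ![V m, W m]

/-- Smooth two-forms on `M` with values in the Lie algebroid. -/
structure IsForm2 [IsManifold 𝓘(ℝ, EG) ∞ G] [IsManifold 𝓘(ℝ, EM) ∞ M] (ζ : 𝒢.Form2) : Prop where
  mem_vertical : ∀ m v, ζ m v ∈ 𝒢.vertical (𝒢.one m)
  smooth : ∀ V W, V.Smooth → W.Smooth → 𝒢.IsSection (Form2.eval ζ V W)

/-- The derivative `(∇^bas_ν ζ)(V, W)` of a two-form by the basic connections. -/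
def basicForm (D : 𝒢.ConnOp) (ν : 𝒢.Sec) (ζ : 𝒢.Form2) (V W : VecField EM M) : 𝒢.Sec :=
  𝒢.basicSec D ν (Form2.eval ζ V W) - Form2.eval ζ (𝒢.basicVec D ν V) W
    - Form2.eval ζ V (𝒢.basicVec D ν W)

/-- Adjustments: connections on the Lie algebroid with vanishing basic curvature. -/
structure IsAdjustment [IsManifold 𝓘(ℝ, EG) ∞ G] [IsManifold 𝓘(ℝ, EM) ∞ M]
    (D : 𝒢.ConnOp) : Prop where
  isConnection : 𝒢.IsConnection D
  basicCurvature_eq_zero : ∀ ν₁ ν₂ V, 𝒢.IsSection ν₁ → 𝒢.IsSection ν₂ → V.Smooth →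
    𝒢.basicCurvature D ν₁ ν₂ V = 0

/-- Covariant adjustments: an adjustment `∇` with a primitive `ζ`, a two-form with values in the
Lie algebroid such that `R_∇(V, W) ν + (∇^bas_ν ζ)(V, W) = 0`. -/
structure IsCovariantAdjustment [IsManifold 𝓘(ℝ, EG) ∞ G] [IsManifold 𝓘(ℝ, EM) ∞ M]
    (D : 𝒢.ConnOp) (ζ : 𝒢.Form2) : Prop where
  isAdjustment : 𝒢.IsAdjustment D
  isForm2 : 𝒢.IsForm2 ζ
  curvature_add : ∀ V W ν, V.Smooth → W.Smooth → 𝒢.IsSection ν →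
    𝒢.curvature D V W ν + 𝒢.basicForm D ν ζ V W = 0

end GroupoidMaps

/-! ### Actions and action groupoids -/

section Action

variable {EG EM G M : Type*}
  [NormedAddCommGroup EG] [NormedSpace ℝ EG] [NormedAddCommGroup EM] [NormedSpace ℝ EM]
  [TopologicalSpace G] [ChartedSpace EG G] [TopologicalSpace M] [ChartedSpace EM M]

/-- A smooth right action of a Lie groupoid on a manifold `N` along `ψ : N → M`. The expression
`act n g` is meaningful only if `ψ n = tgt g`. -/
structure RightAction (𝒢 : GroupoidMaps EG EM G M) (EN N : Type*)
    [NormedAddCommGroup EN] [NormedSpace ℝ EN] [TopologicalSpace N] [ChartedSpace EN N] where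
  ψ : N → M
  act : N → G → N
  ψ_smooth : ContMDiff 𝓘(ℝ, EN) 𝓘(ℝ, EM) ∞ ψ
  act_smooth : ContMDiffOn (𝓘(ℝ, EN).prod 𝓘(ℝ, EG)) 𝓘(ℝ, EN) ∞
    (fun p : N × G => act p.1 p.2) {p | ψ p.1 = 𝒢.tgt p.2}
  ψ_act : ∀ n g, ψ n = 𝒢.tgt g → ψ (act n g) = 𝒢.src g
  act_one : ∀ n, act n (𝒢.one (ψ n)) = n
  act_act : ∀ n g h, ψ n = 𝒢.tgt g → 𝒢.src g = 𝒢.tgt h → act (act n g) h = act n (𝒢.mul g h)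

namespace RightAction

variable {𝒢 : GroupoidMaps EG EM G M} {EN N : Type*}
  [NormedAddCommGroup EN] [NormedSpace ℝ EN] [TopologicalSpace N] [ChartedSpace EN N]
  (A : RightAction 𝒢 EN N)

/-- The arrows `N ×_{ψ, tgt} G` of the action groupoid. -/
def Arrows : Type _ := FiberProduct A.ψ 𝒢.tgt

instance : TopologicalSpace A.Arrows :=
  inferInstanceAs (TopologicalSpace (FiberProduct A.ψ 𝒢.tgt))

variable [FiniteDimensional ℝ EG] [FiniteDimensional ℝ EM] [IsLieGroupoid 𝒢]

instance : ChartedSpace (EN × FiberModel EG EM) A.Arrows :=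
  FiberProduct.chartedSpace (IsLieGroupoid.tgt_submersion (𝒢 := 𝒢)) A.ψ_smooth

instance [IsManifold 𝓘(ℝ, EN) ∞ N] [IsManifold 𝓘(ℝ, EG) ∞ G] [IsManifold 𝓘(ℝ, EM) ∞ M] :
    IsManifold 𝓘(ℝ, EN × FiberModel EG EM) ∞ A.Arrows :=
  FiberProduct.isManifold (IsLieGroupoid.tgt_submersion (𝒢 := 𝒢)) A.ψ_smooth

open Classical in
/-- The action groupoid. -/
def actionGroupoid : GroupoidMaps (EN × FiberModel EG EM) EN A.Arrows N where
  src k := A.act k.1.1 k.1.2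
  tgt k := k.1.1
  one n := ⟨(n, 𝒢.one (A.ψ n)), (IsLieGroupoid.tgt_one (A.ψ n)).symm⟩
  mul k l :=
    if h : A.act k.1.1 k.1.2 = l.1.1 then
      ⟨(k.1.1, 𝒢.mul k.1.2 l.1.2), by
        have hs : 𝒢.src k.1.2 = 𝒢.tgt l.1.2 := by
          rw [← A.ψ_act _ _ k.2, h]
          exact l.2
        exact k.2.trans (IsLieGroupoid.tgt_mul _ _ hs).symm⟩
    else k
  inv k := ⟨(A.act k.1.1 k.1.2, 𝒢.inv k.1.2),
    (A.ψ_act _ _ k.2).trans (IsLieGroupoid.tgt_inv k.1.2).symm⟩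

/-- The projection `N ×_{ψ, tgt} G → G`. -/
def toArrow (k : A.Arrows) : G := k.1.2

/-- The distribution on the action groupoid induced by a distribution on `G`: the vectors whose
image in `TG` is horizontal. Its vertical projection is the pullback of that of `H`. -/
def inducedDistribution (H : ∀ g : G, Submodule ℝ (TangentSpace 𝓘(ℝ, EG) g)) (k : A.Arrows) :
    Submodule ℝ (TangentSpace 𝓘(ℝ, EN × FiberModel EG EM) k) :=
  (H (A.toArrow k)).comap
    (mfderiv 𝓘(ℝ, EN × FiberModel EG EM) 𝓘(ℝ, EG) A.toArrow k).toLinearMap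

open Classical in
/-- The map `g ↦ (n, g)` from the fibre of `tgt` over `ψ n` onto the fibre of the target map of the
action groupoid over `n` (extended arbitrarily to `G`). -/
def fiberIncl (n : N) (g : G) : A.Arrows :=
  if h : A.ψ n = 𝒢.tgt g then ⟨(n, g), h⟩ else A.actionGroupoid.one n

/-- The canonical identification of the fibre at `ψ n` of the Lie algebroid of `𝒢` with the fibre at
`n` of the Lie algebroid of the action groupoid: the differential at the unit of `g ↦ (n, g)`. As
this map lives on the fibre of `tgt` over `ψ n`, only the values on `ker (d tgt)` matter. -/
def algebroidLift (n : N) : TangentSpace 𝓘(ℝ, EG) (𝒢.one (A.ψ n)) →L[ℝ]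
    TangentSpace 𝓘(ℝ, EN × FiberModel EG EM) (A.actionGroupoid.one n) :=
  mfderivWithin 𝓘(ℝ, EG) 𝓘(ℝ, EN × FiberModel EG EM) (A.fiberIncl n)
    {g | 𝒢.tgt g = A.ψ n} (𝒢.one (A.ψ n))

/-- The pullback `ψ^* ν` of a section of the Lie algebroid of `𝒢`. -/
def pullbackSection (ν : 𝒢.Sec) : A.actionGroupoid.Sec := fun n =>
  A.algebroidLift n (ν (A.ψ n))

/-- The pullback of a Lie algebroid valued two-form along `ψ`, as a form. -/
def pullbackForm (ζ : 𝒢.Form2) : A.actionGroupoid.Form2 := fun n =>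
  (A.algebroidLift n).toLinearMap.compAlternatingMap
    ((ζ (A.ψ n)).compLinearMap (mfderiv 𝓘(ℝ, EN) 𝓘(ℝ, EM) A.ψ n).toLinearMap)

/-- `D'` is the pullback along `ψ` of the connection `D`: at each point `n`,
`D'_X (ψ^* ν) = ψ^* (D_V ν)` whenever `dψ (X n) = V (ψ n)`. -/
def IsPullbackConnection [IsManifold 𝓘(ℝ, EG) ∞ G] [IsManifold 𝓘(ℝ, EM) ∞ M]
    [IsManifold 𝓘(ℝ, EN) ∞ N] (D : 𝒢.ConnOp) (D' : A.actionGroupoid.ConnOp) : Prop :=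
  A.actionGroupoid.IsConnection D' ∧
    ∀ (X : VecField EN N) (V : VecField EM M) (ν : 𝒢.Sec) (n : N),
      X.Smooth → V.Smooth → 𝒢.IsSection ν →
      mfderiv 𝓘(ℝ, EN) 𝓘(ℝ, EM) A.ψ n (X n) = V (A.ψ n) →
      D' X (A.pullbackSection ν) n = A.algebroidLift n (D V ν (A.ψ n))

end RightAction

end Action

end

/-! The projection `A.toArrow : (n, g) ↦ g` is a groupoid morphism from the action groupoid to `𝒢`
over `ψ`, and it identifies the target fibre over `n` with the target fibre over `ψ n`. The tangent
space of the manifold of arrows at `(n, g)` is the space of pairs `(x, ξ)` with `dψ x = dt ξ`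
(`tangent_ext`, `exists_tangent`). The induced distribution is thus the preimage of a subgroupoid
under a groupoid morphism. Splitting `ξ` into its horizontal and vertical parts, while leaving `x`
with the horizontal one, shows that it is complementary to the vertical space
(`isCartanConnection_inducedDistribution`).

The Lie algebroid data are compared through related vector fields. The left-invariant field of `ψ^*
ν` is `toArrow`-related to that of `ν`, and if `X` on `N` is `ψ`-related to `V` on `M`, the
horizontal lift of `X` is related to that of `V`. Brackets of related fields are related
(`mfderiv_mlieBracket_of_related`), and a vertical vector at a unit is determined by its image in
`TG` (`eq_algebroidLift`). Hence brackets of pullback sections are pullbacks of brackets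
(`bracket_pullbackSection`) and the induced connection is the pullback connection
(`isPullbackConnection_inducedConnection`).

On projectable vector fields and pullback sections, the basic curvature and both terms of the
equation for `ζ` are therefore the lifts of the same expressions on `𝒢`, whose hypotheses make them
vanish. This suffices, because all these expressions are tensorial, a submersion has local frames of
projectable fields, and pullback sections locally span the sections of the algebroid
(`eq_zero_of_projectable`, `eq_zero_of_pullbackSection`). Tensoriality is a Leibniz computation in
which the terms differentiating the coefficient function cancel.

Multiplication and action are defined on fibre products only, so their differentials are derivatives
within subsets. A local retraction of the ambient product onto the fibre product
(`FiberProduct.exists_retraction`) shows that these derivatives are determined on tangent vectors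
and depend smoothly on them. -/

/-! ### The Lie bracket as a commutator of derivations -/

section FunctionBracket

variable {E F M : Type*} [NormedAddCommGroup E] [NormedSpace ℝ E]
  [NormedAddCommGroup F] [NormedSpace ℝ F]
  [TopologicalSpace M] [ChartedSpace E M]

/-- In the commutator the second derivatives of `f` cancel by symmetry; what remains is `df` applied
to the difference of the derivatives of the fields. -/
theorem fderiv_lieBracket {f : E → F} {V W : E → E} {x : E} (hf : ContDiffAt ℝ 2 f x)
    (hV : DifferentiableAt ℝ V x) (hW : DifferentiableAt ℝ W x) :
    fderiv ℝ f x (VectorField.lieBracket ℝ V W x) =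
      fderiv ℝ (fun y => fderiv ℝ f y (W y)) x (V x) -
        fderiv ℝ (fun y => fderiv ℝ f y (V y)) x (W x) := by
  have hd : DifferentiableAt ℝ (fderiv ℝ f) x :=
    (hf.fderiv_right (m := 1) (by norm_num)).differentiableAt (by norm_num)
  have hs : IsSymmSndFDerivAt ℝ f x := hf.isSymmSndFDerivAt (by simp)
  rw [fderiv_clm_apply hd hW, fderiv_clm_apply hd hV]
  simp [VectorField.lieBracket, hs.eq (V x) (W x)]

/-- Pulling `V` back to the chart applies the inverse of the derivative of the inverse chart, which
the chain rule undoes. -/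
theorem fderiv_comp_extChartAt_symm {g : M → F} {V : VecField E M} {x : M} {z : E}
    [IsManifold 𝓘(ℝ, E) 1 M]
    (hz : z ∈ (extChartAt 𝓘(ℝ, E) x).target)
    (hg : MDifferentiableAt 𝓘(ℝ, E) 𝓘(ℝ, F) g ((extChartAt 𝓘(ℝ, E) x).symm z)) :
    fderiv ℝ (g ∘ (extChartAt 𝓘(ℝ, E) x).symm) z
      (VectorField.mpullbackWithin 𝓘(ℝ, E) 𝓘(ℝ, E) (extChartAt 𝓘(ℝ, E) x).symm V
        (range 𝓘(ℝ, E)) z) =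
      mvfderiv 𝓘(ℝ, E) g ((extChartAt 𝓘(ℝ, E) x).symm z)
        (V ((extChartAt 𝓘(ℝ, E) x).symm z)) := by
  have hi := isInvertible_mfderivWithin_extChartAt_symm hz
  have hd := mdifferentiableWithinAt_extChartAt_symm hz
  have h := mfderiv_comp_mfderivWithin z hg hd (by
    rw [modelWithCornersSelf_coe, range_id]; exact uniqueMDiffWithinAt_univ _)
  rw [VectorField.mpullbackWithin_apply]
  have h2 : mfderivWithin 𝓘(ℝ, E) 𝓘(ℝ, F) (g ∘ (extChartAt 𝓘(ℝ, E) x).symm) (range 𝓘(ℝ, E)) z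
      = fderiv ℝ (g ∘ (extChartAt 𝓘(ℝ, E) x).symm) z := by
    rw [modelWithCornersSelf_coe, range_id, mfderivWithin_univ, mfderiv_eq_fderiv]
  rw [h2] at h
  have h3 := DFunLike.congr_fun h ((mfderivWithin 𝓘(ℝ, E) 𝓘(ℝ, E) (extChartAt 𝓘(ℝ, E) x).symm
    (range 𝓘(ℝ, E)) z).inverse (V ((extChartAt 𝓘(ℝ, E) x).symm z)))
  refine h3.trans ?_
  change mfderiv 𝓘(ℝ, E) 𝓘(ℝ, F) g _ (_) = mfderiv 𝓘(ℝ, E) 𝓘(ℝ, F) g _ _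
  congr 1
  exact hi.self_apply_inverse _

/-- Reading everything in the chart at `x` reduces this to the flat formula. Values in a normed
space are allowed so that `f` can later be a chart, whose injective derivative recovers the bracket
itself. -/
theorem mvfderiv_mlieBracket [CompleteSpace E] [IsManifold 𝓘(ℝ, E) 2 M]
    {f : M → F} {V W : VecField E M} {x : M}
    (hf : ContMDiffAt 𝓘(ℝ, E) 𝓘(ℝ, F) 2 f x)
    (hV : MDifferentiableAt 𝓘(ℝ, E) 𝓘(ℝ, E).tangent
      (fun y => (⟨y, V y⟩ : TangentBundle 𝓘(ℝ, E) M)) x)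
    (hW : MDifferentiableAt 𝓘(ℝ, E) 𝓘(ℝ, E).tangent
      (fun y => (⟨y, W y⟩ : TangentBundle 𝓘(ℝ, E) M)) x)
    (hfV : MDifferentiableAt 𝓘(ℝ, E) 𝓘(ℝ, F) (fun y => mvfderiv 𝓘(ℝ, E) f y (V y)) x)
    (hfW : MDifferentiableAt 𝓘(ℝ, E) 𝓘(ℝ, F) (fun y => mvfderiv 𝓘(ℝ, E) f y (W y)) x) :
    mvfderiv 𝓘(ℝ, E) f x (VectorField.mlieBracket 𝓘(ℝ, E) V W x) =
      mvfderiv 𝓘(ℝ, E) (fun y => mvfderiv 𝓘(ℝ, E) f y (W y)) x (V x) -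
        mvfderiv 𝓘(ℝ, E) (fun y => mvfderiv 𝓘(ℝ, E) f y (V y)) x (W x) := by
  have hM1 : IsManifold 𝓘(ℝ, E) 1 M := IsManifold.of_le (n := 2) (by norm_num)
  set φ := extChartAt 𝓘(ℝ, E) x with hφ
  set V' := VectorField.mpullbackWithin 𝓘(ℝ, E) 𝓘(ℝ, E) φ.symm V (range 𝓘(ℝ, E)) with hV'
  set W' := VectorField.mpullbackWithin 𝓘(ℝ, E) 𝓘(ℝ, E) φ.symm W (range 𝓘(ℝ, E)) with hW'
  have hx : φ.symm (φ x) = x := extChartAt_to_inv x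
  have hxt : φ x ∈ φ.target := mem_extChartAt_target x
  have dV : DifferentiableAt ℝ V' (φ x) := by
    have := (mdifferentiableWithinAt_univ.2 hV).differentiableWithinAt_mpullbackWithin_vectorField
    rw [preimage_univ, univ_inter] at this
    have hr : range 𝓘(ℝ, E) = univ := by simp
    exact differentiableWithinAt_univ.1 (hr ▸ this)
  have dW : DifferentiableAt ℝ W' (φ x) := by
    have := (mdifferentiableWithinAt_univ.2 hW).differentiableWithinAt_mpullbackWithin_vectorField
    rw [preimage_univ, univ_inter] at this
    have hr : range 𝓘(ℝ, E) = univ := by simp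
    exact differentiableWithinAt_univ.1 (hr ▸ this)
  have hfc : ContDiffAt ℝ 2 (f ∘ φ.symm) (φ x) := by
    have := hf.contMDiffWithinAt (s := univ)
    have h := (contMDiffAt_iff.1 hf).2
    simpa using! h
  have hev : ∀ᶠ z in 𝓝 (φ x), z ∈ φ.target ∧
      MDifferentiableAt 𝓘(ℝ, E) 𝓘(ℝ, F) f (φ.symm z) := by
    refine Filter.Eventually.and ((isOpen_extChartAt_target x).mem_nhds hxt) ?_
    have h1 : ∀ᶠ y in 𝓝 x, MDifferentiableAt 𝓘(ℝ, E) 𝓘(ℝ, F) f y :=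
      ((contMDiffAt_iff_contMDiffAt_nhds (by simp)).1 hf).mono fun y hy => hy.mdifferentiableAt (by norm_num)
    have hc : ContinuousAt φ.symm (φ x) := continuousAt_extChartAt_symm x
    rw [ContinuousAt, hx] at hc
    exact hc.eventually h1
  -- The equality is needed on a neighbourhood, as both sides are differentiated once more.
  have key : ∀ U : VecField E M,
      (fun z => fderiv ℝ (f ∘ φ.symm) z
        (VectorField.mpullbackWithin 𝓘(ℝ, E) 𝓘(ℝ, E) φ.symm U (range 𝓘(ℝ, E)) z)) =ᶠ[𝓝 (φ x)]
      (fun y => mvfderiv 𝓘(ℝ, E) f y (U y)) ∘ φ.symm := by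
    intro U
    filter_upwards [hev] with z hz
    exact fderiv_comp_extChartAt_symm hz.1 hz.2
  have main := fderiv_lieBracket hfc dV dW
  rw [(key V).fderiv_eq, (key W).fderiv_eq, fderiv_comp_extChartAt_symm hxt (by rwa [hx]),
    fderiv_comp_extChartAt_symm hxt (by rwa [hx]), hx] at main
  rw [← main]
  have hi : (mfderiv 𝓘(ℝ, E) 𝓘(ℝ, E) φ x).IsInvertible :=
    isInvertible_mfderiv_extChartAt (mem_extChartAt_source x)
  have hd : DifferentiableAt ℝ (f ∘ φ.symm) (φ x) := hfc.differentiableAt (by norm_num)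
  have hφd : MDifferentiableAt 𝓘(ℝ, E) 𝓘(ℝ, E) φ x :=
    mdifferentiableAt_extChartAt (mem_chart_source E x)
  have hc := mfderiv_comp x hd.mdifferentiableAt hφd
  have hc2 : (f ∘ φ.symm) ∘ φ =ᶠ[𝓝 x] f := by
    filter_upwards [extChartAt_source_mem_nhds (I := 𝓘(ℝ, E)) x] with y hy
    simp only [Function.comp_apply]
    rw [φ.left_inv hy]
  have hc3 := hc2.mfderiv_eq (I := 𝓘(ℝ, E)) (I' := 𝓘(ℝ, F))
  have hb : mfderiv 𝓘(ℝ, E) 𝓘(ℝ, E) φ x (VectorField.mlieBracket 𝓘(ℝ, E) V W x) =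
      VectorField.lieBracket ℝ V' W' (φ x) := by
    rw [← VectorField.mlieBracketWithin_univ, VectorField.mlieBracketWithin_apply,
      preimage_univ, univ_inter]
    refine (hi.self_apply_inverse _).trans ?_
    have hr : range 𝓘(ℝ, E) = univ := by simp
    rw [hV', hW', hr]
    exact congrFun VectorField.lieBracketWithin_univ (φ x)
  rw [← hb]
  change mfderiv 𝓘(ℝ, E) 𝓘(ℝ, F) f x _ = _
  have h4 := DFunLike.congr_fun (hc3.symm.trans hc) (VectorField.mlieBracket 𝓘(ℝ, E) V W x)
  refine Eq.trans ?_ (h4.trans ?_)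
  · rfl
  · rw [mfderiv_eq_fderiv]; rfl
end FunctionBracket

theorem infty_add_one_le : (∞ : WithTop ℕ∞) + 1 ≤ ∞ := le_of_eq rfl

theorem two_le_infty : (2 : WithTop ℕ∞) ≤ ∞ :=
  WithTop.coe_le_coe.2 (le_top : (2 : ℕ∞) ≤ ⊤)

/-! ### Smoothness of vector fields along a map -/

section Along

variable {EP HP P : Type*} [NormedAddCommGroup EP] [NormedSpace ℝ EP] [TopologicalSpace HP]
  {J : ModelWithCorners ℝ EP HP} [TopologicalSpace P] [ChartedSpace HP P]
  {E H M : Type*} [NormedAddCommGroup E] [NormedSpace ℝ E] [TopologicalSpace H]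
  {I : ModelWithCorners ℝ E H} [TopologicalSpace M] [ChartedSpace H M]
  {E' H' M' : Type*} [NormedAddCommGroup E'] [NormedSpace ℝ E'] [TopologicalSpace H']
  {I' : ModelWithCorners ℝ E' H'} [TopologicalSpace M'] [ChartedSpace H' M']

/-- Base points such as `g ∘ e` and `g` agree only propositionally, whereas every tangent space
unfolds to the model space. Vectors over such points are therefore compared in the model space. -/
theorem tangentBundle_mk_eq {x y : M} (h : x = y) {v : TangentSpace I x} {w : TangentSpace I y}
    (hvw : (show E from v) = (show E from w)) :
    (⟨x, v⟩ : TangentBundle I M) = ⟨y, w⟩ := by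
  subst h
  exact congrArg _ hvw

variable [IsManifold J ∞ P] [IsManifold I ∞ M] [IsManifold I' ∞ M']

/-- The derivative of a smooth family of maps is smooth in the parameter, with no loss of regularity
because `∞ + 1 = ∞`. -/
theorem ContMDiffAt.mfderiv_apply_along {f : P → M → M'} {b : P → M}
    {v : ∀ p, TangentSpace I (b p)} {p₀ : P}
    (hf : ContMDiffAt (J.prod I) I' ∞ (Function.uncurry f) (p₀, b p₀))
    (hv : ContMDiffAt J I.tangent ∞ (fun p => (⟨b p, v p⟩ : TangentBundle I M)) p₀) :
    ContMDiffAt J I'.tangent ∞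
      (fun p => (⟨f p (b p), mfderiv I I' (f p) (b p) (v p)⟩ : TangentBundle I' M')) p₀ := by
  have : IsManifold J 1 P := IsManifold.of_le (n := ∞) (by simp)
  have : IsManifold I 1 M := IsManifold.of_le (n := ∞) (by simp)
  have : IsManifold I' 1 M' := IsManifold.of_le (n := ∞) (by simp)
  have hb : ContMDiffAt J I ∞ b p₀ := (Bundle.contMDiffAt_totalSpace.1 hv).1
  have hfb : ContMDiffAt J I' ∞ (fun p => f p (b p)) p₀ :=
    ContMDiffAt.comp (f := fun p => (p, b p)) p₀ hf (contMDiffAt_id.prodMk hb)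
  exact ContMDiffAt.clm_apply_of_inCoordinates (ϕ := fun p => mfderiv I I' (f p) (b p))
    (hf.mfderiv f b hb infty_add_one_le) hv hfb

theorem ContMDiffAt.tangentMap_along {f : M → M'} {b : P → M}
    {v : ∀ p, TangentSpace I (b p)} {p₀ : P}
    (hf : ContMDiffAt I I' ∞ f (b p₀))
    (hv : ContMDiffAt J I.tangent ∞ (fun p => (⟨b p, v p⟩ : TangentBundle I M)) p₀) :
    ContMDiffAt J I'.tangent ∞
      (fun p => (⟨f (b p), mfderiv I I' f (b p) (v p)⟩ : TangentBundle I' M')) p₀ :=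
  ContMDiffAt.mfderiv_apply_along (f := fun _ => f)
    (ContMDiffAt.comp (f := Prod.snd) (p₀, b p₀) hf contMDiffAt_snd) hv

theorem ContMDiffAt.add_along {b : P → M} {v w : ∀ p, TangentSpace I (b p)} {p₀ : P}
    (hv : ContMDiffAt J I.tangent ∞ (fun p => (⟨b p, v p⟩ : TangentBundle I M)) p₀)
    (hw : ContMDiffAt J I.tangent ∞ (fun p => (⟨b p, w p⟩ : TangentBundle I M)) p₀) :
    ContMDiffAt J I.tangent ∞ (fun p => (⟨b p, v p + w p⟩ : TangentBundle I M)) p₀ := by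
  rw [Bundle.contMDiffAt_totalSpace] at hv hw ⊢
  refine ⟨hv.1, (hv.2.add hw.2).congr_of_eventuallyEq ?_⟩
  have h := hv.1.continuousAt.preimage_mem_nhds
    ((trivializationAt E (TangentSpace I) (b p₀)).open_baseSet.mem_nhds
      (FiberBundle.mem_baseSet_trivializationAt' (b p₀)))
  filter_upwards [h] with p hp
  exact ((trivializationAt E (TangentSpace I) (b p₀)).linear ℝ hp).1 _ _

theorem ContMDiffAt.smul_along {b : P → M} {f : P → ℝ} {v : ∀ p, TangentSpace I (b p)} {p₀ : P}
    (hf : ContMDiffAt J 𝓘(ℝ, ℝ) ∞ f p₀)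
    (hv : ContMDiffAt J I.tangent ∞ (fun p => (⟨b p, v p⟩ : TangentBundle I M)) p₀) :
    ContMDiffAt J I.tangent ∞ (fun p => (⟨b p, f p • v p⟩ : TangentBundle I M)) p₀ := by
  rw [Bundle.contMDiffAt_totalSpace] at hv ⊢
  refine ⟨hv.1, (hf.smul hv.2).congr_of_eventuallyEq ?_⟩
  have h := hv.1.continuousAt.preimage_mem_nhds
    ((trivializationAt E (TangentSpace I) (b p₀)).open_baseSet.mem_nhds
      (FiberBundle.mem_baseSet_trivializationAt' (b p₀)))
  filter_upwards [h] with p hp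
  exact ((trivializationAt E (TangentSpace I) (b p₀)).linear ℝ hp).2 _ _

theorem ContMDiffAt.zero_along {b : P → M} {p₀ : P} (hb : ContMDiffAt J I ∞ b p₀) :
    ContMDiffAt J I.tangent ∞ (fun p => (⟨b p, 0⟩ : TangentBundle I M)) p₀ :=
  ContMDiffAt.comp p₀ (Bundle.contMDiff_zeroSection ℝ (TangentSpace I : M → Type _) |>.contMDiffAt) hb

theorem ContMDiffAt.sum_along {ι : Type*} {b : P → M} {s : Finset ι}
    {v : ι → ∀ p, TangentSpace I (b p)} {p₀ : P} (hb : ContMDiffAt J I ∞ b p₀)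
    (hv : ∀ i ∈ s, ContMDiffAt J I.tangent ∞ (fun p => (⟨b p, v i p⟩ : TangentBundle I M)) p₀) :
    ContMDiffAt J I.tangent ∞ (fun p => (⟨b p, ∑ i ∈ s, v i p⟩ : TangentBundle I M)) p₀ := by
  classical
  induction s using Finset.induction_on with
  | empty => simpa using ContMDiffAt.zero_along hb
  | insert i s hi ih =>
    simp_rw [Finset.sum_insert hi]
    exact (hv i (Finset.mem_insert_self i s)).add_along
      (ih fun j hj => hv j (Finset.mem_insert_of_mem hj))

theorem contMDiffAt_tangentBundle_modelSpace_iff {F : Type*} [NormedAddCommGroup F]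
    [NormedSpace ℝ F] {b : P → F} {v : P → F} {p₀ : P} :
    ContMDiffAt J 𝓘(ℝ, F).tangent ∞ (fun p => (⟨b p, v p⟩ : TangentBundle 𝓘(ℝ, F) F)) p₀ ↔
      ContMDiffAt J 𝓘(ℝ, F) ∞ b p₀ ∧ ContMDiffAt J 𝓘(ℝ, F) ∞ v p₀ := by
  rw [Bundle.contMDiffAt_totalSpace]
  refine and_congr_right fun _ => ?_
  have : (fun x => (trivializationAt F (TangentSpace 𝓘(ℝ, F)) (b p₀)
      (⟨b x, v x⟩ : TangentBundle 𝓘(ℝ, F) F)).2) = v := by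
    funext x
    simp
  exact Iff.of_eq (congrArg (fun f => ContMDiffAt J 𝓘(ℝ, F) ∞ f p₀) this)

theorem ContMDiffAt.mvfderiv_apply_along {F : Type*} [NormedAddCommGroup F] [NormedSpace ℝ F]
    {f : M → F} {b : P → M} {v : ∀ p, TangentSpace I (b p)} {p₀ : P}
    (hf : ContMDiffAt I 𝓘(ℝ, F) ∞ f (b p₀))
    (hv : ContMDiffAt J I.tangent ∞ (fun p => (⟨b p, v p⟩ : TangentBundle I M)) p₀) :
    ContMDiffAt J 𝓘(ℝ, F) ∞ (fun p => mvfderiv I f (b p) (v p)) p₀ :=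
  (contMDiffAt_tangentBundle_modelSpace_iff.1 (hf.tangentMap_along hv)).2

end Along

/-! ### Tangent vectors in charts of the maximal atlas -/

section Charts

variable {EP HP P : Type*} [NormedAddCommGroup EP] [NormedSpace ℝ EP] [TopologicalSpace HP]
  {J : ModelWithCorners ℝ EP HP} [TopologicalSpace P] [ChartedSpace HP P]
  {E M : Type*} [NormedAddCommGroup E] [NormedSpace ℝ E]
  [TopologicalSpace M] [ChartedSpace E M]
  [IsManifold J ∞ P] [IsManifold 𝓘(ℝ, E) ∞ M]

theorem mvfderiv_comp_mfderiv {E' H' M' : Type*} [NormedAddCommGroup E'] [NormedSpace ℝ E']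
    [TopologicalSpace H'] {I' : ModelWithCorners ℝ E' H'} [TopologicalSpace M'] [ChartedSpace H' M']
    {F : Type*} [NormedAddCommGroup F] [NormedSpace ℝ F] {φ : P → M'} {f : M' → F} {p : P}
    (hf : MDifferentiableAt I' 𝓘(ℝ, F) f (φ p)) (hφ : MDifferentiableAt J I' φ p)
    (v : TangentSpace J p) :
    mvfderiv J (f ∘ φ) p v = mvfderiv I' f (φ p) (mfderiv J I' φ p v) := by
  have h := mfderiv_comp p hf hφ
  exact DFunLike.congr_fun h v

/-- The coordinate vector field of a chart with constant coefficient `u`. -/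
noncomputable def OpenPartialHomeomorph.coordField (e : OpenPartialHomeomorph M E) (u : E) :
    VecField E M := fun x => (mfderiv 𝓘(ℝ, E) 𝓘(ℝ, E) e x).inverse u

variable {e : OpenPartialHomeomorph M E}

theorem OpenPartialHomeomorph.contMDiffAt_of_mem (he : e ∈ IsManifold.maximalAtlas 𝓘(ℝ, E) ∞ M)
    {x : M} (hx : x ∈ e.source) : ContMDiffAt 𝓘(ℝ, E) 𝓘(ℝ, E) ∞ e x :=
  (contMDiffOn_of_mem_maximalAtlas he).contMDiffAt (e.open_source.mem_nhds hx)

theorem OpenPartialHomeomorph.contMDiffAt_symm_of_mem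
    (he : e ∈ IsManifold.maximalAtlas 𝓘(ℝ, E) ∞ M)
    {u : E} (hu : u ∈ e.target) : ContMDiffAt 𝓘(ℝ, E) 𝓘(ℝ, E) ∞ e.symm u :=
  (contMDiffOn_symm_of_mem_maximalAtlas he).contMDiffAt (e.open_target.mem_nhds hu)

theorem OpenPartialHomeomorph.mdifferentiable_of_mem
    (he : e ∈ IsManifold.maximalAtlas 𝓘(ℝ, E) ∞ M) : e.MDifferentiable 𝓘(ℝ, E) 𝓘(ℝ, E) :=
  ⟨(contMDiffOn_of_mem_maximalAtlas he).mdifferentiableOn (by simp),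
    (contMDiffOn_symm_of_mem_maximalAtlas he).mdifferentiableOn (by simp)⟩

theorem OpenPartialHomeomorph.isInvertible_mfderiv
    (he : e ∈ IsManifold.maximalAtlas 𝓘(ℝ, E) ∞ M) {x : M} (hx : x ∈ e.source) :
    (mfderiv 𝓘(ℝ, E) 𝓘(ℝ, E) e x).IsInvertible :=
  ⟨(e.mdifferentiable_of_mem he).mfderiv hx, rfl⟩

theorem OpenPartialHomeomorph.mvfderiv_coordField
    (he : e ∈ IsManifold.maximalAtlas 𝓘(ℝ, E) ∞ M) {x : M} (hx : x ∈ e.source) (u : E) :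
    mvfderiv 𝓘(ℝ, E) e x (e.coordField u x) = u :=
  (e.isInvertible_mfderiv he hx).self_apply_inverse _

theorem OpenPartialHomeomorph.mvfderiv_injective
    (he : e ∈ IsManifold.maximalAtlas 𝓘(ℝ, E) ∞ M) {x : M} (hx : x ∈ e.source) :
    Function.Injective (mvfderiv 𝓘(ℝ, E) e x) :=
  (e.isInvertible_mfderiv he hx).injective

/-- Conversely, `v` is recovered by applying the derivative of `e.symm` to its coordinates.
Arbitrary charts are allowed because the charts straightening a submersion need not be the preferred
ones. -/
theorem contMDiffAt_along_iff_of_chart (he : e ∈ IsManifold.maximalAtlas 𝓘(ℝ, E) ∞ M)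
    {b : P → M} {v : ∀ p, TangentSpace 𝓘(ℝ, E) (b p)} {p₀ : P} (hx : b p₀ ∈ e.source) :
    ContMDiffAt J 𝓘(ℝ, E).tangent ∞ (fun p => (⟨b p, v p⟩ : TangentBundle 𝓘(ℝ, E) M)) p₀ ↔
      ContMDiffAt J 𝓘(ℝ, E) ∞ b p₀ ∧
        ContMDiffAt J 𝓘(ℝ, E) ∞ (fun p => mvfderiv 𝓘(ℝ, E) e (b p) (v p)) p₀ := by
  constructor
  · intro h
    exact ⟨(Bundle.contMDiffAt_totalSpace.1 h).1,
      (e.contMDiffAt_of_mem he hx).mvfderiv_apply_along h⟩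
  · rintro ⟨hb, hv⟩
    have h1 : ContMDiffAt J 𝓘(ℝ, E).tangent ∞
        (fun p => (⟨e (b p), mvfderiv 𝓘(ℝ, E) e (b p) (v p)⟩ : TangentBundle 𝓘(ℝ, E) E)) p₀ :=
      contMDiffAt_tangentBundle_modelSpace_iff.2
        ⟨(e.contMDiffAt_of_mem he hx).comp p₀ hb, hv⟩
    have h2 := ContMDiffAt.tangentMap_along (f := e.symm) (b := fun p => e (b p))
      (e.contMDiffAt_symm_of_mem he (e.map_source hx)) h1
    refine h2.congr_of_eventuallyEq ?_
    filter_upwards [hb.continuousAt.preimage_mem_nhds (e.open_source.mem_nhds hx)] with p hp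
    refine tangentBundle_mk_eq (e.left_inv hp).symm ?_
    have := DFunLike.congr_fun ((e.mdifferentiable_of_mem he).symm_comp_deriv hp) (v p)
    exact this.symm

theorem OpenPartialHomeomorph.contMDiffAt_coordField
    (he : e ∈ IsManifold.maximalAtlas 𝓘(ℝ, E) ∞ M) {b : P → M} {u : P → E} {p₀ : P}
    (hb : ContMDiffAt J 𝓘(ℝ, E) ∞ b p₀) (hu : ContMDiffAt J 𝓘(ℝ, E) ∞ u p₀)
    (hx : b p₀ ∈ e.source) :
    ContMDiffAt J 𝓘(ℝ, E).tangent ∞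
      (fun p => (⟨b p, e.coordField (u p) (b p)⟩ : TangentBundle 𝓘(ℝ, E) M)) p₀ := by
  refine (contMDiffAt_along_iff_of_chart he hx).2 ⟨hb, hu.congr_of_eventuallyEq ?_⟩
  filter_upwards [hb.continuousAt.preimage_mem_nhds (e.open_source.mem_nhds hx)] with p hp
  exact e.mvfderiv_coordField he hp _

end Charts

/-! ### Smooth vector fields at a point -/

section SmoothFields

variable {E M : Type*} [NormedAddCommGroup E] [NormedSpace ℝ E]
  [TopologicalSpace M] [ChartedSpace E M] [IsManifold 𝓘(ℝ, E) ∞ M]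

/-- Smoothness of a vector field at a point. -/
def VecField.SmoothAt (X : VecField E M) (x : M) : Prop :=
  ContMDiffAt 𝓘(ℝ, E) 𝓘(ℝ, E).tangent ∞ (fun x => (⟨x, X x⟩ : TangentBundle 𝓘(ℝ, E) M)) x

theorem VecField.smooth_iff {X : VecField E M} : X.Smooth ↔ ∀ x, X.SmoothAt x :=
  contMDiffOn_univ

theorem VecField.smooth_zero : (0 : VecField E M).Smooth :=
  VecField.smooth_iff.2 fun _ => ContMDiffAt.zero_along contMDiffAt_id

theorem VecField.Smooth.add {V W : VecField E M} (hV : V.Smooth) (hW : W.Smooth) :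
    (V + W).Smooth :=
  VecField.smooth_iff.2 fun x =>
    (VecField.smooth_iff.1 hV x).add_along (b := fun x => x) (VecField.smooth_iff.1 hW x)

theorem VecField.Smooth.smul {f : M → ℝ} {V : VecField E M} (hf : ContMDiff 𝓘(ℝ, E) 𝓘(ℝ, ℝ) ∞ f)
    (hV : V.Smooth) : VecField.Smooth (fun x => f x • V x) :=
  VecField.smooth_iff.2 fun x =>
    (hf x).smul_along (b := fun x => x) (VecField.smooth_iff.1 hV x)

end SmoothFields

/-! ### Brackets of related vector fields -/

section Related

variable {E M F Q : Type*} [NormedAddCommGroup E] [NormedSpace ℝ E] [CompleteSpace E]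
  [TopologicalSpace M] [ChartedSpace E M] [IsManifold 𝓘(ℝ, E) ∞ M]
  [NormedAddCommGroup F] [NormedSpace ℝ F] [CompleteSpace F]
  [TopologicalSpace Q] [ChartedSpace F Q] [IsManifold 𝓘(ℝ, F) ∞ Q]

theorem mvfderiv_mlieBracket_of_smoothAt {G : Type*} [NormedAddCommGroup G] [NormedSpace ℝ G]
    {f : M → G} {V W : VecField E M} {x : M}
    (hf : ContMDiffAt 𝓘(ℝ, E) 𝓘(ℝ, G) ∞ f x) (hV : V.SmoothAt x) (hW : W.SmoothAt x) :
    mvfderiv 𝓘(ℝ, E) f x (VectorField.mlieBracket 𝓘(ℝ, E) V W x) =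
      mvfderiv 𝓘(ℝ, E) (fun y => mvfderiv 𝓘(ℝ, E) f y (W y)) x (V x) -
        mvfderiv 𝓘(ℝ, E) (fun y => mvfderiv 𝓘(ℝ, E) f y (V y)) x (W x) := by
  have : IsManifold 𝓘(ℝ, E) 2 M := IsManifold.of_le (n := ∞) two_le_infty
  exact mvfderiv_mlieBracket (hf.of_le two_le_infty)
    (hV.mdifferentiableAt (by simp)) (hW.mdifferentiableAt (by simp))
    ((hf.mvfderiv_apply_along (b := fun y => y) hV).mdifferentiableAt (by simp))
    ((hf.mvfderiv_apply_along (b := fun y => y) hW).mdifferentiableAt (by simp))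

theorem ContMDiffAt.eventually_mdifferentiableAt {φ : M → Q} {x : M}
    (hφ : ContMDiffAt 𝓘(ℝ, E) 𝓘(ℝ, F) ∞ φ x) :
    ∀ᶠ y in 𝓝 x, MDifferentiableAt 𝓘(ℝ, E) 𝓘(ℝ, F) φ y := by
  have : IsManifold 𝓘(ℝ, E) 1 M := IsManifold.of_le (n := ∞) (by simp)
  have : IsManifold 𝓘(ℝ, F) 1 Q := IsManifold.of_le (n := ∞) (by simp)
  exact ((contMDiffAt_iff_contMDiffAt_nhds (n := 1) (by simp)).1 (hφ.of_le (by simp))).mono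
    fun y hy => hy.mdifferentiableAt (by simp)

/-- Let `e` be a chart at `φ x`. Relatedness gives `V (e ∘ φ) = (V' e) ∘ φ`, so the commutator
formula for `e ∘ φ` upstairs and for `e` downstairs give the same value. Since `φ` need not be a
diffeomorphism, this applies to the projections and structure maps of the groupoids. -/
theorem mfderiv_mlieBracket_of_related {φ : M → Q} {V W : VecField E M} {V' W' : VecField F Q}
    {x : M} (hφ : ContMDiffAt 𝓘(ℝ, E) 𝓘(ℝ, F) ∞ φ x) (hV : V.SmoothAt x) (hW : W.SmoothAt x)
    (hV' : V'.SmoothAt (φ x)) (hW' : W'.SmoothAt (φ x))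
    (hVV' : ∀ᶠ y in 𝓝 x, mfderiv 𝓘(ℝ, E) 𝓘(ℝ, F) φ y (V y) = V' (φ y))
    (hWW' : ∀ᶠ y in 𝓝 x, mfderiv 𝓘(ℝ, E) 𝓘(ℝ, F) φ y (W y) = W' (φ y)) :
    mfderiv 𝓘(ℝ, E) 𝓘(ℝ, F) φ x (VectorField.mlieBracket 𝓘(ℝ, E) V W x) =
      VectorField.mlieBracket 𝓘(ℝ, F) V' W' (φ x) := by
  set e := chartAt F (φ x)
  have he : e ∈ IsManifold.maximalAtlas 𝓘(ℝ, F) ∞ Q := IsManifold.chart_mem_maximalAtlas (φ x)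
  have hx : φ x ∈ e.source := mem_chart_source F (φ x)
  have hec := e.contMDiffAt_of_mem he hx
  refine e.mvfderiv_injective he hx ?_
  have hφd := hφ.mdifferentiableAt (by simp)
  rw [mvfderiv_mlieBracket_of_smoothAt hec hV' hW',
    ← mvfderiv_comp_mfderiv (hec.mdifferentiableAt (by simp)) hφd,
    mvfderiv_mlieBracket_of_smoothAt (hec.comp x hφ) hV hW]
  have key : ∀ (U : VecField E M) (U' : VecField F Q),
      (∀ᶠ y in 𝓝 x, mfderiv 𝓘(ℝ, E) 𝓘(ℝ, F) φ y (U y) = U' (φ y)) →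
      (fun y => mvfderiv 𝓘(ℝ, E) (e ∘ φ) y (U y)) =ᶠ[𝓝 x]
        (fun z => mvfderiv 𝓘(ℝ, F) e z (U' z)) ∘ φ := by
    intro U U' h
    filter_upwards [h, hφ.eventually_mdifferentiableAt,
      hφ.continuousAt.preimage_mem_nhds (e.open_source.mem_nhds hx)] with y h1 h2 h3
    rw [mvfderiv_comp_mfderiv ((e.contMDiffAt_of_mem he h3).mdifferentiableAt (by simp)) h2, h1]
    rfl
  have key2 : ∀ (U U₂ : VecField E M) (U' U₂' : VecField F Q),
      (∀ᶠ y in 𝓝 x, mfderiv 𝓘(ℝ, E) 𝓘(ℝ, F) φ y (U y) = U' (φ y)) →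
      (∀ᶠ y in 𝓝 x, mfderiv 𝓘(ℝ, E) 𝓘(ℝ, F) φ y (U₂ y) = U₂' (φ y)) → U'.SmoothAt (φ x) →
      mvfderiv 𝓘(ℝ, E) (fun y => mvfderiv 𝓘(ℝ, E) (e ∘ φ) y (U y)) x (U₂ x) =
        mvfderiv 𝓘(ℝ, F) (fun z => mvfderiv 𝓘(ℝ, F) e z (U' z)) (φ x) (U₂' (φ x)) := by
    intro U U₂ U' U₂' h h₂ hs
    have h3 : MDifferentiableAt 𝓘(ℝ, F) 𝓘(ℝ, F) (fun z => mvfderiv 𝓘(ℝ, F) e z (U' z)) (φ x) :=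
      (hec.mvfderiv_apply_along (b := fun y => y) hs).mdifferentiableAt (by simp)
    have h4 : mvfderiv 𝓘(ℝ, E) (fun y => mvfderiv 𝓘(ℝ, E) (e ∘ φ) y (U y)) x (U₂ x) =
      mvfderiv 𝓘(ℝ, E) ((fun z => mvfderiv 𝓘(ℝ, F) e z (U' z)) ∘ φ) x (U₂ x) :=
      DFunLike.congr_fun (key U U' h).mfderiv_eq (U₂ x)
    rw [h4, mvfderiv_comp_mfderiv h3 hφd, h₂.self_of_nhds]
  rw [key2 W V W' V' hWW' hVV' hW', key2 V W V' W' hVV' hWW' hV']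

end Related

/-! ### Tensoriality and expansion in frames -/

section Tensorial

variable {M : Type*} {𝒱 : M → Type*} [∀ m, AddCommGroup (𝒱 m)] [∀ m, Module ℝ (𝒱 m)]
  {A : Type*} [AddCommGroup A] [Module ℝ A]

/-- `T` is additive, and linear over the functions satisfying `C` after evaluation at `x₀`, on the
module of sections satisfying `S`. -/
structure IsTensorialAt (C : (M → ℝ) → Prop) (S : (∀ m, 𝒱 m) → Prop) (T : (∀ m, 𝒱 m) → A)
    (x₀ : M) : Prop where
  zero_mem : S 0
  add_mem : ∀ σ τ, S σ → S τ → S (σ + τ)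
  smul_mem : ∀ f σ, C f → S σ → S (fun m => f m • σ m)
  map_add : ∀ σ τ, S σ → S τ → T (σ + τ) = T σ + T τ
  map_smul : ∀ f σ, C f → S σ → T (fun m => f m • σ m) = f x₀ • T σ

namespace IsTensorialAt

variable {C : (M → ℝ) → Prop} {S : (∀ m, 𝒱 m) → Prop} {T : (∀ m, 𝒱 m) → A} {x₀ : M}

theorem map_zero (hT : IsTensorialAt C S T x₀) : T 0 = 0 := by
  have h := hT.map_add 0 0 hT.zero_mem hT.zero_mem
  simpa using h

theorem map_sum (hT : IsTensorialAt C S T x₀) {ι : Type*} (s : Finset ι) (f : ι → M → ℝ)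
    (σ : ι → ∀ m, 𝒱 m) (hf : ∀ i, C (f i)) (hσ : ∀ i, S (σ i)) :
    S (fun m => ∑ i ∈ s, f i m • σ i m) ∧
      T (fun m => ∑ i ∈ s, f i m • σ i m) = ∑ i ∈ s, f i x₀ • T (σ i) := by
  classical
  induction s using Finset.induction_on with
  | empty =>
    have h : (fun m => ∑ i ∈ (∅ : Finset ι), f i m • σ i m) = 0 := by
      funext m
      simp
    rw [h, Finset.sum_empty]
    exact ⟨hT.zero_mem, hT.map_zero⟩
  | insert i s hi ih =>
    have h : (fun m => ∑ j ∈ insert i s, f j m • σ j m) =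
        (fun m => f i m • σ i m) + fun m => ∑ j ∈ s, f j m • σ j m := by
      funext m
      simp [Finset.sum_insert hi]
    rw [h, Finset.sum_insert hi]
    refine ⟨hT.add_mem _ _ (hT.smul_mem _ _ (hf i) (hσ i)) ih.1, ?_⟩
    rw [hT.map_add _ _ (hT.smul_mem _ _ (hf i) (hσ i)) ih.1, ih.2, hT.map_smul _ _ (hf i) (hσ i)]

/-- As `χ x₀ = 1`, replacing `τ` by `χ • τ` does not change `T τ`, and `χ • τ` has an expansion into
global sections even if only a local frame exists. -/
theorem eq_sum (hT : IsTensorialAt C S T x₀) {ι : Type*} {s : Finset ι} {χ : M → ℝ}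
    {f : ι → M → ℝ} {τ : ∀ m, 𝒱 m} {σ : ι → ∀ m, 𝒱 m} (hχ : C χ) (hχ₀ : χ x₀ = 1) (hτ : S τ)
    (hf : ∀ i, C (f i)) (hσ : ∀ i, S (σ i)) (h : ∀ m, χ m • τ m = ∑ i ∈ s, f i m • σ i m) :
    T τ = ∑ i ∈ s, f i x₀ • T (σ i) := by
  rw [← (hT.map_sum s f σ hf hσ).2, ← funext h, hT.map_smul χ τ hχ hτ, hχ₀, one_smul]

end IsTensorialAt

end Tensorial

/-! ### Cut-off functions and cut-off coordinate frames -/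

section Bump

variable {E M : Type*} [NormedAddCommGroup E] [NormedSpace ℝ E] [FiniteDimensional ℝ E]
  [TopologicalSpace M] [T2Space M] [ChartedSpace E M] [IsManifold 𝓘(ℝ, E) ∞ M]
  {F Q : Type*} [NormedAddCommGroup F] [NormedSpace ℝ F]
  [TopologicalSpace Q] [ChartedSpace F Q] [IsManifold 𝓘(ℝ, F) ∞ Q]

theorem exists_bump (x₀ : M) {U : Set M} (hU : U ∈ 𝓝 x₀) :
    ∃ χ : M → ℝ, ContMDiff 𝓘(ℝ, E) 𝓘(ℝ, ℝ) ∞ χ ∧ χ =ᶠ[𝓝 x₀] 1 ∧ tsupport χ ⊆ U := by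
  obtain ⟨χ, -, hχ⟩ := (SmoothBumpFunction.nhds_basis_tsupport (I := 𝓘(ℝ, E)) x₀).mem_iff.1 hU
  exact ⟨χ, χ.contMDiff, χ.eventuallyEq_one, hχ⟩

theorem contMDiff_smul_along_of_tsupport {χ : M → ℝ} {b : M → Q}
    {v : ∀ m, TangentSpace 𝓘(ℝ, F) (b m)} (hχ : ContMDiff 𝓘(ℝ, E) 𝓘(ℝ, ℝ) ∞ χ)
    (hb : ContMDiff 𝓘(ℝ, E) 𝓘(ℝ, F) ∞ b)
    (hv : ∀ m ∈ tsupport χ, ContMDiffAt 𝓘(ℝ, E) 𝓘(ℝ, F).tangent ∞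
      (fun m => (⟨b m, v m⟩ : TangentBundle 𝓘(ℝ, F) Q)) m) :
    ContMDiff 𝓘(ℝ, E) 𝓘(ℝ, F).tangent ∞
      (fun m => (⟨b m, χ m • v m⟩ : TangentBundle 𝓘(ℝ, F) Q)) := by
  intro m
  by_cases hm : m ∈ tsupport χ
  · exact hχ.contMDiffAt.smul_along (hv m hm)
  · refine (ContMDiffAt.zero_along (hb m)).congr_of_eventuallyEq ?_
    filter_upwards [(isClosed_tsupport χ).isOpen_compl.mem_nhds hm] with p hp
    rw [image_eq_zero_of_notMem_tsupport hp, zero_smul]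

theorem contMDiff_mul_of_tsupport {χ h : M → ℝ} (hχ : ContMDiff 𝓘(ℝ, E) 𝓘(ℝ, ℝ) ∞ χ)
    (hh : ∀ m ∈ tsupport χ, ContMDiffAt 𝓘(ℝ, E) 𝓘(ℝ, ℝ) ∞ h m) :
    ContMDiff 𝓘(ℝ, E) 𝓘(ℝ, ℝ) ∞ (fun m => χ m * h m) := by
  intro m
  by_cases hm : m ∈ tsupport χ
  · exact hχ.contMDiffAt.mul (hh m hm)
  · refine (contMDiffAt_const (c := (0 : ℝ))).congr_of_eventuallyEq ?_
    filter_upwards [(isClosed_tsupport χ).isOpen_compl.mem_nhds hm] with p hp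
    rw [image_eq_zero_of_notMem_tsupport hp, zero_mul]

/-- The coordinate vector field of a chart, cut off by a function. -/
noncomputable def cutoffField (χ : M → ℝ) (e : OpenPartialHomeomorph M E) (u : E) :
    VecField E M := fun x => χ x • e.coordField u x

variable {χ : M → ℝ} {e : OpenPartialHomeomorph M E}

theorem smooth_cutoffField (he : e ∈ IsManifold.maximalAtlas 𝓘(ℝ, E) ∞ M)
    (hχ : ContMDiff 𝓘(ℝ, E) 𝓘(ℝ, ℝ) ∞ χ) (hs : tsupport χ ⊆ e.source) (u : E) :
    (cutoffField χ e u).Smooth :=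
  contMDiffOn_univ.2 <| contMDiff_smul_along_of_tsupport hχ contMDiff_id fun _ hm =>
    e.contMDiffAt_coordField he contMDiffAt_id contMDiffAt_const (hs hm)

/-- The coefficients of a vector field in a chart. -/
noncomputable def chartCoeff (χ : M → ℝ) (e : OpenPartialHomeomorph M E) (X : VecField E M)
    (i : Fin (Module.finrank ℝ E)) (x : M) : ℝ :=
  χ x * (Module.finBasis ℝ E).repr (mvfderiv 𝓘(ℝ, E) e x (X x)) i

theorem contMDiff_chartCoeff (he : e ∈ IsManifold.maximalAtlas 𝓘(ℝ, E) ∞ M)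
    (hχ : ContMDiff 𝓘(ℝ, E) 𝓘(ℝ, ℝ) ∞ χ) (hs : tsupport χ ⊆ e.source) {X : VecField E M}
    (hX : X.Smooth) (i : Fin (Module.finrank ℝ E)) :
    ContMDiff 𝓘(ℝ, E) 𝓘(ℝ, ℝ) ∞ (chartCoeff χ e X i) := by
  refine contMDiff_mul_of_tsupport hχ fun m hm => ?_
  have h1 := (e.contMDiffAt_of_mem he (hs hm)).mvfderiv_apply_along (b := fun x => x)
    (contMDiffOn_univ.1 hX m)
  let L : E →L[ℝ] ℝ := LinearMap.toContinuousLinearMap ((Module.finBasis ℝ E).coord i)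
  exact L.contMDiff.contMDiffAt.comp m h1

/-- The coefficient and the frame field each carry a factor `χ` in order to be globally smooth,
hence the square. -/
theorem sum_chartCoeff (he : e ∈ IsManifold.maximalAtlas 𝓘(ℝ, E) ∞ M)
    (hs : tsupport χ ⊆ e.source) (X : VecField E M) (x : M) :
    (χ x * χ x) • X x =
      ∑ i, chartCoeff χ e X i x • cutoffField χ e (Module.finBasis ℝ E i) x := by
  by_cases hx : x ∈ tsupport χ
  · refine e.mvfderiv_injective he (hs hx) ?_
    simp only [cutoffField, chartCoeff, map_smul, map_sum]
    simp_rw [e.mvfderiv_coordField he (hs hx)]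
    conv_lhs => rw [← (Module.finBasis ℝ E).sum_repr (mvfderiv 𝓘(ℝ, E) e x (X x))]
    rw [Finset.smul_sum]
    refine Finset.sum_congr rfl fun i _ => ?_
    simp only [smul_smul]
    congr 1
    ring
  · simp [cutoffField, image_eq_zero_of_notMem_tsupport hx]

variable {A : Type*} [AddCommGroup A] [Module ℝ A] {T : VecField E M → A} {x₀ : M}

/-- Tensoriality of an operator on smooth vector fields. -/
abbrev VecField.IsTensorialAt (T : VecField E M → A) (x₀ : M) : Prop :=
  _root_.IsTensorialAt (ContMDiff 𝓘(ℝ, E) 𝓘(ℝ, ℝ) ∞) VecField.Smooth T x₀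

theorem VecField.isTensorialAt_mk
    (hadd : ∀ V W : VecField E M, V.Smooth → W.Smooth → T (V + W) = T V + T W)
    (hsmul : ∀ (f : M → ℝ) (V : VecField E M), ContMDiff 𝓘(ℝ, E) 𝓘(ℝ, ℝ) ∞ f → V.Smooth →
      T (fun x => f x • V x) = f x₀ • T V) : VecField.IsTensorialAt T x₀ :=
  ⟨VecField.smooth_zero, fun _ _ => VecField.Smooth.add, fun _ _ => VecField.Smooth.smul,
    hadd, hsmul⟩

theorem VecField.IsTensorialAt.eq_sum_chartCoeff (hT : VecField.IsTensorialAt T x₀)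
    (he : e ∈ IsManifold.maximalAtlas 𝓘(ℝ, E) ∞ M)
    (hχ : ContMDiff 𝓘(ℝ, E) 𝓘(ℝ, ℝ) ∞ χ) (hs : tsupport χ ⊆ e.source) (hχ₀ : χ x₀ = 1)
    {X : VecField E M} (hX : X.Smooth) :
    T X = ∑ i, chartCoeff χ e X i x₀ • T (cutoffField χ e (Module.finBasis ℝ E i)) :=
  IsTensorialAt.eq_sum hT (hχ.mul hχ) (by simp [hχ₀]) hX
    (fun i => contMDiff_chartCoeff he hχ hs hX i) (fun i => smooth_cutoffField he hχ hs _)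
    (sum_chartCoeff he hs X)

/-- The expansion in a cut-off coordinate frame involves the field only through its coefficients at
`x₀`. -/
theorem VecField.IsTensorialAt.congr (hT : VecField.IsTensorialAt T x₀) {X Y : VecField E M}
    (hX : X.Smooth) (hY : Y.Smooth) (h : X x₀ = Y x₀) : T X = T Y := by
  set e := chartAt E x₀
  have he : e ∈ IsManifold.maximalAtlas 𝓘(ℝ, E) ∞ M := IsManifold.chart_mem_maximalAtlas x₀
  obtain ⟨χ, hχ, hχ₁, hs⟩ := exists_bump (E := E) x₀
    (e.open_source.mem_nhds (mem_chart_source E x₀))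
  rw [hT.eq_sum_chartCoeff he hχ hs hχ₁.self_of_nhds hX,
    hT.eq_sum_chartCoeff he hχ hs hχ₁.self_of_nhds hY]
  simp only [chartCoeff, h]

end Bump

/-! ### Retractions onto fibre products, and derivatives within them -/

section Retraction

variable {EN EG EM : Type*}
  [NormedAddCommGroup EN] [NormedSpace ℝ EN]
  [NormedAddCommGroup EG] [NormedSpace ℝ EG] [FiniteDimensional ℝ EG]
  [NormedAddCommGroup EM] [NormedSpace ℝ EM] [FiniteDimensional ℝ EM]
  {N G M : Type*}
  [TopologicalSpace N] [ChartedSpace EN N] [IsManifold 𝓘(ℝ, EN) ∞ N]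
  [TopologicalSpace G] [ChartedSpace EG G] [IsManifold 𝓘(ℝ, EG) ∞ G]
  [TopologicalSpace M] [ChartedSpace EM M] [IsManifold 𝓘(ℝ, EM) ∞ M]
  {f : N → M} {t : G → M}

theorem mvfderiv_clm_comp {EP HP P : Type*} [NormedAddCommGroup EP] [NormedSpace ℝ EP]
    [TopologicalSpace HP] {J : ModelWithCorners ℝ EP HP} [TopologicalSpace P] [ChartedSpace HP P]
    {F F' : Type*} [NormedAddCommGroup F] [NormedSpace ℝ F] [NormedAddCommGroup F']
    [NormedSpace ℝ F'] (L : F →L[ℝ] F') {f : P → F} {p : P}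
    (hf : MDifferentiableAt J 𝓘(ℝ, F) f p) (v : TangentSpace J p) :
    mvfderiv J (L ∘ f) p v = L (mvfderiv J f p v) := by
  have h := DFunLike.congr_fun (mfderiv_comp p (L.mdifferentiableAt (x := f p)) hf) v
  rw [L.mfderiv_eq] at h
  exact h

namespace FiberProduct

variable (ht : Manifold.IsSubmersion 𝓘(ℝ, EG) 𝓘(ℝ, EM) ∞ t) (p₀ : FiberProduct f t)

theorem totChart_mem_maximalAtlas : totChart ht p₀ ∈ IsManifold.maximalAtlas 𝓘(ℝ, EG) ∞ G :=
  (submersionAt_fiberModel ht p₀.1.2).domChart_mem_maximalAtlas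

theorem baseChart_mem_maximalAtlas : baseChart ht p₀ ∈ IsManifold.maximalAtlas 𝓘(ℝ, EM) ∞ M :=
  (submersionAt_fiberModel ht p₀.1.2).codChart_mem_maximalAtlas

theorem mem_totChart_source : p₀.1.2 ∈ (totChart ht p₀).source :=
  (submersionAt_fiberModel ht p₀.1.2).mem_domChart_source

theorem mem_coordDomain : p₀.1 ∈ coordDomain EN ht p₀ :=
  ⟨mem_chart_source EN p₀.1.1, mem_totChart_source ht p₀⟩

/-- In the straightening charts `t` is the first projection; this is the differentiated form. -/
theorem mvfderiv_baseChart {g : G} (hg : g ∈ (totChart ht p₀).source)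
    (w : TangentSpace 𝓘(ℝ, EG) g) :
    mvfderiv 𝓘(ℝ, EM) (baseChart ht p₀) (t g) (mfderiv 𝓘(ℝ, EG) 𝓘(ℝ, EM) t g w) =
      (split ht p₀ (mvfderiv 𝓘(ℝ, EG) (totChart ht p₀) g w)).1 := by
  have htd : MDifferentiableAt 𝓘(ℝ, EG) 𝓘(ℝ, EM) t g :=
    ht.contMDiff.contMDiffAt.mdifferentiableAt (by simp)
  rw [← mvfderiv_comp_mfderiv ((OpenPartialHomeomorph.contMDiffAt_of_mem
    (baseChart_mem_maximalAtlas ht p₀) (base_of_mem ht p₀ hg).1).mdifferentiableAt (by simp)) htd]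
  let L : EG →L[ℝ] EM := (ContinuousLinearMap.fst ℝ EM (FiberModel EG EM)).comp
    (split ht p₀ : EG →L[ℝ] EM × FiberModel EG EM)
  have h1 : baseChart ht p₀ ∘ t =ᶠ[𝓝 g] L ∘ totChart ht p₀ := by
    filter_upwards [(totChart ht p₀).open_source.mem_nhds hg] with g' hg'
    exact (base_of_mem ht p₀ hg').2
  have h2 := DFunLike.congr_fun (h1.mfderiv_eq (I := 𝓘(ℝ, EG)) (I' := 𝓘(ℝ, EM))) w
  exact h2.trans (mvfderiv_clm_comp L ((OpenPartialHomeomorph.contMDiffAt_of_mem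
      (totChart_mem_maximalAtlas ht p₀) hg).mdifferentiableAt (by simp)) w)

theorem mvfderiv_coord {n : N} {g : G} (hp : (n, g) ∈ coordDomain EN ht p₀)
    (x : TangentSpace 𝓘(ℝ, EN) n) (ξ : TangentSpace 𝓘(ℝ, EG) g) :
    mvfderiv (𝓘(ℝ, EN).prod 𝓘(ℝ, EG)) (coord (EN := EN) ht p₀) (n, g) (x, ξ) =
      (mvfderiv 𝓘(ℝ, EN) (chartAt EN p₀.1.1) n x,
        (split ht p₀ (mvfderiv 𝓘(ℝ, EG) (totChart ht p₀) g ξ)).2) := by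
  have hc : MDifferentiableAt (𝓘(ℝ, EN).prod 𝓘(ℝ, EG)) 𝓘(ℝ, EN × FiberModel EG EM)
      (coord (EN := EN) ht p₀) (n, g) :=
    ((contMDiffOn_coord ht p₀).contMDiffAt
      ((isOpen_coordDomain ht p₀).mem_nhds hp)).mdifferentiableAt (by simp)
  have hN : MDifferentiableAt 𝓘(ℝ, EN) 𝓘(ℝ, EN) (chartAt EN p₀.1.1) n :=
    ((chartAt EN p₀.1.1).contMDiffAt_of_mem
      (IsManifold.chart_mem_maximalAtlas p₀.1.1) hp.1).mdifferentiableAt (by simp)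
  have hG : MDifferentiableAt 𝓘(ℝ, EG) 𝓘(ℝ, EG) (totChart ht p₀) g :=
    ((totChart ht p₀).contMDiffAt_of_mem
      (totChart_mem_maximalAtlas ht p₀) hp.2).mdifferentiableAt (by simp)
  refine Prod.ext ?_ ?_
  · refine (mvfderiv_clm_comp (ContinuousLinearMap.fst ℝ EN (FiberModel EG EM)) hc _).symm.trans ?_
    refine (mvfderiv_comp_mfderiv (J := 𝓘(ℝ, EN).prod 𝓘(ℝ, EG)) (I' := 𝓘(ℝ, EN))
      (φ := Prod.fst) (f := chartAt EN p₀.1.1) (p := (n, g)) hN mdifferentiableAt_fst _).trans ?_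
    rw [mfderiv_fst]
    rfl
  · refine (mvfderiv_clm_comp (ContinuousLinearMap.snd ℝ EN (FiberModel EG EM)) hc _).symm.trans ?_
    let L : EG →L[ℝ] FiberModel EG EM := (ContinuousLinearMap.snd ℝ EM (FiberModel EG EM)).comp
      (split ht p₀ : EG →L[ℝ] EM × FiberModel EG EM)
    refine (mvfderiv_clm_comp (J := 𝓘(ℝ, EN).prod 𝓘(ℝ, EG)) (p := (n, g)) L
      (f := totChart ht p₀ ∘ Prod.snd)
      (MDifferentiableAt.comp (n, g) hG mdifferentiableAt_snd) _).trans ?_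
    refine congrArg L ((mvfderiv_comp_mfderiv (J := 𝓘(ℝ, EN).prod 𝓘(ℝ, EG)) (I' := 𝓘(ℝ, EG))
      (φ := Prod.snd) (f := totChart ht p₀) (p := (n, g)) hG mdifferentiableAt_snd _).trans ?_)
    rw [mfderiv_snd]
    rfl

/-- The map `coord` forgets only the base part of the coordinates of `ξ`, and for a pair tangent to
the fibre product this part is the coordinate of `df x`. -/
theorem eq_of_mvfderiv_coord_eq
    {x y : TangentSpace 𝓘(ℝ, EN) p₀.1.1} {ξ η : TangentSpace 𝓘(ℝ, EG) p₀.1.2}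
    (hv : @Eq EM (mfderiv 𝓘(ℝ, EN) 𝓘(ℝ, EM) f p₀.1.1 x)
      (mfderiv 𝓘(ℝ, EG) 𝓘(ℝ, EM) t p₀.1.2 ξ))
    (hw : @Eq EM (mfderiv 𝓘(ℝ, EN) 𝓘(ℝ, EM) f p₀.1.1 y)
      (mfderiv 𝓘(ℝ, EG) 𝓘(ℝ, EM) t p₀.1.2 η))
    (h : mvfderiv (𝓘(ℝ, EN).prod 𝓘(ℝ, EG)) (coord (EN := EN) ht p₀) p₀.1 (x, ξ) =
      mvfderiv (𝓘(ℝ, EN).prod 𝓘(ℝ, EG)) (coord (EN := EN) ht p₀) p₀.1 (y, η)) :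
    x = y ∧ ξ = η := by
  have hm := mem_coordDomain (EN := EN) ht p₀
  have h' := (mvfderiv_coord ht p₀ hm x ξ).symm.trans (h.trans (mvfderiv_coord ht p₀ hm y η))
  rw [Prod.mk.injEq] at h'
  have h1 : x = y := (chartAt EN p₀.1.1).mvfderiv_injective
    (IsManifold.chart_mem_maximalAtlas p₀.1.1) (mem_chart_source EN p₀.1.1) h'.1
  subst h1
  refine ⟨rfl, (totChart ht p₀).mvfderiv_injective (totChart_mem_maximalAtlas ht p₀)
    (mem_totChart_source ht p₀) ((split ht p₀).injective (Prod.ext ?_ h'.2))⟩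
  rw [← mvfderiv_baseChart ht p₀ hm.2, ← mvfderiv_baseChart ht p₀ hm.2]
  exact congrArg _ (hv.symm.trans hw)

/-- Near `p₀` the fibre coordinate of `g` can be kept while its base coordinate is replaced by that
of `f n`. The result lies in the fibre product, and nothing changes if the point was already there.
The last clause identifies the tangent space of the fibre product with vectors fixed by the
derivative. -/
theorem exists_retraction (ht : Manifold.IsSubmersion 𝓘(ℝ, EG) 𝓘(ℝ, EM) ∞ t)
    (p₀ : FiberProduct f t) (hf : ContMDiff 𝓘(ℝ, EN) 𝓘(ℝ, EM) ∞ f) :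
    ∃ r : N × G → N × G, ContMDiffAt (𝓘(ℝ, EN).prod 𝓘(ℝ, EG)) (𝓘(ℝ, EN).prod 𝓘(ℝ, EG)) ∞ r p₀.1 ∧
      (∀ᶠ p in 𝓝 p₀.1, f (r p).1 = t (r p).2) ∧ (∀ᶠ p in 𝓝 p₀.1, (r p).1 = p.1) ∧
      (∀ᶠ p in 𝓝 p₀.1, f p.1 = t p.2 → r p = p) ∧
      ∀ (x : TangentSpace 𝓘(ℝ, EN) p₀.1.1) (ξ : TangentSpace 𝓘(ℝ, EG) p₀.1.2),
        @Eq EM (mfderiv 𝓘(ℝ, EN) 𝓘(ℝ, EM) f p₀.1.1 x) (mfderiv 𝓘(ℝ, EG) 𝓘(ℝ, EM) t p₀.1.2 ξ) →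
        @Eq (EN × EG) (mfderiv (𝓘(ℝ, EN).prod 𝓘(ℝ, EG)) (𝓘(ℝ, EN).prod 𝓘(ℝ, EG)) r p₀.1 (x, ξ))
          (x, ξ) := by
  have hm := mem_coordDomain (EN := EN) ht p₀
  have hcm := coord_mem ht p₀ p₀.2 hm
  have hcd : coordDomain EN ht p₀ ∈ 𝓝 p₀.1 := (isOpen_coordDomain ht p₀).mem_nhds hm
  have hpd : paramDomain (EN := EN) ht p₀ ∈ 𝓝 (coord (EN := EN) ht p₀ p₀.1) :=
    (isOpen_paramDomain ht p₀ hf).mem_nhds hcm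
  have hcs := (contMDiffOn_coord (EN := EN) ht p₀).contMDiffAt hcd
  have hps := (contMDiffOn_param (EN := EN) ht p₀ hf).contMDiffAt hpd
  have hW := hcs.continuousAt.preimage_mem_nhds hpd
  set r : N × G → N × G := param (EN := EN) ht p₀ ∘ coord (EN := EN) ht p₀ with hr
  have hrs : ContMDiffAt (𝓘(ℝ, EN).prod 𝓘(ℝ, EG)) (𝓘(ℝ, EN).prod 𝓘(ℝ, EG)) ∞ r p₀.1 :=
    hps.comp p₀.1 hcs
  have hr₀ : r p₀.1 = p₀.1 := param_coord ht p₀ p₀.2 hm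
  have hC : ∀ᶠ p in 𝓝 p₀.1, f (r p).1 = t (r p).2 := by
    filter_upwards [hW] with p hp using param_mem ht p₀ hp
  refine ⟨r, hrs, hC, ?_, ?_, ?_⟩
  · filter_upwards [hcd] with p hp using (chartAt EN p₀.1.1).left_inv hp.1
  · filter_upwards [hcd] with p hp hpC using param_coord ht p₀ hpC hp
  · intro x ξ hx
    have hrd := hrs.mdifferentiableAt (by simp : (∞ : WithTop ℕ∞) ≠ 0)
    set dr : EN × EG := mfderiv (𝓘(ℝ, EN).prod 𝓘(ℝ, EG)) (𝓘(ℝ, EN).prod 𝓘(ℝ, EG)) r p₀.1 (x, ξ)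
      with hdr
    -- `coord ∘ r = coord` near `p₀`, so `dr` and `(x, ξ)` have the same coordinates. Both are
    -- tangent to the fibre product, `dr` because `r` takes values there, so they coincide.
    have h1 : mvfderiv (𝓘(ℝ, EN).prod 𝓘(ℝ, EG)) (coord (EN := EN) ht p₀) p₀.1 dr =
        mvfderiv (𝓘(ℝ, EN).prod 𝓘(ℝ, EG)) (coord (EN := EN) ht p₀) p₀.1 (x, ξ) := by
      have h2 : coord (EN := EN) ht p₀ ∘ r =ᶠ[𝓝 p₀.1] coord (EN := EN) ht p₀ := by
        filter_upwards [hW] with p hp using coord_param ht p₀ hp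
      have h3 := mvfderiv_comp_mfderiv (f := coord (EN := EN) ht p₀) (φ := r) (p := p₀.1)
        (by rw [hr₀]; exact hcs.mdifferentiableAt (by simp)) hrd (x, ξ)
      have h4 := DFunLike.congr_fun (h2.mfderiv_eq (I := 𝓘(ℝ, EN).prod 𝓘(ℝ, EG))
        (I' := 𝓘(ℝ, EN × FiberModel EG EM))) (x, ξ)
      rw [hr₀] at h3
      exact h3.symm.trans h4
    have h2 : @Eq EM (mfderiv 𝓘(ℝ, EN) 𝓘(ℝ, EM) f p₀.1.1 dr.1)
        (mfderiv 𝓘(ℝ, EG) 𝓘(ℝ, EM) t p₀.1.2 dr.2) := by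
      have h3 : (f ∘ Prod.fst) ∘ r =ᶠ[𝓝 p₀.1] (t ∘ Prod.snd) ∘ r := hC
      have h4 := DFunLike.congr_fun (h3.mfderiv_eq (I := 𝓘(ℝ, EN).prod 𝓘(ℝ, EG))
        (I' := 𝓘(ℝ, EM))) (x, ξ)
      have hfd : HasMFDerivAt (𝓘(ℝ, EN).prod 𝓘(ℝ, EG)) 𝓘(ℝ, EM) (f ∘ Prod.fst) p₀.1 _ :=
        HasMFDerivAt.comp p₀.1 ((hf.mdifferentiable (by simp)) p₀.1.1).hasMFDerivAt
          (hasMFDerivAt_fst p₀.1)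
      have htd : HasMFDerivAt (𝓘(ℝ, EN).prod 𝓘(ℝ, EG)) 𝓘(ℝ, EM) (t ∘ Prod.snd) p₀.1 _ :=
        HasMFDerivAt.comp p₀.1 ((ht.contMDiff.mdifferentiable (by simp)) p₀.1.2).hasMFDerivAt
          (hasMFDerivAt_snd p₀.1)
      rw [← hr₀] at hfd htd
      have h5 := DFunLike.congr_fun (HasMFDerivAt.comp p₀.1 hfd hrd.hasMFDerivAt).mfderiv (x, ξ)
      have h6 := DFunLike.congr_fun (HasMFDerivAt.comp p₀.1 htd hrd.hasMFDerivAt).mfderiv (x, ξ)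
      have h7 := h5.symm.trans (h4.trans h6)
      rw [hr₀] at h7
      exact h7
    obtain ⟨h3, h4⟩ := eq_of_mvfderiv_coord_eq (x := dr.1) (ξ := dr.2) ht p₀ h2 hx h1
    exact Prod.ext h3 h4

end FiberProduct

section Within

variable {EQ Q : Type*} [NormedAddCommGroup EQ] [NormedSpace ℝ EQ]
  [TopologicalSpace Q] [ChartedSpace EQ Q] [IsManifold 𝓘(ℝ, EQ) ∞ Q] {φ : N × G → Q}

/-- Composed with the derivative of the retraction `r`, each candidate becomes the ordinary
derivative of `φ ∘ r`, which is unique; and the derivative of `r` fixes tangent vectors. The set has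
no unique derivatives in the ambient product, so agreement holds on tangent vectors only. -/
theorem HasMFDerivWithinAt.eq_of_tangent_fiberProduct
    (ht : Manifold.IsSubmersion 𝓘(ℝ, EG) 𝓘(ℝ, EM) ∞ t)
    (hf : ContMDiff 𝓘(ℝ, EN) 𝓘(ℝ, EM) ∞ f) {p : N × G} (hp : f p.1 = t p.2)
    {L₁ L₂ : TangentSpace (𝓘(ℝ, EN).prod 𝓘(ℝ, EG)) p →L[ℝ] TangentSpace 𝓘(ℝ, EQ) (φ p)}
    (h₁ : HasMFDerivWithinAt (𝓘(ℝ, EN).prod 𝓘(ℝ, EG)) 𝓘(ℝ, EQ) φ {p | f p.1 = t p.2} p L₁)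
    (h₂ : HasMFDerivWithinAt (𝓘(ℝ, EN).prod 𝓘(ℝ, EG)) 𝓘(ℝ, EQ) φ {p | f p.1 = t p.2} p L₂)
    {x : TangentSpace 𝓘(ℝ, EN) p.1} {ξ : TangentSpace 𝓘(ℝ, EG) p.2}
    (hx : @Eq EM (mfderiv 𝓘(ℝ, EN) 𝓘(ℝ, EM) f p.1 x) (mfderiv 𝓘(ℝ, EG) 𝓘(ℝ, EM) t p.2 ξ)) :
    L₁ (x, ξ) = L₂ (x, ξ) := by
  obtain ⟨r, hrs, hC, -, hid, hd⟩ := FiberProduct.exists_retraction ht ⟨p, hp⟩ hf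
  have hr₀ : r p = p := hid.self_of_nhds hp
  have hrd := (hrs.mdifferentiableAt (by simp)).hasMFDerivAt.hasMFDerivWithinAt
    (s := {q | f (r q).1 = t (r q).2})
  have key : ∀ L : TangentSpace (𝓘(ℝ, EN).prod 𝓘(ℝ, EG)) p →L[ℝ] TangentSpace 𝓘(ℝ, EQ) (φ p),
      HasMFDerivWithinAt (𝓘(ℝ, EN).prod 𝓘(ℝ, EG)) 𝓘(ℝ, EQ) φ {p | f p.1 = t p.2} p L →
      @Eq EQ (mfderiv (𝓘(ℝ, EN).prod 𝓘(ℝ, EG)) 𝓘(ℝ, EQ) (φ ∘ r) p (x, ξ)) (L (x, ξ)) := by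
    intro L hL
    have hL' : HasMFDerivWithinAt (𝓘(ℝ, EN).prod 𝓘(ℝ, EG)) 𝓘(ℝ, EQ) φ {p | f p.1 = t p.2}
        (r p) L := by rwa [hr₀]
    have h := (HasMFDerivWithinAt.comp p hL' hrd (fun q hq => hq)).hasMFDerivAt hC
    have h' := DFunLike.congr_fun h.mfderiv (x, ξ)
    refine h'.trans ?_
    exact congrArg (L : EN × EG → EQ) (hd x ξ hx)
  exact (key L₁ h₁).symm.trans (key L₂ h₂)

/-- A fibre of `t` is treated as a fibre product of `t` with a constant map. -/
theorem HasMFDerivWithinAt.eq_of_tangent_fiber {φ : G → Q}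
    (ht : Manifold.IsSubmersion 𝓘(ℝ, EG) 𝓘(ℝ, EM) ∞ t) {g : G} {m : M} (hg : t g = m)
    {L₁ L₂ : TangentSpace 𝓘(ℝ, EG) g →L[ℝ] TangentSpace 𝓘(ℝ, EQ) (φ g)}
    (h₁ : HasMFDerivWithinAt 𝓘(ℝ, EG) 𝓘(ℝ, EQ) φ {h | t h = m} g L₁)
    (h₂ : HasMFDerivWithinAt 𝓘(ℝ, EG) 𝓘(ℝ, EQ) φ {h | t h = m} g L₂)
    {ξ : TangentSpace 𝓘(ℝ, EG) g} (hξ : mfderiv 𝓘(ℝ, EG) 𝓘(ℝ, EM) t g ξ = 0) :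
    L₁ ξ = L₂ ξ := by
  have key : ∀ L : TangentSpace 𝓘(ℝ, EG) g →L[ℝ] TangentSpace 𝓘(ℝ, EQ) (φ g),
      HasMFDerivWithinAt 𝓘(ℝ, EG) 𝓘(ℝ, EQ) φ {h | t h = m} g L →
      HasMFDerivWithinAt (𝓘(ℝ, EG).prod 𝓘(ℝ, EG)) 𝓘(ℝ, EQ) (φ ∘ Prod.snd)
        {p : G × G | (fun _ : G => m) p.1 = t p.2} (g, g)
        (L.comp (ContinuousLinearMap.snd ℝ (TangentSpace 𝓘(ℝ, EG) g)
          (TangentSpace 𝓘(ℝ, EG) g))) := by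
    intro L hL
    exact HasMFDerivWithinAt.comp (g, g) hL (hasMFDerivAt_snd (g, g)).hasMFDerivWithinAt
      (fun q hq => hq.symm)
  have h := (key L₁ h₁).eq_of_tangent_fiberProduct ht (contMDiff_const) hg.symm (key L₂ h₂)
    (x := 0) (ξ := ξ) (by rw [map_zero]; exact hξ.symm)
  exact h

/-- The extension is `φ ∘ r` with the retraction `r`. The comparison of derivatives at all nearby
points of the fibre product, not just at `p₀`, is what allows the smoothness of derivatives within
it to be proved. -/
theorem FiberProduct.exists_extension (ht : Manifold.IsSubmersion 𝓘(ℝ, EG) 𝓘(ℝ, EM) ∞ t)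
    (hf : ContMDiff 𝓘(ℝ, EN) 𝓘(ℝ, EM) ∞ f)
    (hφ : ContMDiffOn (𝓘(ℝ, EN).prod 𝓘(ℝ, EG)) 𝓘(ℝ, EQ) ∞ φ {p | f p.1 = t p.2})
    {p₀ : N × G} (hp₀ : f p₀.1 = t p₀.2) :
    ∃ φ' : N × G → Q, ContMDiffAt (𝓘(ℝ, EN).prod 𝓘(ℝ, EG)) 𝓘(ℝ, EQ) ∞ φ' p₀ ∧
      ∀ᶠ p in 𝓝 p₀, f p.1 = t p.2 → φ' p = φ p ∧
        ∀ (x : TangentSpace 𝓘(ℝ, EN) p.1) (ξ : TangentSpace 𝓘(ℝ, EG) p.2),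
          @Eq EM (mfderiv 𝓘(ℝ, EN) 𝓘(ℝ, EM) f p.1 x) (mfderiv 𝓘(ℝ, EG) 𝓘(ℝ, EM) t p.2 ξ) →
          @Eq EQ (mfderiv (𝓘(ℝ, EN).prod 𝓘(ℝ, EG)) 𝓘(ℝ, EQ) φ' p (x, ξ))
            (mfderivWithin (𝓘(ℝ, EN).prod 𝓘(ℝ, EG)) 𝓘(ℝ, EQ) φ {p | f p.1 = t p.2} p (x, ξ)) := by
  obtain ⟨r, hrs, hC, -, hid, hd⟩ := FiberProduct.exists_retraction ht ⟨p₀, hp₀⟩ hf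
  have hr₀ : r p₀ = p₀ := hid.self_of_nhds hp₀
  have hs : ContMDiffAt (𝓘(ℝ, EN).prod 𝓘(ℝ, EG)) 𝓘(ℝ, EQ) ∞ (φ ∘ r) p₀ := by
    have h1 : ContMDiffWithinAt (𝓘(ℝ, EN).prod 𝓘(ℝ, EG)) 𝓘(ℝ, EQ) ∞ φ {p | f p.1 = t p.2}
        (r p₀) := by
      rw [hr₀]
      exact hφ p₀ hp₀
    exact (h1.comp p₀ (hrs.contMDiffWithinAt (s := {q | f (r q).1 = t (r q).2}))
      fun q hq => hq).contMDiffAt hC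
  refine ⟨φ ∘ r, hs, ?_⟩
  have : IsManifold (𝓘(ℝ, EN).prod 𝓘(ℝ, EG)) 1 (N × G) :=
    IsManifold.of_le (n := ∞) (by simp)
  have : IsManifold 𝓘(ℝ, EQ) 1 Q := IsManifold.of_le (n := ∞) (by simp)
  have hsd : ∀ᶠ p in 𝓝 p₀, MDifferentiableAt (𝓘(ℝ, EN).prod 𝓘(ℝ, EG)) 𝓘(ℝ, EQ) (φ ∘ r) p :=
    ((contMDiffAt_iff_contMDiffAt_nhds (n := 1) (by simp)).1 (hs.of_le (by simp))).mono
    fun y hy => hy.mdifferentiableAt (by simp)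
  filter_upwards [hid.eventually_nhds, hsd] with p hp1 hp2 hpC
  have hp3 : (φ ∘ r) p = φ p := congrArg φ (hp1.self_of_nhds hpC)
  refine ⟨hp3, fun x ξ hx => ?_⟩
  have h1 := (((hφ p hpC).mdifferentiableWithinAt (by simp))).hasMFDerivWithinAt
  have h2 := hp2.hasMFDerivAt.hasMFDerivWithinAt (s := {p | f p.1 = t p.2})
  have h3 : HasMFDerivWithinAt (𝓘(ℝ, EN).prod 𝓘(ℝ, EG)) 𝓘(ℝ, EQ) φ {p | f p.1 = t p.2} p
      (mfderiv (𝓘(ℝ, EN).prod 𝓘(ℝ, EG)) 𝓘(ℝ, EQ) (φ ∘ r) p) := by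
    refine h2.congr_of_eventuallyEq ?_ hp3.symm
    filter_upwards [nhdsWithin_le_nhds hp1, self_mem_nhdsWithin] with q hq hqC
    exact (congrArg φ (hq hqC)).symm
  exact h3.eq_of_tangent_fiberProduct ht hf hpC h1 hx

variable {EP HP P : Type*} [NormedAddCommGroup EP] [NormedSpace ℝ EP] [TopologicalSpace HP]
  {J : ModelWithCorners ℝ EP HP} [TopologicalSpace P] [ChartedSpace HP P] [IsManifold J ∞ P]

theorem ContMDiffAt.prodMk_along {b : P → N} {c : P → G} {x : ∀ p, TangentSpace 𝓘(ℝ, EN) (b p)}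
    {ξ : ∀ p, TangentSpace 𝓘(ℝ, EG) (c p)} {p₀ : P}
    (hx : ContMDiffAt J 𝓘(ℝ, EN).tangent ∞ (fun p => (⟨b p, x p⟩ : TangentBundle 𝓘(ℝ, EN) N)) p₀)
    (hξ : ContMDiffAt J 𝓘(ℝ, EG).tangent ∞
      (fun p => (⟨c p, ξ p⟩ : TangentBundle 𝓘(ℝ, EG) G)) p₀) :
    ContMDiffAt J (𝓘(ℝ, EN).prod 𝓘(ℝ, EG)).tangent ∞
      (fun p => (⟨(b p, c p), (x p, ξ p)⟩ : TangentBundle (𝓘(ℝ, EN).prod 𝓘(ℝ, EG)) (N × G))) p₀ := by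
  have : IsManifold 𝓘(ℝ, EN) (∞ + 1) N := ‹IsManifold 𝓘(ℝ, EN) ∞ N›
  have : IsManifold 𝓘(ℝ, EG) (∞ + 1) G := ‹IsManifold 𝓘(ℝ, EG) ∞ G›
  exact (contMDiff_equivTangentBundleProd_symm (I := 𝓘(ℝ, EN)) (I' := 𝓘(ℝ, EG)) (M := N)
    (M' := G) (n := ∞)).contMDiffAt.comp p₀ (hx.prodMk hξ)

/-- On tangent vectors the derivative within the fibre product is that of a smooth local extension,
which varies smoothly. -/
theorem FiberProduct.contMDiffAt_mfderivWithin_along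
    (ht : Manifold.IsSubmersion 𝓘(ℝ, EG) 𝓘(ℝ, EM) ∞ t)
    (hf : ContMDiff 𝓘(ℝ, EN) 𝓘(ℝ, EM) ∞ f)
    (hφ : ContMDiffOn (𝓘(ℝ, EN).prod 𝓘(ℝ, EG)) 𝓘(ℝ, EQ) ∞ φ {p | f p.1 = t p.2})
    {b : P → N} {c : P → G} {x : ∀ p, TangentSpace 𝓘(ℝ, EN) (b p)}
    {ξ : ∀ p, TangentSpace 𝓘(ℝ, EG) (c p)} {p₀ : P}
    (hx : ContMDiffAt J 𝓘(ℝ, EN).tangent ∞ (fun p => (⟨b p, x p⟩ : TangentBundle 𝓘(ℝ, EN) N)) p₀)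
    (hξ : ContMDiffAt J 𝓘(ℝ, EG).tangent ∞
      (fun p => (⟨c p, ξ p⟩ : TangentBundle 𝓘(ℝ, EG) G)) p₀)
    (hbc : ∀ p, f (b p) = t (c p))
    (hT : ∀ p, @Eq EM (mfderiv 𝓘(ℝ, EN) 𝓘(ℝ, EM) f (b p) (x p))
      (mfderiv 𝓘(ℝ, EG) 𝓘(ℝ, EM) t (c p) (ξ p))) :
    ContMDiffAt J 𝓘(ℝ, EQ).tangent ∞
      (fun p => (⟨φ (b p, c p), mfderivWithin (𝓘(ℝ, EN).prod 𝓘(ℝ, EG)) 𝓘(ℝ, EQ) φ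
        {p | f p.1 = t p.2} (b p, c p) (x p, ξ p)⟩ : TangentBundle 𝓘(ℝ, EQ) Q)) p₀ := by
  obtain ⟨φ', hφ', h⟩ := FiberProduct.exists_extension ht hf hφ (p₀ := (b p₀, c p₀)) (hbc p₀)
  have hxξ := hx.prodMk_along hξ
  have hbc' : ContinuousAt (fun p => (b p, c p)) p₀ :=
    (Bundle.contMDiffAt_totalSpace.1 hxξ).1.continuousAt
  refine (ContMDiffAt.tangentMap_along (b := fun p => (b p, c p)) hφ' hxξ).congr_of_eventuallyEq ?_
  filter_upwards [hbc'.eventually h] with p hp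
  exact tangentBundle_mk_eq (hp (hbc p)).1.symm ((hp (hbc p)).2 _ _ (hT p)).symm

end Within

end Retraction

theorem VecField.apply_congr {E M : Type*} [NormedAddCommGroup E] [NormedSpace ℝ E]
    [TopologicalSpace M] [ChartedSpace E M] (X : VecField E M) {x y : M} (h : x = y) :
    @Eq E (X x) (X y) := by
  subst h
  rfl

theorem mfderiv_congr_apply {E E' M M' : Type*} [NormedAddCommGroup E] [NormedSpace ℝ E]
    [TopologicalSpace M] [ChartedSpace E M] [NormedAddCommGroup E'] [NormedSpace ℝ E']
    [TopologicalSpace M'] [ChartedSpace E' M'] (f : M → M') {x y : M} (h : x = y)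
    {v : TangentSpace 𝓘(ℝ, E) x} {w : TangentSpace 𝓘(ℝ, E) y} (hvw : @Eq E v w) :
    @Eq E' (mfderiv 𝓘(ℝ, E) 𝓘(ℝ, E') f x v) (mfderiv 𝓘(ℝ, E) 𝓘(ℝ, E') f y w) := by
  subst h
  exact congrArg (mfderiv 𝓘(ℝ, E) 𝓘(ℝ, E') f x) hvw

theorem Manifold.IsSubmersion.mfderiv_surjective {EG EM G M : Type*}
    [NormedAddCommGroup EG] [NormedSpace ℝ EG] [FiniteDimensional ℝ EG]
    [NormedAddCommGroup EM] [NormedSpace ℝ EM] [FiniteDimensional ℝ EM]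
    [TopologicalSpace G] [ChartedSpace EG G] [IsManifold 𝓘(ℝ, EG) ∞ G]
    [TopologicalSpace M] [ChartedSpace EM M] [IsManifold 𝓘(ℝ, EM) ∞ M] {t : G → M}
    (ht : Manifold.IsSubmersion 𝓘(ℝ, EG) 𝓘(ℝ, EM) ∞ t) (g : G) :
    Function.Surjective (mfderiv 𝓘(ℝ, EG) 𝓘(ℝ, EM) t g) := by
  intro w
  -- The fibre product of `t` with itself only serves to access the charts straightening `t` at `g`.
  let p₀ : FiberProduct t t := ⟨(g, g), rfl⟩
  have hg := FiberProduct.mem_totChart_source ht p₀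
  refine ⟨(FiberProduct.totChart ht p₀).coordField ((FiberProduct.split ht p₀).symm
    (mvfderiv 𝓘(ℝ, EM) (FiberProduct.baseChart ht p₀) (t g) w, 0)) g, ?_⟩
  refine (FiberProduct.baseChart ht p₀).mvfderiv_injective
    (FiberProduct.baseChart_mem_maximalAtlas ht p₀) (FiberProduct.base_of_mem ht p₀ hg).1 ?_
  rw [FiberProduct.mvfderiv_baseChart ht p₀ hg, (FiberProduct.totChart ht p₀).mvfderiv_coordField
    (FiberProduct.totChart_mem_maximalAtlas ht p₀) hg, ContinuousLinearEquiv.apply_symm_apply]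

/-! ### Tangent multiplication and left-invariant vector fields -/

namespace GroupoidMaps

variable {EG EM G M : Type*}
  [NormedAddCommGroup EG] [NormedSpace ℝ EG] [FiniteDimensional ℝ EG]
  [NormedAddCommGroup EM] [NormedSpace ℝ EM] [FiniteDimensional ℝ EM]
  [TopologicalSpace G] [ChartedSpace EG G] [IsManifold 𝓘(ℝ, EG) ∞ G]
  [TopologicalSpace M] [ChartedSpace EM M] [IsManifold 𝓘(ℝ, EM) ∞ M]
  {𝒢 : GroupoidMaps EG EM G M} [h𝒢 : IsLieGroupoid 𝒢]

theorem contMDiff_src : ContMDiff 𝓘(ℝ, EG) 𝓘(ℝ, EM) ∞ 𝒢.src := h𝒢.src_submersion.contMDiff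

theorem contMDiff_tgt : ContMDiff 𝓘(ℝ, EG) 𝓘(ℝ, EM) ∞ 𝒢.tgt := h𝒢.tgt_submersion.contMDiff

theorem mdifferentiableAt_src (g : G) : MDifferentiableAt 𝓘(ℝ, EG) 𝓘(ℝ, EM) 𝒢.src g :=
  contMDiff_src.mdifferentiable (by simp) g

theorem mdifferentiableAt_tgt (g : G) : MDifferentiableAt 𝓘(ℝ, EG) 𝓘(ℝ, EM) 𝒢.tgt g :=
  contMDiff_tgt.mdifferentiable (by simp) g

theorem mdifferentiableAt_one (m : M) : MDifferentiableAt 𝓘(ℝ, EM) 𝓘(ℝ, EG) 𝒢.one m :=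
  h𝒢.one_smooth.mdifferentiable (by simp) m

theorem hasMFDerivWithinAt_mul {g h : G} (hgh : 𝒢.src g = 𝒢.tgt h) :
    HasMFDerivWithinAt (𝓘(ℝ, EG).prod 𝓘(ℝ, EG)) 𝓘(ℝ, EG) (fun p : G × G => 𝒢.mul p.1 p.2)
      𝒢.composable (g, h) (mfderivWithin (𝓘(ℝ, EG).prod 𝓘(ℝ, EG)) 𝓘(ℝ, EG)
        (fun p : G × G => 𝒢.mul p.1 p.2) 𝒢.composable (g, h)) :=
  ((h𝒢.mul_smooth (g, h) hgh).mdifferentiableWithinAt (by simp)).hasMFDerivWithinAt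

/-- An identity `φ (g ∘ h) = ψ (g, h)` on composable pairs may be differentiated along composable
tangent vectors, because derivatives within the fibre product of `src` and `tgt` are determined
there. -/
theorem mfderiv_tangentMul_of_eqOn {EQ Q : Type*} [NormedAddCommGroup EQ] [NormedSpace ℝ EQ]
    [TopologicalSpace Q] [ChartedSpace EQ Q] [IsManifold 𝓘(ℝ, EQ) ∞ Q] {φ : G → Q}
    {ψ : G × G → Q} {g h : G} (hgh : 𝒢.src g = 𝒢.tgt h)
    {L : TangentSpace (𝓘(ℝ, EG).prod 𝓘(ℝ, EG)) (g, h) →L[ℝ] TangentSpace 𝓘(ℝ, EQ) (ψ (g, h))}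
    (hφ : MDifferentiableAt 𝓘(ℝ, EG) 𝓘(ℝ, EQ) φ (𝒢.mul g h))
    (hψ : HasMFDerivWithinAt (𝓘(ℝ, EG).prod 𝓘(ℝ, EG)) 𝓘(ℝ, EQ) ψ 𝒢.composable (g, h) L)
    (heq : ∀ p ∈ 𝒢.composable, φ (𝒢.mul p.1 p.2) = ψ p)
    {v : TangentSpace 𝓘(ℝ, EG) g} {w : TangentSpace 𝓘(ℝ, EG) h}
    (hvw : @Eq EM (mfderiv 𝓘(ℝ, EG) 𝓘(ℝ, EM) 𝒢.src g v) (mfderiv 𝓘(ℝ, EG) 𝓘(ℝ, EM) 𝒢.tgt h w)) :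
    @Eq EQ (mfderiv 𝓘(ℝ, EG) 𝓘(ℝ, EQ) φ (𝒢.mul g h) (𝒢.tangentMul v w)) (L (v, w)) := by
  have h1 := HasMFDerivWithinAt.comp (g, h) (u := univ) (hφ.hasMFDerivAt.hasMFDerivWithinAt)
    (hasMFDerivWithinAt_mul hgh) (fun _ _ => mem_univ _)
  have h2 : HasMFDerivWithinAt (𝓘(ℝ, EG).prod 𝓘(ℝ, EG)) 𝓘(ℝ, EQ) ψ 𝒢.composable (g, h) _ :=
    h1.congr_of_eventuallyEq (Filter.eventuallyEq_of_mem self_mem_nhdsWithin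
      fun p hp => (heq p hp).symm) (heq (g, h) hgh).symm
  exact HasMFDerivWithinAt.eq_of_tangent_fiberProduct h𝒢.tgt_submersion
    (contMDiff_src (𝒢 := 𝒢)) hgh h2 hψ hvw

theorem mfderiv_tgt_tangentMul {g h : G} (hgh : 𝒢.src g = 𝒢.tgt h)
    {v : TangentSpace 𝓘(ℝ, EG) g} {w : TangentSpace 𝓘(ℝ, EG) h}
    (hvw : @Eq EM (mfderiv 𝓘(ℝ, EG) 𝓘(ℝ, EM) 𝒢.src g v) (mfderiv 𝓘(ℝ, EG) 𝓘(ℝ, EM) 𝒢.tgt h w)) :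
    @Eq EM (mfderiv 𝓘(ℝ, EG) 𝓘(ℝ, EM) 𝒢.tgt (𝒢.mul g h) (𝒢.tangentMul v w))
      (mfderiv 𝓘(ℝ, EG) 𝓘(ℝ, EM) 𝒢.tgt g v) :=
  mfderiv_tangentMul_of_eqOn (ψ := 𝒢.tgt ∘ Prod.fst) hgh (mdifferentiableAt_tgt _)
    (HasMFDerivAt.comp (g, h) (mdifferentiableAt_tgt g).hasMFDerivAt
      (hasMFDerivAt_fst (g, h))).hasMFDerivWithinAt (fun _ hp => h𝒢.tgt_mul _ _ hp) hvw

theorem src_eq_tgt_one (g : G) : 𝒢.src g = 𝒢.tgt (𝒢.one (𝒢.src g)) := (h𝒢.tgt_one _).symm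

/-- Left translation is multiplication with the first factor fixed. In this form the dependence on
`g` is governed by the single map `mul`, which yields the smoothness of left-invariant fields. -/
theorem leftInvariant_eq_tangentMul {ν : 𝒢.Sec} (hν : ∀ m, ν m ∈ 𝒢.vertical (𝒢.one m)) (g : G) :
    @Eq EG (𝒢.leftInvariant ν g)
      (𝒢.tangentMul (0 : TangentSpace 𝓘(ℝ, EG) g) (ν (𝒢.src g))) := by
  have hg := src_eq_tgt_one (𝒢 := 𝒢) g
  have h0 : HasMFDerivAt 𝓘(ℝ, EG) (𝓘(ℝ, EG).prod 𝓘(ℝ, EG)) (fun h : G => (g, h))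
      (𝒢.one (𝒢.src g)) _ := (hasMFDerivAt_const g _).prodMk (hasMFDerivAt_id _)
  have h1 : HasMFDerivWithinAt 𝓘(ℝ, EG) 𝓘(ℝ, EG) (fun h => 𝒢.mul g h)
      {h | 𝒢.tgt h = 𝒢.src g} (𝒢.one (𝒢.src g)) _ :=
    HasMFDerivWithinAt.comp (f := fun h : G => (g, h)) (g := fun p : G × G => 𝒢.mul p.1 p.2)
      (𝒢.one (𝒢.src g)) (hasMFDerivWithinAt_mul hg)
      h0.hasMFDerivWithinAt (fun h (hh : 𝒢.tgt h = 𝒢.src g) => hh.symm)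
  have h2 := h1.mdifferentiableWithinAt.hasMFDerivWithinAt
  have h3 := h2.eq_of_tangent_fiber h𝒢.tgt_submersion hg.symm h1 (hν (𝒢.src g))
  exact h3

theorem mfderiv_src_zero_eq {ν : 𝒢.Sec} (hν : ∀ m, ν m ∈ 𝒢.vertical (𝒢.one m)) (g : G) :
    @Eq EM (mfderiv 𝓘(ℝ, EG) 𝓘(ℝ, EM) 𝒢.src g 0)
      (mfderiv 𝓘(ℝ, EG) 𝓘(ℝ, EM) 𝒢.tgt (𝒢.one (𝒢.src g)) (ν (𝒢.src g))) := by
  rw [map_zero]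
  exact Eq.symm (hν (𝒢.src g))

theorem leftInvariant_mk_eq {ν : 𝒢.Sec} (hν : ∀ m, ν m ∈ 𝒢.vertical (𝒢.one m)) (g : G) :
    (⟨g, 𝒢.leftInvariant ν g⟩ : TangentBundle 𝓘(ℝ, EG) G) =
      ⟨𝒢.mul g (𝒢.one (𝒢.src g)),
        𝒢.tangentMul (0 : TangentSpace 𝓘(ℝ, EG) g) (ν (𝒢.src g))⟩ :=
  tangentBundle_mk_eq (h𝒢.mul_one g).symm (leftInvariant_eq_tangentMul hν g)

theorem smoothAt_leftInvariant {ν : 𝒢.Sec} (hν : 𝒢.IsSection ν) (g : G) :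
    (𝒢.leftInvariant ν).SmoothAt g := by
  unfold VecField.SmoothAt
  simp_rw [leftInvariant_mk_eq hν.mem_vertical]
  refine FiberProduct.contMDiffAt_mfderivWithin_along (f := 𝒢.src) (t := 𝒢.tgt)
    (φ := fun p : G × G => 𝒢.mul p.1 p.2) (b := fun g => g) (c := fun g => 𝒢.one (𝒢.src g))
    (x := fun g => 0) (ξ := fun g => ν (𝒢.src g)) h𝒢.tgt_submersion contMDiff_src h𝒢.mul_smooth
    (ContMDiffAt.zero_along contMDiffAt_id)
    (hν.smooth.contMDiffAt.comp g contMDiff_src.contMDiffAt) (fun g => src_eq_tgt_one g)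
    (fun g => mfderiv_src_zero_eq hν.mem_vertical g)

theorem mfderiv_tgt_leftInvariant {ν : 𝒢.Sec} (hν : ∀ m, ν m ∈ 𝒢.vertical (𝒢.one m)) (g : G) :
    mfderiv 𝓘(ℝ, EG) 𝓘(ℝ, EM) 𝒢.tgt g (𝒢.leftInvariant ν g) = 0 := by
  have h := mfderiv_tgt_tangentMul (src_eq_tgt_one g) (mfderiv_src_zero_eq hν g)
  have h1 := mfderiv_congr_apply (E := EG) (E' := EM) 𝒢.tgt (h𝒢.mul_one g).symm (leftInvariant_eq_tangentMul hν g)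
  exact h1.trans (h.trans (map_zero _))

theorem leftInvariant_one {ν : 𝒢.Sec} (hν : ∀ m, ν m ∈ 𝒢.vertical (𝒢.one m)) (m : M) :
    𝒢.leftInvariant ν (𝒢.one m) = ν m := by
  -- The point `src (one m)` equals `m` only propositionally, so it is replaced by a variable in all
  -- places at once.
  have key : ∀ m₁ : M, m₁ = m → @Eq EG (mfderivWithin 𝓘(ℝ, EG) 𝓘(ℝ, EG)
      (fun h => 𝒢.mul (𝒢.one m) h) {h | 𝒢.tgt h = m₁} (𝒢.one m₁) (ν m₁)) (ν m) := by
    rintro _ rfl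
    rename_i m
    have h1 : HasMFDerivWithinAt 𝓘(ℝ, EG) 𝓘(ℝ, EG) (fun h => 𝒢.mul (𝒢.one m) h)
        {h | 𝒢.tgt h = m} (𝒢.one m) (ContinuousLinearMap.id ℝ (TangentSpace 𝓘(ℝ, EG) (𝒢.one m))) := by
      have hEq : ∀ h : G, 𝒢.tgt h = m → 𝒢.mul (𝒢.one m) h = h := by
        rintro h rfl
        exact h𝒢.one_mul h
      refine (hasMFDerivAt_id (𝒢.one m)).hasMFDerivWithinAt.congr_of_eventuallyEq
        (Filter.eventuallyEq_of_mem self_mem_nhdsWithin fun h hh => hEq h hh)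
        (hEq _ (h𝒢.tgt_one m))
    exact h1.mdifferentiableWithinAt.hasMFDerivWithinAt.eq_of_tangent_fiber
      h𝒢.tgt_submersion (h𝒢.tgt_one m) h1 (hν m)
  exact key _ (h𝒢.src_one m)

theorem leftInvariant_add (ν μ : 𝒢.Sec) :
    𝒢.leftInvariant (ν + μ) = 𝒢.leftInvariant ν + 𝒢.leftInvariant μ :=
  funext fun _ => map_add _ _ _

theorem leftInvariant_smul (f : M → ℝ) (ν : 𝒢.Sec) :
    𝒢.leftInvariant (fun m => f m • ν m) = (f ∘ 𝒢.src) • 𝒢.leftInvariant ν :=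
  funext fun _ => map_smul _ _ _

theorem leftInvariant_eventuallyEq {ν μ : 𝒢.Sec} {m : M} (h : ∀ᶠ x in 𝓝 m, ν x = μ x) :
    𝒢.leftInvariant ν =ᶠ[𝓝 (𝒢.one m)] 𝒢.leftInvariant μ := by
  have h1 : ∀ᶠ g in 𝓝 (𝒢.one m), ν (𝒢.src g) = μ (𝒢.src g) := by
    have hc : Filter.Tendsto 𝒢.src (𝓝 (𝒢.one m)) (𝓝 m) := by
      have := (contMDiff_src (𝒢 := 𝒢)).continuous.tendsto (𝒢.one m)
      rwa [h𝒢.src_one] at this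
    exact hc.eventually h
  filter_upwards [h1] with g hg
  exact congrArg (mfderivWithin 𝓘(ℝ, EG) 𝓘(ℝ, EG) (fun h => 𝒢.mul g h) {h | 𝒢.tgt h = 𝒢.src g}
    (𝒢.one (𝒢.src g))) hg

/-! #### Sections of the Lie algebroid -/

theorem isSection_zero : 𝒢.IsSection 0 :=
  ⟨fun _ => zero_mem _, fun m => ContMDiffAt.zero_along (h𝒢.one_smooth m)⟩

theorem IsSection.add {ν μ : 𝒢.Sec} (hν : 𝒢.IsSection ν) (hμ : 𝒢.IsSection μ) :
    𝒢.IsSection (ν + μ) :=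
  ⟨fun m => add_mem (hν.mem_vertical m) (hμ.mem_vertical m),
    fun m => (hν.smooth m).add_along (hμ.smooth m)⟩

theorem IsSection.smul {f : M → ℝ} {ν : 𝒢.Sec} (hf : ContMDiff 𝓘(ℝ, EM) 𝓘(ℝ, ℝ) ∞ f)
    (hν : 𝒢.IsSection ν) : 𝒢.IsSection (fun m => f m • ν m) :=
  ⟨fun m => Submodule.smul_mem _ _ (hν.mem_vertical m), fun m => (hf m).smul_along (hν.smooth m)⟩

theorem smooth_anchor {ν : 𝒢.Sec} (hν : 𝒢.IsSection ν) : (𝒢.anchor ν).Smooth := by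
  refine VecField.smooth_iff.2 fun m => ?_
  have h := ContMDiffAt.tangentMap_along (f := 𝒢.src) (b := 𝒢.one)
    contMDiff_src.contMDiffAt (hν.smooth m)
  unfold VecField.SmoothAt
  refine h.congr_of_eventuallyEq (Filter.Eventually.of_forall fun x => ?_)
  exact tangentBundle_mk_eq (h𝒢.src_one x).symm rfl

theorem anchor_add (ν μ : 𝒢.Sec) : 𝒢.anchor (ν + μ) = 𝒢.anchor ν + 𝒢.anchor μ :=
  funext fun _ => map_add _ _ _

theorem anchor_smul (f : M → ℝ) (ν : 𝒢.Sec) :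
    𝒢.anchor (fun m => f m • ν m) = fun m => f m • 𝒢.anchor ν m :=
  funext fun _ => map_smul _ _ _

/-- The field `X` is `tgt`-related to `V` and `ν_l` to `0`, so the bracket is related to `[V, 0] =
0`. With `V = 0` this serves the algebroid bracket, with `X` a horizontal lift the induced
connection. -/
theorem mfderiv_tgt_mlieBracket {X : VecField EG G} {V : VecField EM M} {ν : 𝒢.Sec}
    (hν : 𝒢.IsSection ν) {g : G} (hX : X.SmoothAt g) (hV : V.SmoothAt (𝒢.tgt g))
    (h : ∀ g, mfderiv 𝓘(ℝ, EG) 𝓘(ℝ, EM) 𝒢.tgt g (X g) = V (𝒢.tgt g)) :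
    mfderiv 𝓘(ℝ, EG) 𝓘(ℝ, EM) 𝒢.tgt g
      (VectorField.mlieBracket 𝓘(ℝ, EG) X (𝒢.leftInvariant ν) g) = 0 := by
  have := FiniteDimensional.complete ℝ EG
  have := FiniteDimensional.complete ℝ EM
  rw [mfderiv_mlieBracket_of_related (V' := V) (W' := 0) contMDiff_tgt.contMDiffAt hX
    (smoothAt_leftInvariant hν g) hV (ContMDiffAt.zero_along contMDiffAt_id)
    (Filter.Eventually.of_forall h)
    (Filter.Eventually.of_forall fun g => mfderiv_tgt_leftInvariant hν.mem_vertical g)]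
  simp

theorem contMDiffAt_mlieBracket_one {X Y : VecField EG G} {m : M}
    (hX : X.SmoothAt (𝒢.one m)) (hY : Y.SmoothAt (𝒢.one m)) :
    ContMDiffAt 𝓘(ℝ, EM) 𝓘(ℝ, EG).tangent ∞ (fun m => (⟨𝒢.one m,
      VectorField.mlieBracket 𝓘(ℝ, EG) X Y (𝒢.one m)⟩ : TangentBundle 𝓘(ℝ, EG) G)) m := by
  have := FiniteDimensional.complete ℝ EG
  have : IsManifold 𝓘(ℝ, EG) ((⊤ : ℕ∞) + 1) G := ‹IsManifold 𝓘(ℝ, EG) ∞ G›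
  have : IsManifold 𝓘(ℝ, EG) (minSmoothness ℝ 2) G := by
    rw [minSmoothness_of_isRCLikeNormedField]
    exact IsManifold.of_le (n := ∞) two_le_infty
  have h := ContMDiffAt.mlieBracket_vectorField (m := ⊤) (n := ⊤) hX hY
    (by simp)
  exact ContMDiffAt.comp m h (h𝒢.one_smooth m)

theorem isSection_bracket {ν μ : 𝒢.Sec} (hν : 𝒢.IsSection ν) (hμ : 𝒢.IsSection μ) :
    𝒢.IsSection (𝒢.bracket ν μ) :=
  ⟨fun _ => mfderiv_tgt_mlieBracket (V := 0) hμ (smoothAt_leftInvariant hν _)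
    (ContMDiffAt.zero_along contMDiffAt_id) fun g => mfderiv_tgt_leftInvariant hν.mem_vertical g,
   fun _ => contMDiffAt_mlieBracket_one (smoothAt_leftInvariant hν _)
    (smoothAt_leftInvariant hμ _)⟩

theorem bracket_swap (ν μ : 𝒢.Sec) : 𝒢.bracket ν μ = -𝒢.bracket μ ν :=
  funext fun _ => VectorField.mlieBracket_swap_apply

theorem bracket_add_right {ν μ μ' : 𝒢.Sec} (hμ : 𝒢.IsSection μ) (hμ' : 𝒢.IsSection μ') :
    𝒢.bracket ν (μ + μ') = 𝒢.bracket ν μ + 𝒢.bracket ν μ' := by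
  have := FiniteDimensional.complete ℝ EG
  have : IsManifold 𝓘(ℝ, EG) 2 G := IsManifold.of_le (n := ∞) two_le_infty
  funext m
  simp only [bracket, leftInvariant_add]
  exact VectorField.mlieBracket_add_right
    (ContMDiffAt.mdifferentiableAt (smoothAt_leftInvariant hμ _) (by simp))
    (ContMDiffAt.mdifferentiableAt (smoothAt_leftInvariant hμ' _) (by simp))

/-- Common source of both Leibniz rules: since `(f ν)_l = (f ∘ src) ν_l`, the function is
differentiated along the image of `X` under `d src`, which is the anchor for the bracket and `V` for
the connection. -/
theorem mlieBracket_smul_src_one {X : VecField EG G} {f : M → ℝ} {ν : 𝒢.Sec}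
    (hf : ContMDiff 𝓘(ℝ, EM) 𝓘(ℝ, ℝ) ∞ f) (hν : 𝒢.IsSection ν) (m : M) :
    VectorField.mlieBracket 𝓘(ℝ, EG) X (𝒢.leftInvariant fun m => f m • ν m) (𝒢.one m) =
      f m • VectorField.mlieBracket 𝓘(ℝ, EG) X (𝒢.leftInvariant ν) (𝒢.one m) +
        (mvfderiv 𝓘(ℝ, EM) f m
          (mfderiv 𝓘(ℝ, EG) 𝓘(ℝ, EM) 𝒢.src (𝒢.one m) (X (𝒢.one m)))) • ν m := by
  have := FiniteDimensional.complete ℝ EG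
  have : IsManifold 𝓘(ℝ, EG) 2 G := IsManifold.of_le (n := ∞) two_le_infty
  have hd : MDifferentiableAt 𝓘(ℝ, EM) 𝓘(ℝ, ℝ) f (𝒢.src (𝒢.one m)) :=
    hf.mdifferentiable (by simp) _
  rw [leftInvariant_smul, VectorField.mlieBracket_smul_right
    (hd.comp (𝒢.one m) (mdifferentiableAt_src _))
    (ContMDiffAt.mdifferentiableAt (smoothAt_leftInvariant hν _) (by simp)),
    leftInvariant_one hν.mem_vertical, add_comm,
    mvfderiv_comp_mfderiv hd (mdifferentiableAt_src _)]
  simp only [Function.comp_apply, h𝒢.src_one]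
  exact congrArg₂ (· + ·) rfl (congrArg (· • ν m)
    (mfderiv_congr_apply (E := EM) (E' := ℝ) f (h𝒢.src_one m) rfl))

theorem bracket_smul_right {f : M → ℝ} {ν μ : 𝒢.Sec} (hf : ContMDiff 𝓘(ℝ, EM) 𝓘(ℝ, ℝ) ∞ f)
    (hν : 𝒢.IsSection ν) (hμ : 𝒢.IsSection μ) :
    𝒢.bracket ν (fun m => f m • μ m) =
      fun m => f m • 𝒢.bracket ν μ m + (𝒢.anchor ν).deriv f m • μ m := by
  funext m
  refine (mlieBracket_smul_src_one hf hμ m).trans ?_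
  rw [leftInvariant_one hν.mem_vertical]
  rfl

theorem bracket_congr {ν ν' μ μ' : 𝒢.Sec} {m : M} (hν : ∀ᶠ x in 𝓝 m, ν x = ν' x)
    (hμ : ∀ᶠ x in 𝓝 m, μ x = μ' x) : 𝒢.bracket ν μ m = 𝒢.bracket ν' μ' m :=
  (leftInvariant_eventuallyEq hν).mlieBracket_vectorField_eq (leftInvariant_eventuallyEq hμ)

end GroupoidMaps

/-! ### Horizontal lifts and the induced connection -/

namespace GroupoidMaps

variable {EG EM G M : Type*}
  [NormedAddCommGroup EG] [NormedSpace ℝ EG] [FiniteDimensional ℝ EG]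
  [NormedAddCommGroup EM] [NormedSpace ℝ EM] [FiniteDimensional ℝ EM]
  [TopologicalSpace G] [ChartedSpace EG G] [IsManifold 𝓘(ℝ, EG) ∞ G]
  [TopologicalSpace M] [ChartedSpace EM M] [IsManifold 𝓘(ℝ, EM) ∞ M]
  {𝒢 : GroupoidMaps EG EM G M} [h𝒢 : IsLieGroupoid 𝒢]
  {H : ∀ g : G, Submodule ℝ (TangentSpace 𝓘(ℝ, EG) g)}

theorem exists_mem_horizontal (hH : ∀ g, IsCompl (H g) (𝒢.vertical g)) (g : G)
    (w : TangentSpace 𝓘(ℝ, EM) (𝒢.tgt g)) :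
    ∃ γ ∈ H g, mfderiv 𝓘(ℝ, EG) 𝓘(ℝ, EM) 𝒢.tgt g γ = w := by
  obtain ⟨v, rfl⟩ := h𝒢.tgt_submersion.mfderiv_surjective g w
  obtain ⟨a, ha, b, hb, rfl⟩ := Submodule.mem_sup.1
    ((hH g).sup_eq_top ▸ Submodule.mem_top : v ∈ H g ⊔ 𝒢.vertical g)
  refine ⟨a, ha, ?_⟩
  have hb' : mfderiv 𝓘(ℝ, EG) 𝓘(ℝ, EM) 𝒢.tgt g b = 0 := hb
  rw [map_add, hb', add_zero]

theorem eq_of_mem_horizontal (hH : ∀ g, IsCompl (H g) (𝒢.vertical g)) {g : G}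
    {v w : TangentSpace 𝓘(ℝ, EG) g} (hv : v ∈ H g) (hw : w ∈ H g)
    (h : mfderiv 𝓘(ℝ, EG) 𝓘(ℝ, EM) 𝒢.tgt g v = mfderiv 𝓘(ℝ, EG) 𝓘(ℝ, EM) 𝒢.tgt g w) : v = w := by
  have h1 : v - w ∈ 𝒢.vertical g := by
    change mfderiv 𝓘(ℝ, EG) 𝓘(ℝ, EM) 𝒢.tgt g (v - w) = 0
    rw [map_sub, h, sub_self]
  exact sub_eq_zero.1 (Submodule.disjoint_def.1 (hH g).disjoint _ (sub_mem hv hw) h1)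

theorem horLift_mem (hH : ∀ g, IsCompl (H g) (𝒢.vertical g)) (V : VecField EM M) (g : G) :
    𝒢.horLift H V g ∈ H g :=
  (Classical.epsilon_spec (exists_mem_horizontal hH g (V (𝒢.tgt g)))).1

theorem mfderiv_tgt_horLift (hH : ∀ g, IsCompl (H g) (𝒢.vertical g)) (V : VecField EM M) (g : G) :
    mfderiv 𝓘(ℝ, EG) 𝓘(ℝ, EM) 𝒢.tgt g (𝒢.horLift H V g) = V (𝒢.tgt g) :=
  (Classical.epsilon_spec (exists_mem_horizontal hH g (V (𝒢.tgt g)))).2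

/-- Complementarity makes the choice in `horLift` forced; every formula for horizontal lifts is
obtained by exhibiting a candidate. -/
theorem eq_horLift (hH : ∀ g, IsCompl (H g) (𝒢.vertical g)) {V : VecField EM M} {g : G}
    {v : TangentSpace 𝓘(ℝ, EG) g} (hv : v ∈ H g)
    (h : mfderiv 𝓘(ℝ, EG) 𝓘(ℝ, EM) 𝒢.tgt g v = V (𝒢.tgt g)) : v = 𝒢.horLift H V g :=
  eq_of_mem_horizontal hH hv (horLift_mem hH V g) (h.trans (mfderiv_tgt_horLift hH V g).symm)

theorem horLift_add (hH : ∀ g, IsCompl (H g) (𝒢.vertical g)) (V W : VecField EM M) :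
    𝒢.horLift H (V + W) = 𝒢.horLift H V + 𝒢.horLift H W := by
  funext g
  refine (eq_horLift hH (add_mem (horLift_mem hH V g) (horLift_mem hH W g)) ?_).symm
  rw [map_add, mfderiv_tgt_horLift hH, mfderiv_tgt_horLift hH]
  rfl

theorem horLift_smul (hH : ∀ g, IsCompl (H g) (𝒢.vertical g)) (f : M → ℝ) (V : VecField EM M) :
    𝒢.horLift H (fun m => f m • V m) = (f ∘ 𝒢.tgt) • 𝒢.horLift H V := by
  funext g
  refine (eq_horLift hH (Submodule.smul_mem _ _ (horLift_mem hH V g)) ?_).symm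
  rw [map_smul, mfderiv_tgt_horLift hH]
  rfl

theorem mfderiv_tgt_mfderiv_one (m : M) (v : TangentSpace 𝓘(ℝ, EM) m) :
    @Eq EM (mfderiv 𝓘(ℝ, EG) 𝓘(ℝ, EM) 𝒢.tgt (𝒢.one m) (mfderiv 𝓘(ℝ, EM) 𝓘(ℝ, EG) 𝒢.one m v)) v := by
  have h := DFunLike.congr_fun (mfderiv_comp m (mdifferentiableAt_tgt (𝒢 := 𝒢) (𝒢.one m))
    (mdifferentiableAt_one (𝒢 := 𝒢) m)) v
  have h1 : 𝒢.tgt ∘ 𝒢.one = id := funext h𝒢.tgt_one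
  rw [h1, mfderiv_id] at h
  exact h.symm

theorem mfderiv_src_mfderiv_one (m : M) (v : TangentSpace 𝓘(ℝ, EM) m) :
    @Eq EM (mfderiv 𝓘(ℝ, EG) 𝓘(ℝ, EM) 𝒢.src (𝒢.one m) (mfderiv 𝓘(ℝ, EM) 𝓘(ℝ, EG) 𝒢.one m v)) v := by
  have h := DFunLike.congr_fun (mfderiv_comp m (mdifferentiableAt_src (𝒢 := 𝒢) (𝒢.one m))
    (mdifferentiableAt_one (𝒢 := 𝒢) m)) v
  have h1 : 𝒢.src ∘ 𝒢.one = id := funext h𝒢.src_one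
  rw [h1, mfderiv_id] at h
  exact h.symm

/-- Vectors tangent to the units are horizontal because `H` is a subgroupoid over all of `TM`, and
`tgt ∘ one` is the identity. -/
theorem horLift_one (hH : 𝒢.IsCartanConnection H) (V : VecField EM M) (m : M) :
    𝒢.horLift H V (𝒢.one m) = mfderiv 𝓘(ℝ, EM) 𝓘(ℝ, EG) 𝒢.one m (V m) :=
  (eq_horLift hH.isCompl (hH.multiplicative.one_mem m (V m))
    ((mfderiv_tgt_mfderiv_one m (V m)).trans (V.apply_congr (h𝒢.tgt_one m).symm))).symm

/-- Local sections of `H` through lifts of a basis at `g₀` still project to a basis nearby. Solving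
a linear system with smooth, invertible matrix expresses the horizontal lift through them. -/
theorem smoothAt_horLift (hH : ∀ g, IsCompl (H g) (𝒢.vertical g)) (hs : IsSmoothDistribution H)
    {V : VecField EM M} {g₀ : G} (hV : V.SmoothAt (𝒢.tgt g₀)) : (𝒢.horLift H V).SmoothAt g₀ := by
  have := FiniteDimensional.complete ℝ EM
  set e := chartAt EM (𝒢.tgt g₀)
  have he : e ∈ IsManifold.maximalAtlas 𝓘(ℝ, EM) ∞ M := IsManifold.chart_mem_maximalAtlas _
  have hx : 𝒢.tgt g₀ ∈ e.source := mem_chart_source EM _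
  set bs := Module.finBasis ℝ EM
  have hex : ∀ i, ∃ (U : Set G) (Y : VecField EG G), IsOpen U ∧ g₀ ∈ U ∧ Y.SmoothOn U ∧
      mfderiv 𝓘(ℝ, EG) 𝓘(ℝ, EM) 𝒢.tgt g₀ (Y g₀) = e.coordField (bs i) (𝒢.tgt g₀) ∧
      ∀ x ∈ U, Y x ∈ H x := by
    intro i
    obtain ⟨γ, hγ, hγ'⟩ := exists_mem_horizontal hH g₀ (e.coordField (bs i) (𝒢.tgt g₀))
    obtain ⟨U, hU, hgU, Y, hY, hYg, hYH⟩ := hs.exists_local_section g₀ γ hγ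
    exact ⟨U, Y, hU, hgU, hY, by rw [hYg, hγ'], hYH⟩
  choose U Y hU hgU hYs hY₀ hYH using hex
  have hYs' : ∀ i, (Y i).SmoothAt g₀ := fun i =>
    (hYs i).contMDiffAt ((hU i).mem_nhds (hgU i))
  have hec := e.contMDiffAt_of_mem he hx
  let a : Fin (Module.finrank ℝ EM) → G → EM := fun i g =>
    mvfderiv 𝓘(ℝ, EM) e (𝒢.tgt g) (mfderiv 𝓘(ℝ, EG) 𝓘(ℝ, EM) 𝒢.tgt g (Y i g))
  have ha : ∀ i, ContMDiffAt 𝓘(ℝ, EG) 𝓘(ℝ, EM) ∞ (a i) g₀ := fun i =>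
    hec.mvfderiv_apply_along (b := 𝒢.tgt)
      (ContMDiffAt.tangentMap_along (b := fun g => g) contMDiff_tgt.contMDiffAt (hYs' i))
  let c : Fin (Module.finrank ℝ EM) → EM →L[ℝ] ℝ := fun i =>
    LinearMap.toContinuousLinearMap (bs.coord i)
  -- `B g` sends the basis vector `bs i` to the projection of `Y i g`, in coordinates; by the choice
  -- of the `Y i` it is the identity at `g₀`.
  let B : G → EM →L[ℝ] EM := fun g => ∑ i, (c i).smulRight (a i g)
  have hB : ContMDiffAt 𝓘(ℝ, EG) 𝓘(ℝ, EM →L[ℝ] EM) ∞ B g₀ := by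
    refine ContMDiffAt.sum fun i _ => ?_
    exact (ContinuousLinearMap.smulRightL ℝ EM EM (c i)).contMDiff.contMDiffAt.comp g₀ (ha i)
  have hB₀ : B g₀ = ContinuousLinearMap.id ℝ EM := by
    ext u
    have : ∀ i, a i g₀ = bs i := fun i => by
      simp only [a, hY₀ i]
      exact e.mvfderiv_coordField he hx _
    simp only [B, sum_apply, ContinuousLinearMap.smulRight_apply, this,
      ContinuousLinearMap.id_apply]
    exact bs.sum_repr u
  have hinv : (B g₀).IsInvertible := by
    rw [hB₀]
    exact ⟨ContinuousLinearEquiv.refl ℝ EM, rfl⟩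
  have hBinv : ContMDiffAt 𝓘(ℝ, EG) 𝓘(ℝ, EM →L[ℝ] EM) ∞ (fun g => (B g).inverse) g₀ :=
    ContMDiffAt.comp g₀ hinv.contDiffAt_map_inverse.contMDiffAt hB
  have hBev : ∀ᶠ g in 𝓝 g₀, (B g).IsInvertible := by
    have : range ((↑) : (EM ≃L[ℝ] EM) → EM →L[ℝ] EM) ∈ 𝓝 (B g₀) := by
      obtain ⟨A, hA⟩ := hinv
      rw [← hA]
      exact A.nhds
    exact hB.continuousAt.eventually this
  let d : G → EM := fun g => (B g).inverse (mvfderiv 𝓘(ℝ, EM) e (𝒢.tgt g) (V (𝒢.tgt g)))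
  have hd : ContMDiffAt 𝓘(ℝ, EG) 𝓘(ℝ, EM) ∞ d g₀ :=
    hBinv.clm_apply (hec.mvfderiv_apply_along (b := 𝒢.tgt)
      (ContMDiffAt.comp g₀ hV contMDiff_tgt.contMDiffAt))
  have hZ : ContMDiffAt 𝓘(ℝ, EG) 𝓘(ℝ, EG).tangent ∞
      (fun g => (⟨g, ∑ i, c i (d g) • Y i g⟩ : TangentBundle 𝓘(ℝ, EG) G)) g₀ :=
    ContMDiffAt.sum_along contMDiffAt_id fun i _ =>
      ContMDiffAt.smul_along (b := fun g => g) ((c i).contMDiff.contMDiffAt.comp g₀ hd) (hYs' i)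
  refine hZ.congr_of_eventuallyEq ?_
  have hUev : ∀ᶠ g in 𝓝 g₀, ∀ i, g ∈ U i :=
    Filter.eventually_all.2 fun i => (hU i).mem_nhds (hgU i)
  filter_upwards [hBev, hUev, (contMDiff_tgt (𝒢 := 𝒢)).continuous.continuousAt.preimage_mem_nhds
    (e.open_source.mem_nhds hx)] with g h1 h2 h3
  refine tangentBundle_mk_eq rfl (eq_horLift hH ?_ ?_).symm
  · exact Submodule.sum_mem _ fun i _ => Submodule.smul_mem _ _ (hYH i g (h2 i))
  · refine e.mvfderiv_injective he h3 ?_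
    have h4 : B g (d g) = mvfderiv 𝓘(ℝ, EM) e (𝒢.tgt g) (V (𝒢.tgt g)) :=
      h1.self_apply_inverse _
    rw [← h4]
    simp only [map_sum, map_smul, B, sum_apply,
      ContinuousLinearMap.smulRight_apply, a]

theorem smooth_horLift (hH : 𝒢.IsCartanConnection H) {V : VecField EM M} (hV : V.Smooth) (g : G) :
    (𝒢.horLift H V).SmoothAt g :=
  smoothAt_horLift hH.isCompl hH.multiplicative.smooth (VecField.smooth_iff.1 hV _)

theorem isConnection_inducedConnection (hH : 𝒢.IsCartanConnection H) :
    𝒢.IsConnection (𝒢.inducedConnection H) := by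
  have := FiniteDimensional.complete ℝ EG
  have : IsManifold 𝓘(ℝ, EG) 2 G := IsManifold.of_le (n := ∞) two_le_infty
  have hhd : ∀ {V : VecField EM M} (_ : V.Smooth) (g : G), MDifferentiableAt 𝓘(ℝ, EG)
      𝓘(ℝ, EG).tangent (fun g => (⟨g, 𝒢.horLift H V g⟩ : TangentBundle 𝓘(ℝ, EG) G)) g :=
    fun hV g => ContMDiffAt.mdifferentiableAt (smooth_horLift hH hV g) (by simp)
  have hld : ∀ {ν : 𝒢.Sec} (_ : 𝒢.IsSection ν) (g : G), MDifferentiableAt 𝓘(ℝ, EG)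
      𝓘(ℝ, EG).tangent (fun g => (⟨g, 𝒢.leftInvariant ν g⟩ : TangentBundle 𝓘(ℝ, EG) G)) g :=
    fun hν g => ContMDiffAt.mdifferentiableAt (smoothAt_leftInvariant hν g) (by simp)
  refine ⟨fun V ν hV hν => ⟨fun m => ?_, fun m => ?_⟩, fun V W ν hV hW hν => ?_,
    fun V ν μ hV hν hμ => ?_, fun f V ν hf hV hν => ?_, fun f V ν hf hV hν => ?_⟩
  · exact mfderiv_tgt_mlieBracket hν (smooth_horLift hH hV _) (VecField.smooth_iff.1 hV _)
      (mfderiv_tgt_horLift hH.isCompl V)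
  · exact contMDiffAt_mlieBracket_one (smooth_horLift hH hV _) (smoothAt_leftInvariant hν _)
  · funext m
    simp only [inducedConnection, horLift_add hH.isCompl]
    exact VectorField.mlieBracket_add_left (hhd hV _) (hhd hW _)
  · funext m
    simp only [inducedConnection, leftInvariant_add]
    exact VectorField.mlieBracket_add_right (hld hν _) (hld hμ _)
  · funext m
    simp only [inducedConnection, horLift_smul hH.isCompl]
    have hd : MDifferentiableAt 𝓘(ℝ, EM) 𝓘(ℝ, ℝ) f (𝒢.tgt (𝒢.one m)) :=
      hf.mdifferentiable (by simp) _
    -- The coefficient is `f ∘ tgt`, whose derivative along the vertical field `ν_l` vanishes, so no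
    -- extra term appears.
    rw [VectorField.mlieBracket_smul_left (hd.comp (𝒢.one m) (mdifferentiableAt_tgt _)) (hhd hV _),
      mvfderiv_comp_mfderiv hd (mdifferentiableAt_tgt _),
      mfderiv_tgt_leftInvariant hν.mem_vertical, map_zero, neg_zero, zero_smul, zero_add,
      Function.comp_apply, h𝒢.tgt_one]
  · funext m
    refine (mlieBracket_smul_src_one hf hν m).trans ?_
    -- Along the units the lift of `V` is `d one (V)`, which `d src` sends back to `V`.
    rw [horLift_one hH]
    exact congrArg₂ (· + ·) rfl (congrArg (· • ν m) (congrArg (mvfderiv 𝓘(ℝ, EM) f m)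
      (mfderiv_src_mfderiv_one m (V m))))

end GroupoidMaps

/-! ### Derivatives and brackets of smooth vector fields -/

namespace VecField

variable {E M : Type*} [NormedAddCommGroup E] [NormedSpace ℝ E] [FiniteDimensional ℝ E]
  [TopologicalSpace M] [ChartedSpace E M] [IsManifold 𝓘(ℝ, E) ∞ M]

theorem contMDiff_deriv {V : VecField E M} {f : M → ℝ} (hV : V.Smooth)
    (hf : ContMDiff 𝓘(ℝ, E) 𝓘(ℝ, ℝ) ∞ f) : ContMDiff 𝓘(ℝ, E) 𝓘(ℝ, ℝ) ∞ (V.deriv f) :=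
  fun x => (hf x).mvfderiv_apply_along (b := fun x => x) (smooth_iff.1 hV x)

theorem deriv_add (V W : VecField E M) (f : M → ℝ) (m : M) :
    (V + W).deriv f m = V.deriv f m + W.deriv f m :=
  map_add (mvfderiv 𝓘(ℝ, E) f m) (V m) (W m)

theorem deriv_mlieBracket {V W : VecField E M} {f : M → ℝ} (hV : V.Smooth) (hW : W.Smooth)
    (hf : ContMDiff 𝓘(ℝ, E) 𝓘(ℝ, ℝ) ∞ f) (m : M) :
    VecField.deriv (VectorField.mlieBracket 𝓘(ℝ, E) V W) f m =
      V.deriv (W.deriv f) m - W.deriv (V.deriv f) m :=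
  have := FiniteDimensional.complete ℝ E
  mvfderiv_mlieBracket_of_smoothAt (hf m) (smooth_iff.1 hV m) (smooth_iff.1 hW m)

theorem Smooth.mdifferentiableAt {V : VecField E M} (hV : V.Smooth) (m : M) :
    MDifferentiableAt 𝓘(ℝ, E) 𝓘(ℝ, E).tangent (fun x => (⟨x, V x⟩ : TangentBundle 𝓘(ℝ, E) M)) m :=
  ContMDiffAt.mdifferentiableAt (smooth_iff.1 hV m) (by simp)

theorem Smooth.mlieBracket {V W : VecField E M} (hV : V.Smooth) (hW : W.Smooth) :
    VecField.Smooth (VectorField.mlieBracket 𝓘(ℝ, E) V W) := by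
  have := FiniteDimensional.complete ℝ E
  have : IsManifold 𝓘(ℝ, E) ((⊤ : ℕ∞) + 1) M := ‹IsManifold 𝓘(ℝ, E) ∞ M›
  have : IsManifold 𝓘(ℝ, E) (minSmoothness ℝ 2) M := by
    rw [minSmoothness_of_isRCLikeNormedField]
    exact IsManifold.of_le (n := ∞) two_le_infty
  exact smooth_iff.2 fun x => ContMDiffAt.mlieBracket_vectorField (m := ⊤) (n := ⊤)
    (smooth_iff.1 hV x) (smooth_iff.1 hW x) (by simp)

theorem mlieBracket_add_right {V W W' : VecField E M} (hW : W.Smooth) (hW' : W'.Smooth) :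
    VectorField.mlieBracket 𝓘(ℝ, E) V (W + W') =
      VectorField.mlieBracket 𝓘(ℝ, E) V W + VectorField.mlieBracket 𝓘(ℝ, E) V W' := by
  have := FiniteDimensional.complete ℝ E
  have : IsManifold 𝓘(ℝ, E) 2 M := IsManifold.of_le (n := ∞) two_le_infty
  exact funext fun m =>
    VectorField.mlieBracket_add_right (hW.mdifferentiableAt m) (hW'.mdifferentiableAt m)

theorem mlieBracket_add_left {V V' W : VecField E M} (hV : V.Smooth) (hV' : V'.Smooth) :
    VectorField.mlieBracket 𝓘(ℝ, E) (V + V') W =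
      VectorField.mlieBracket 𝓘(ℝ, E) V W + VectorField.mlieBracket 𝓘(ℝ, E) V' W := by
  have := FiniteDimensional.complete ℝ E
  have : IsManifold 𝓘(ℝ, E) 2 M := IsManifold.of_le (n := ∞) two_le_infty
  exact funext fun m =>
    VectorField.mlieBracket_add_left (hV.mdifferentiableAt m) (hV'.mdifferentiableAt m)

theorem mlieBracket_smul_right {V W : VecField E M} {f : M → ℝ}
    (hf : ContMDiff 𝓘(ℝ, E) 𝓘(ℝ, ℝ) ∞ f) (hW : W.Smooth) :
    VectorField.mlieBracket 𝓘(ℝ, E) V (fun m => f m • W m) =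
      (fun m => f m • VectorField.mlieBracket 𝓘(ℝ, E) V W m) + fun m => V.deriv f m • W m := by
  have := FiniteDimensional.complete ℝ E
  have : IsManifold 𝓘(ℝ, E) 2 M := IsManifold.of_le (n := ∞) two_le_infty
  funext m
  exact (VectorField.mlieBracket_smul_right (hf.mdifferentiable (by simp) m)
    (hW.mdifferentiableAt m)).trans (add_comm _ _)

theorem mlieBracket_smul_left {V W : VecField E M} {f : M → ℝ}
    (hf : ContMDiff 𝓘(ℝ, E) 𝓘(ℝ, ℝ) ∞ f) (hV : V.Smooth) :
    VectorField.mlieBracket 𝓘(ℝ, E) (fun m => f m • V m) W =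
      (fun m => f m • VectorField.mlieBracket 𝓘(ℝ, E) V W m) - fun m => W.deriv f m • V m := by
  have := FiniteDimensional.complete ℝ E
  have : IsManifold 𝓘(ℝ, E) 2 M := IsManifold.of_le (n := ∞) two_le_infty
  funext m
  refine (VectorField.mlieBracket_smul_left (hf.mdifferentiable (by simp) m)
    (hV.mdifferentiableAt m)).trans ?_
  rw [neg_smul, neg_add_eq_sub]
  rfl

end VecField

/-! ### Calculus of connections and basic connections -/

namespace GroupoidMaps

variable {EG EM G M : Type*}
  [NormedAddCommGroup EG] [NormedSpace ℝ EG] [FiniteDimensional ℝ EG]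
  [NormedAddCommGroup EM] [NormedSpace ℝ EM] [FiniteDimensional ℝ EM]
  [TopologicalSpace G] [ChartedSpace EG G] [IsManifold 𝓘(ℝ, EG) ∞ G]
  [TopologicalSpace M] [ChartedSpace EM M] [IsManifold 𝓘(ℝ, EM) ∞ M]
  {𝒢 : GroupoidMaps EG EM G M} [h𝒢 : IsLieGroupoid 𝒢] {D : 𝒢.ConnOp}

theorem IsSection.neg {ν : 𝒢.Sec} (hν : 𝒢.IsSection ν) : 𝒢.IsSection (-ν) := by
  have h := hν.smul (f := fun _ => -1) contMDiff_const
  have h' : (fun m => (-1 : ℝ) • ν m) = -ν := funext fun m => neg_one_smul ℝ (ν m)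
  rwa [h'] at h

theorem bracket_smul_right' {f : M → ℝ} {ν μ : 𝒢.Sec} (hf : ContMDiff 𝓘(ℝ, EM) 𝓘(ℝ, ℝ) ∞ f)
    (hν : 𝒢.IsSection ν) (hμ : 𝒢.IsSection μ) :
    𝒢.bracket ν (fun m => f m • μ m) =
      (fun m => f m • 𝒢.bracket ν μ m) + fun m => (𝒢.anchor ν).deriv f m • μ m :=
  bracket_smul_right hf hν hμ

theorem bracket_smul_left {f : M → ℝ} {ν μ : 𝒢.Sec} (hf : ContMDiff 𝓘(ℝ, EM) 𝓘(ℝ, ℝ) ∞ f)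
    (hν : 𝒢.IsSection ν) (hμ : 𝒢.IsSection μ) :
    𝒢.bracket (fun m => f m • ν m) μ =
      (fun m => f m • 𝒢.bracket ν μ m) - fun m => (𝒢.anchor μ).deriv f m • ν m := by
  rw [bracket_swap, bracket_smul_right hf hμ hν, bracket_swap ν μ]
  funext m
  simp only [Pi.neg_apply, Pi.sub_apply]
  module

theorem bracket_add_left {ν ν' μ : 𝒢.Sec} (hν : 𝒢.IsSection ν) (hν' : 𝒢.IsSection ν') :
    𝒢.bracket (ν + ν') μ = 𝒢.bracket ν μ + 𝒢.bracket ν' μ := by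
  rw [bracket_swap, bracket_add_right hν hν', bracket_swap ν, bracket_swap ν', neg_add]

namespace IsConnection

theorem leibniz' (hD : 𝒢.IsConnection D) {f : M → ℝ} {V : VecField EM M} {ν : 𝒢.Sec}
    (hf : ContMDiff 𝓘(ℝ, EM) 𝓘(ℝ, ℝ) ∞ f) (hV : V.Smooth) (hν : 𝒢.IsSection ν) :
    D V (fun m => f m • ν m) = (fun m => f m • D V ν m) + fun m => V.deriv f m • ν m :=
  hD.leibniz f V ν hf hV hν

theorem zero_right (hD : 𝒢.IsConnection D) {V : VecField EM M} (hV : V.Smooth) : D V 0 = 0 := by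
  have h := hD.add_right V 0 0 hV isSection_zero isSection_zero
  simpa using h

theorem zero_left (hD : 𝒢.IsConnection D) {ν : 𝒢.Sec} (hν : 𝒢.IsSection ν) : D 0 ν = 0 := by
  have h := hD.add_left 0 0 ν VecField.smooth_zero VecField.smooth_zero hν
  simpa using h

theorem neg_right (hD : 𝒢.IsConnection D) {V : VecField EM M} {ν : 𝒢.Sec} (hV : V.Smooth)
    (hν : 𝒢.IsSection ν) : D V (-ν) = -D V ν := by
  have h := hD.add_right V ν (-ν) hV hν hν.neg
  rw [add_neg_cancel, hD.zero_right hV] at h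
  exact (neg_eq_of_add_eq_zero_right h.symm).symm

theorem neg_left (hD : 𝒢.IsConnection D) {V : VecField EM M} {ν : 𝒢.Sec} (hV : V.Smooth)
    (hν : 𝒢.IsSection ν) : D (-V) ν = -D V ν := by
  have hV' : (-V).Smooth := by
    have h := VecField.Smooth.smul (f := fun _ => (-1 : ℝ)) contMDiff_const hV
    have h' : (fun m => (-1 : ℝ) • V m) = -V := funext fun m => neg_one_smul ℝ (V m)
    rwa [h'] at h
  have h := hD.add_left V (-V) ν hV hV' hν
  rw [add_neg_cancel, hD.zero_left hν] at h
  exact (neg_eq_of_add_eq_zero_right h.symm).symm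

theorem smooth_basicVec (hD : 𝒢.IsConnection D) {ν : 𝒢.Sec} {V : VecField EM M}
    (hν : 𝒢.IsSection ν) (hV : V.Smooth) : (𝒢.basicVec D ν V).Smooth :=
  (smooth_anchor (hD.isSection V ν hV hν)).add ((smooth_anchor hν).mlieBracket hV)

/-- The term `V(f) ρ(ν)` from the Leibniz rule cancels against the one from `[f ρ(ν), V]`. -/
theorem basicVec_smul_left (hD : 𝒢.IsConnection D) {f : M → ℝ} {ν : 𝒢.Sec} {V : VecField EM M}
    (hf : ContMDiff 𝓘(ℝ, EM) 𝓘(ℝ, ℝ) ∞ f) (hν : 𝒢.IsSection ν) (hV : V.Smooth) :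
    𝒢.basicVec D (fun m => f m • ν m) V = fun m => f m • 𝒢.basicVec D ν V m := by
  rw [basicVec, hD.leibniz' hf hV hν, anchor_add, anchor_smul, anchor_smul, anchor_smul,
    VecField.mlieBracket_smul_left hf (smooth_anchor hν)]
  funext m
  simp only [basicVec, Pi.add_apply, Pi.sub_apply]
  module

theorem basicVec_smul_right (hD : 𝒢.IsConnection D) {f : M → ℝ} {ν : 𝒢.Sec} {V : VecField EM M}
    (hf : ContMDiff 𝓘(ℝ, EM) 𝓘(ℝ, ℝ) ∞ f) (hν : 𝒢.IsSection ν) (hV : V.Smooth) :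
    𝒢.basicVec D ν (fun m => f m • V m) =
      (fun m => f m • 𝒢.basicVec D ν V m) + fun m => (𝒢.anchor ν).deriv f m • V m := by
  rw [basicVec, hD.smul_left f V ν hf hV hν, anchor_smul, VecField.mlieBracket_smul_right hf hV]
  funext m
  simp only [basicVec, Pi.add_apply]
  module

theorem basicVec_add_left (hD : 𝒢.IsConnection D) {ν ν' : 𝒢.Sec} {V : VecField EM M}
    (hν : 𝒢.IsSection ν) (hν' : 𝒢.IsSection ν') (hV : V.Smooth) :
    𝒢.basicVec D (ν + ν') V = 𝒢.basicVec D ν V + 𝒢.basicVec D ν' V := by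
  rw [basicVec, hD.add_right V ν ν' hV hν hν', anchor_add, anchor_add,
    VecField.mlieBracket_add_left (smooth_anchor hν) (smooth_anchor hν')]
  simp only [basicVec]
  abel

theorem basicVec_add_right (hD : 𝒢.IsConnection D) {ν : 𝒢.Sec} {V V' : VecField EM M}
    (hν : 𝒢.IsSection ν) (hV : V.Smooth) (hV' : V'.Smooth) :
    𝒢.basicVec D ν (V + V') = 𝒢.basicVec D ν V + 𝒢.basicVec D ν V' := by
  rw [basicVec, hD.add_left V V' ν hV hV' hν, anchor_add, VecField.mlieBracket_add_right hV hV']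
  simp only [basicVec]
  abel

/-! #### Tensoriality of the basic curvature -/

theorem basicCurvature_swap (hD : 𝒢.IsConnection D) {ν₁ ν₂ : 𝒢.Sec} {V : VecField EM M}
    (h₁ : 𝒢.IsSection ν₁) (h₂ : 𝒢.IsSection ν₂) (hV : V.Smooth) :
    𝒢.basicCurvature D ν₁ ν₂ V = -𝒢.basicCurvature D ν₂ ν₁ V := by
  simp only [basicCurvature]
  rw [bracket_swap ν₁ ν₂, hD.neg_right hV (isSection_bracket h₂ h₁), bracket_swap (D V ν₁),
    bracket_swap ν₁]
  abel

theorem basicCurvature_add_right (hD : 𝒢.IsConnection D) {ν₁ ν₂ ν₃ : 𝒢.Sec} {V : VecField EM M}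
    (h₁ : 𝒢.IsSection ν₁) (h₂ : 𝒢.IsSection ν₂) (h₃ : 𝒢.IsSection ν₃) (hV : V.Smooth) :
    𝒢.basicCurvature D ν₁ (ν₂ + ν₃) V =
      𝒢.basicCurvature D ν₁ ν₂ V + 𝒢.basicCurvature D ν₁ ν₃ V := by
  simp only [basicCurvature]
  rw [bracket_add_right h₂ h₃, hD.add_right _ _ _ hV (isSection_bracket h₁ h₂)
    (isSection_bracket h₁ h₃), bracket_add_right h₂ h₃, hD.add_right _ _ _ hV h₂ h₃,
    bracket_add_right (hD.isSection _ _ hV h₂) (hD.isSection _ _ hV h₃),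
    hD.basicVec_add_left h₂ h₃ hV, hD.add_left _ _ _ (hD.smooth_basicVec h₂ hV)
    (hD.smooth_basicVec h₃ hV) h₁, hD.add_right _ _ _ (hD.smooth_basicVec h₁ hV) h₂ h₃]
  abel

/-- The surplus is a multiple of `ν₂` with coefficient `V(ρ(ν₁) f) - ρ(ν₁)(V f) - ρ(∇_V ν₁) f +
(∇^bas_ν₁ V) f`, which is zero by the definition of `∇^bas_ν₁ V`. -/
theorem basicCurvature_smul_right (hD : 𝒢.IsConnection D) {f : M → ℝ} {ν₁ ν₂ : 𝒢.Sec}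
    {V : VecField EM M} (hf : ContMDiff 𝓘(ℝ, EM) 𝓘(ℝ, ℝ) ∞ f)
    (h₁ : 𝒢.IsSection ν₁) (h₂ : 𝒢.IsSection ν₂) (hV : V.Smooth) :
    𝒢.basicCurvature D ν₁ (fun m => f m • ν₂ m) V =
      fun m => f m • 𝒢.basicCurvature D ν₁ ν₂ V m := by
  have hVf := VecField.contMDiff_deriv hV hf
  have hρf := VecField.contMDiff_deriv (smooth_anchor h₁) hf
  have hb := isSection_bracket h₁ h₂
  have hD2 := hD.isSection V ν₂ hV h₂
  simp only [basicCurvature]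
  rw [bracket_smul_right' hf h₁ h₂, hD.add_right _ _ _ hV (hb.smul hf) (h₂.smul hρf),
    hD.leibniz' hf hV hb, hD.leibniz' hρf hV h₂,
    bracket_smul_right' hf (hD.isSection V ν₁ hV h₁) h₂, hD.leibniz' hf hV h₂,
    bracket_add_right (hD2.smul hf) (h₂.smul hVf), bracket_smul_right' hf h₁ hD2,
    bracket_smul_right' hVf h₁ h₂, hD.basicVec_smul_left hf h₂ hV,
    hD.smul_left _ _ _ hf (hD.smooth_basicVec h₂ hV) h₁,
    hD.leibniz' hf (hD.smooth_basicVec h₁ hV) h₂]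
  funext m
  -- The bracket in `∇^bas_ν₁ V` contributes precisely the commutator of second derivatives of `f`.
  have hs : (𝒢.basicVec D ν₁ V).deriv f m = (𝒢.anchor (D V ν₁)).deriv f m +
      ((𝒢.anchor ν₁).deriv (V.deriv f) m - V.deriv ((𝒢.anchor ν₁).deriv f) m) := by
    rw [basicVec, VecField.deriv_add, VecField.deriv_mlieBracket (smooth_anchor h₁) hV hf]
  simp only [Pi.add_apply, Pi.sub_apply, hs]
  module

theorem basicCurvature_add_vec (hD : 𝒢.IsConnection D) {ν₁ ν₂ : 𝒢.Sec} {V W : VecField EM M}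
    (h₁ : 𝒢.IsSection ν₁) (h₂ : 𝒢.IsSection ν₂) (hV : V.Smooth) (hW : W.Smooth) :
    𝒢.basicCurvature D ν₁ ν₂ (V + W) =
      𝒢.basicCurvature D ν₁ ν₂ V + 𝒢.basicCurvature D ν₁ ν₂ W := by
  simp only [basicCurvature]
  rw [hD.add_left _ _ _ hV hW (isSection_bracket h₁ h₂), hD.add_left _ _ _ hV hW h₁,
    hD.add_left _ _ _ hV hW h₂, bracket_add_left (hD.isSection _ _ hV h₁) (hD.isSection _ _ hW h₁),
    bracket_add_right (hD.isSection _ _ hV h₂) (hD.isSection _ _ hW h₂),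
    hD.basicVec_add_right h₁ hV hW, hD.basicVec_add_right h₂ hV hW,
    hD.add_left _ _ _ (hD.smooth_basicVec h₁ hV) (hD.smooth_basicVec h₁ hW) h₂,
    hD.add_left _ _ _ (hD.smooth_basicVec h₂ hV) (hD.smooth_basicVec h₂ hW) h₁]
  abel

/-- The terms `ρ(ν₂)(f) ∇_V ν₁` and `ρ(ν₁)(f) ∇_V ν₂` each arise twice with opposite signs, from a
bracket and from a basic derivative of `f V`. -/
theorem basicCurvature_smul_vec (hD : 𝒢.IsConnection D) {f : M → ℝ} {ν₁ ν₂ : 𝒢.Sec}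
    {V : VecField EM M} (hf : ContMDiff 𝓘(ℝ, EM) 𝓘(ℝ, ℝ) ∞ f)
    (h₁ : 𝒢.IsSection ν₁) (h₂ : 𝒢.IsSection ν₂) (hV : V.Smooth) :
    𝒢.basicCurvature D ν₁ ν₂ (fun m => f m • V m) =
      fun m => f m • 𝒢.basicCurvature D ν₁ ν₂ V m := by
  have hρ₁ := VecField.contMDiff_deriv (smooth_anchor h₁) hf
  have hρ₂ := VecField.contMDiff_deriv (smooth_anchor h₂) hf
  simp only [basicCurvature]
  rw [hD.smul_left _ _ _ hf hV (isSection_bracket h₁ h₂), hD.smul_left _ _ _ hf hV h₁,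
    hD.smul_left _ _ _ hf hV h₂, bracket_smul_left hf (hD.isSection _ _ hV h₁) h₂,
    bracket_smul_right' hf h₁ (hD.isSection _ _ hV h₂),
    hD.basicVec_smul_right hf h₁ hV, hD.basicVec_smul_right hf h₂ hV,
    hD.add_left _ _ _ (VecField.Smooth.smul hf (hD.smooth_basicVec h₁ hV))
      (VecField.Smooth.smul hρ₁ hV) h₂,
    hD.add_left _ _ _ (VecField.Smooth.smul hf (hD.smooth_basicVec h₂ hV))
      (VecField.Smooth.smul hρ₂ hV) h₁,
    hD.smul_left _ _ _ hf (hD.smooth_basicVec h₁ hV) h₂, hD.smul_left _ _ _ hρ₁ hV h₂,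
    hD.smul_left _ _ _ hf (hD.smooth_basicVec h₂ hV) h₁, hD.smul_left _ _ _ hρ₂ hV h₁]
  funext m
  simp only [Pi.add_apply, Pi.sub_apply]
  module

end IsConnection

end GroupoidMaps

/-! ### Tensoriality of the curvature and of the derivative of a two-form -/

namespace GroupoidMaps

variable {EG EM G M : Type*}
  [NormedAddCommGroup EG] [NormedSpace ℝ EG] [FiniteDimensional ℝ EG]
  [NormedAddCommGroup EM] [NormedSpace ℝ EM] [FiniteDimensional ℝ EM]
  [TopologicalSpace G] [ChartedSpace EG G] [IsManifold 𝓘(ℝ, EG) ∞ G]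
  [TopologicalSpace M] [ChartedSpace EM M] [IsManifold 𝓘(ℝ, EM) ∞ M]
  {𝒢 : GroupoidMaps EG EM G M}

namespace Form2

variable (ζ : 𝒢.Form2)

theorem eval_swap (V W : VecField EM M) : ζ.eval V W = -ζ.eval W V := by
  funext m
  have h := (ζ m).map_swap ![W m, V m] (i := 0) (j := 1) (by decide)
  refine Eq.trans (congrArg (ζ m) ?_) h
  funext i
  fin_cases i <;> simp

theorem eval_add_left (V V' W : VecField EM M) : ζ.eval (V + V') W = ζ.eval V W + ζ.eval V' W :=
  funext fun m => (ζ m).map_vecCons_add ![W m] (V m) (V' m)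

theorem eval_smul_left (f : M → ℝ) (V W : VecField EM M) :
    ζ.eval (fun m => f m • V m) W = fun m => f m • ζ.eval V W m :=
  funext fun m => (ζ m).map_vecCons_smul ![W m] (f m) (V m)

theorem eval_add_right (V W W' : VecField EM M) : ζ.eval V (W + W') = ζ.eval V W + ζ.eval V W' := by
  rw [eval_swap, eval_add_left, neg_add, ← eval_swap, ← eval_swap]

theorem eval_smul_right (f : M → ℝ) (V W : VecField EM M) :
    ζ.eval V (fun m => f m • W m) = fun m => f m • ζ.eval V W m := by
  rw [eval_swap, eval_smul_left, eval_swap ζ V W]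
  funext m
  simp

end Form2

variable [h𝒢 : IsLieGroupoid 𝒢] {D : 𝒢.ConnOp}

namespace IsConnection

theorem curvature_swap (hD : 𝒢.IsConnection D) {ν : 𝒢.Sec} {V W : VecField EM M}
    (hν : 𝒢.IsSection ν) (hV : V.Smooth) (hW : W.Smooth) :
    𝒢.curvature D V W ν = -𝒢.curvature D W V ν := by
  have h : VectorField.mlieBracket 𝓘(ℝ, EM) V W = -VectorField.mlieBracket 𝓘(ℝ, EM) W V :=
    funext fun _ => VectorField.mlieBracket_swap_apply
  simp only [curvature]
  rw [h, hD.neg_left (hW.mlieBracket hV) hν]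
  abel

theorem curvature_add_sec (hD : 𝒢.IsConnection D) {ν μ : 𝒢.Sec} {V W : VecField EM M}
    (hν : 𝒢.IsSection ν) (hμ : 𝒢.IsSection μ) (hV : V.Smooth) (hW : W.Smooth) :
    𝒢.curvature D V W (ν + μ) = 𝒢.curvature D V W ν + 𝒢.curvature D V W μ := by
  simp only [curvature]
  rw [hD.add_right _ _ _ hV hν hμ, hD.add_right _ _ _ hW hν hμ,
    hD.add_right _ _ _ hV (hD.isSection _ _ hW hν) (hD.isSection _ _ hW hμ),
    hD.add_right _ _ _ hW (hD.isSection _ _ hV hν) (hD.isSection _ _ hV hμ),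
    hD.add_right _ _ _ (hV.mlieBracket hW) hν hμ]
  abel

theorem curvature_smul_sec (hD : 𝒢.IsConnection D) {f : M → ℝ} {ν : 𝒢.Sec} {V W : VecField EM M}
    (hf : ContMDiff 𝓘(ℝ, EM) 𝓘(ℝ, ℝ) ∞ f)
    (hν : 𝒢.IsSection ν) (hV : V.Smooth) (hW : W.Smooth) :
    𝒢.curvature D V W (fun m => f m • ν m) = fun m => f m • 𝒢.curvature D V W ν m := by
  have hVf := VecField.contMDiff_deriv hV hf
  have hWf := VecField.contMDiff_deriv hW hf
  have hDV := hD.isSection _ _ hV hν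
  have hDW := hD.isSection _ _ hW hν
  simp only [curvature]
  rw [hD.leibniz' hf hV hν, hD.leibniz' hf hW hν, hD.leibniz' hf (hV.mlieBracket hW) hν,
    hD.add_right _ _ _ hV (hDW.smul hf) (hν.smul hWf),
    hD.add_right _ _ _ hW (hDV.smul hf) (hν.smul hVf),
    hD.leibniz' hf hV hDW, hD.leibniz' hf hW hDV, hD.leibniz' hWf hV hν, hD.leibniz' hVf hW hν]
  funext m
  simp only [Pi.add_apply, Pi.sub_apply, VecField.deriv_mlieBracket hV hW hf]
  module

theorem curvature_add_vec (hD : 𝒢.IsConnection D) {ν : 𝒢.Sec} {V V' W : VecField EM M}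
    (hν : 𝒢.IsSection ν) (hV : V.Smooth) (hV' : V'.Smooth) (hW : W.Smooth) :
    𝒢.curvature D (V + V') W ν = 𝒢.curvature D V W ν + 𝒢.curvature D V' W ν := by
  simp only [curvature]
  rw [hD.add_left _ _ _ hV hV' (hD.isSection _ _ hW hν), hD.add_left _ _ _ hV hV' hν,
    hD.add_right _ _ _ hW (hD.isSection _ _ hV hν) (hD.isSection _ _ hV' hν),
    VecField.mlieBracket_add_left hV hV',
    hD.add_left _ _ _ (hV.mlieBracket hW) (hV'.mlieBracket hW) hν]
  abel

theorem curvature_smul_vec (hD : 𝒢.IsConnection D) {f : M → ℝ} {ν : 𝒢.Sec} {V W : VecField EM M}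
    (hf : ContMDiff 𝓘(ℝ, EM) 𝓘(ℝ, ℝ) ∞ f)
    (hν : 𝒢.IsSection ν) (hV : V.Smooth) (hW : W.Smooth) :
    𝒢.curvature D (fun m => f m • V m) W ν = fun m => f m • 𝒢.curvature D V W ν m := by
  have hWf := VecField.contMDiff_deriv hW hf
  -- Written as a sum so that only the additivity axiom of the connection in `V` is needed.
  have hs : (fun m => f m • VectorField.mlieBracket 𝓘(ℝ, EM) V W m) =
      VectorField.mlieBracket 𝓘(ℝ, EM) (fun m => f m • V m) W + fun m => W.deriv f m • V m := by
    rw [VecField.mlieBracket_smul_left hf hV, sub_add_cancel]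
  have h := congrArg (fun X => D X ν) hs
  rw [hD.smul_left _ _ _ hf (hV.mlieBracket hW) hν,
    hD.add_left _ _ _ ((VecField.Smooth.smul hf hV).mlieBracket hW)
      (VecField.Smooth.smul hWf hV) hν, hD.smul_left _ _ _ hWf hV hν] at h
  simp only [curvature]
  rw [hD.smul_left _ _ _ hf hV (hD.isSection _ _ hW hν), hD.smul_left _ _ _ hf hV hν,
    hD.leibniz' hf hW (hD.isSection _ _ hV hν), eq_sub_of_add_eq h.symm]
  funext m
  simp only [Pi.add_apply, Pi.sub_apply]
  module

variable {ζ : 𝒢.Form2}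

theorem basicForm_swap (hD : 𝒢.IsConnection D) (hζ : 𝒢.IsForm2 ζ) {ν : 𝒢.Sec}
    {V W : VecField EM M} (hν : 𝒢.IsSection ν) (hV : V.Smooth) (hW : W.Smooth) :
    𝒢.basicForm D ν ζ V W = -𝒢.basicForm D ν ζ W V := by
  have hs := hζ.smooth W V hW hV
  have ha : 𝒢.anchor (-ζ.eval W V) = -𝒢.anchor (ζ.eval W V) := funext fun _ => map_neg _ _
  have hb : 𝒢.bracket ν (-ζ.eval W V) = -𝒢.bracket ν (ζ.eval W V) := by
    have h := bracket_add_right (ν := ν) hs hs.neg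
    -- Additivity at `0 + 0` shows that the bracket with the zero section vanishes.
    have h0 := bracket_add_right (ν := ν) (isSection_zero (𝒢 := 𝒢)) isSection_zero
    rw [add_zero, left_eq_add] at h0
    rw [add_neg_cancel, h0] at h
    exact (neg_eq_of_add_eq_zero_right h.symm).symm
  simp only [basicForm, basicSec]
  rw [ζ.eval_swap V W, ζ.eval_swap (𝒢.basicVec D ν V), ζ.eval_swap V, ha, hb,
    hD.neg_left (smooth_anchor hs) hν]
  abel

theorem basicForm_add_sec (hD : 𝒢.IsConnection D) (hζ : 𝒢.IsForm2 ζ) {ν μ : 𝒢.Sec}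
    {V W : VecField EM M} (hν : 𝒢.IsSection ν) (hμ : 𝒢.IsSection μ)
    (hV : V.Smooth) (hW : W.Smooth) :
    𝒢.basicForm D (ν + μ) ζ V W = 𝒢.basicForm D ν ζ V W + 𝒢.basicForm D μ ζ V W := by
  have hs := hζ.smooth V W hV hW
  simp only [basicForm, basicSec]
  rw [hD.add_right _ _ _ (smooth_anchor hs) hν hμ, bracket_add_left hν hμ,
    hD.basicVec_add_left hν hμ hV, hD.basicVec_add_left hν hμ hW, ζ.eval_add_left,
    ζ.eval_add_right]
  abel

/-- The term `ρ(ζ(V, W))(f) ν` appears with opposite signs in `∇_{ρ ζ(V, W)} (f ν)` and in `[f ν,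
ζ(V, W)]`. -/
theorem basicForm_smul_sec (hD : 𝒢.IsConnection D) (hζ : 𝒢.IsForm2 ζ) {f : M → ℝ} {ν : 𝒢.Sec}
    {V W : VecField EM M} (hf : ContMDiff 𝓘(ℝ, EM) 𝓘(ℝ, ℝ) ∞ f)
    (hν : 𝒢.IsSection ν) (hV : V.Smooth) (hW : W.Smooth) :
    𝒢.basicForm D (fun m => f m • ν m) ζ V W = fun m => f m • 𝒢.basicForm D ν ζ V W m := by
  have hs := hζ.smooth V W hV hW
  simp only [basicForm, basicSec]
  rw [hD.leibniz' hf (smooth_anchor hs) hν, bracket_smul_left hf hν hs,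
    hD.basicVec_smul_left hf hν hV, hD.basicVec_smul_left hf hν hW, ζ.eval_smul_left,
    ζ.eval_smul_right]
  funext m
  simp only [Pi.add_apply, Pi.sub_apply]
  module

theorem basicForm_add_vec (hD : 𝒢.IsConnection D) (hζ : 𝒢.IsForm2 ζ) {ν : 𝒢.Sec}
    {V V' W : VecField EM M} (hν : 𝒢.IsSection ν)
    (hV : V.Smooth) (hV' : V'.Smooth) (hW : W.Smooth) :
    𝒢.basicForm D ν ζ (V + V') W = 𝒢.basicForm D ν ζ V W + 𝒢.basicForm D ν ζ V' W := by
  have hs := hζ.smooth V W hV hW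
  have hs' := hζ.smooth V' W hV' hW
  simp only [basicForm, basicSec]
  rw [hD.basicVec_add_right hν hV hV', ζ.eval_add_left, ζ.eval_add_left, ζ.eval_add_left,
    anchor_add, hD.add_left _ _ _ (smooth_anchor hs) (smooth_anchor hs') hν,
    bracket_add_right hs hs']
  abel

/-- The term `ρ(ν)(f) ζ(V, W)` from `[ν, f ζ(V, W)]` cancels against the one from `ζ(∇^bas_ν (f V),
W)`. -/
theorem basicForm_smul_vec (hD : 𝒢.IsConnection D) (hζ : 𝒢.IsForm2 ζ) {f : M → ℝ} {ν : 𝒢.Sec}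
    {V W : VecField EM M} (hf : ContMDiff 𝓘(ℝ, EM) 𝓘(ℝ, ℝ) ∞ f)
    (hν : 𝒢.IsSection ν) (hV : V.Smooth) (hW : W.Smooth) :
    𝒢.basicForm D ν ζ (fun m => f m • V m) W = fun m => f m • 𝒢.basicForm D ν ζ V W m := by
  have hs := hζ.smooth V W hV hW
  simp only [basicForm, basicSec]
  rw [hD.basicVec_smul_right hf hν hV, ζ.eval_add_left, ζ.eval_smul_left, ζ.eval_smul_left,
    ζ.eval_smul_left, ζ.eval_smul_left,
    anchor_smul, hD.smul_left _ _ _ hf (smooth_anchor hs) hν, bracket_smul_right' hf hν hs]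
  funext m
  simp only [Pi.add_apply, Pi.sub_apply]
  module

end IsConnection

end GroupoidMaps

namespace RightAction

variable {EG EM EN G M N : Type*}
  [NormedAddCommGroup EG] [NormedSpace ℝ EG] [FiniteDimensional ℝ EG]
  [NormedAddCommGroup EM] [NormedSpace ℝ EM] [FiniteDimensional ℝ EM]
  [NormedAddCommGroup EN] [NormedSpace ℝ EN]
  [TopologicalSpace G] [ChartedSpace EG G] [IsManifold 𝓘(ℝ, EG) ∞ G]
  [TopologicalSpace M] [ChartedSpace EM M] [IsManifold 𝓘(ℝ, EM) ∞ M]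
  [TopologicalSpace N] [ChartedSpace EN N] [IsManifold 𝓘(ℝ, EN) ∞ N]
  {𝒢 : GroupoidMaps EG EM G M} [h𝒢 : IsLieGroupoid 𝒢] {A : RightAction 𝒢 EN N}

variable {EP HP P : Type*} [NormedAddCommGroup EP] [NormedSpace ℝ EP] [TopologicalSpace HP]
  {J : ModelWithCorners ℝ EP HP} [TopologicalSpace P] [ChartedSpace HP P]

/-! #### Smooth maps into and out of the manifold of arrows -/

theorem contMDiffAt_chart {k₀ k : A.Arrows} (hk : k.1 ∈ FiberProduct.coordDomain EN
    h𝒢.tgt_submersion k₀) : ContMDiffAt 𝓘(ℝ, EN × FiberModel EG EM) 𝓘(ℝ, EN × FiberModel EG EM) ∞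
      (fun k : A.Arrows => FiberProduct.coord (EN := EN) h𝒢.tgt_submersion k₀ k.1) k :=
  (chartAt (EN × FiberModel EG EM) k₀).contMDiffAt_of_mem
    (IsManifold.chart_mem_maximalAtlas k₀) hk

theorem contMDiff_val : ContMDiff 𝓘(ℝ, EN × FiberModel EG EM) (𝓘(ℝ, EN).prod 𝓘(ℝ, EG)) ∞
    (fun k : A.Arrows => k.1) := by
  intro k
  have hk := FiberProduct.mem_coordDomain (EN := EN) h𝒢.tgt_submersion k
  have h := ((FiberProduct.contMDiffOn_param (EN := EN) h𝒢.tgt_submersion k A.ψ_smooth).contMDiffAt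
    ((FiberProduct.isOpen_paramDomain h𝒢.tgt_submersion k A.ψ_smooth).mem_nhds
      (FiberProduct.coord_mem h𝒢.tgt_submersion k k.2 hk))).comp k (contMDiffAt_chart hk)
  refine h.congr_of_eventuallyEq ?_
  filter_upwards [((FiberProduct.isOpen_coordDomain (EN := EN) h𝒢.tgt_submersion k).preimage
    continuous_subtype_val).mem_nhds hk] with l hl
  exact (FiberProduct.param_coord h𝒢.tgt_submersion k l.2 hl).symm

theorem contMDiff_toArrow :
    ContMDiff 𝓘(ℝ, EN × FiberModel EG EM) 𝓘(ℝ, EG) ∞ A.toArrow :=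
  contMDiff_snd.comp contMDiff_val

theorem contMDiff_actionGroupoid_tgt :
    ContMDiff 𝓘(ℝ, EN × FiberModel EG EM) 𝓘(ℝ, EN) ∞ A.actionGroupoid.tgt :=
  contMDiff_fst.comp contMDiff_val

/-- The charts of the manifold of arrows are restrictions of the maps `coord`, which are smooth on
open subsets of `N × G`; continuity is that of the subspace topology. -/
theorem contMDiffWithinAt_of_val {b : P → A.Arrows} {s : Set P} {p₀ : P}
    (h : ContMDiffWithinAt J (𝓘(ℝ, EN).prod 𝓘(ℝ, EG)) ∞ (fun p => (b p).1) s p₀) :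
    ContMDiffWithinAt J 𝓘(ℝ, EN × FiberModel EG EM) ∞ b s p₀ := by
  have hk := FiberProduct.mem_coordDomain (EN := EN) h𝒢.tgt_submersion (b p₀)
  have hc : ContinuousWithinAt b s p₀ :=
    Topology.IsInducing.subtypeVal.continuousWithinAt_iff.2 h.continuousWithinAt
  have h1 := ((FiberProduct.contMDiffOn_coord (EN := EN) h𝒢.tgt_submersion (b p₀)).contMDiffAt
    ((FiberProduct.isOpen_coordDomain h𝒢.tgt_submersion (b p₀)).mem_nhds hk)).comp_contMDiffWithinAt
    p₀ h
  set e := chartAt (EN × FiberModel EG EM) (b p₀)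
  have he : b p₀ ∈ e.source := mem_chart_source _ _
  have h2 := (e.contMDiffAt_symm_of_mem (IsManifold.chart_mem_maximalAtlas (b p₀))
    (e.map_source he)).comp_contMDiffWithinAt p₀ (f := fun p => e (b p)) h1
  refine h2.congr_of_eventuallyEq ?_ (e.left_inv he).symm
  filter_upwards [hc.preimage_mem_nhdsWithin (e.open_source.mem_nhds he)] with p hp
  exact (e.left_inv hp).symm

theorem contMDiffAt_of_val {b : P → A.Arrows} {p₀ : P}
    (h : ContMDiffAt J (𝓘(ℝ, EN).prod 𝓘(ℝ, EG)) ∞ (fun p => (b p).1) p₀) :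
    ContMDiffAt J 𝓘(ℝ, EN × FiberModel EG EM) ∞ b p₀ :=
  contMDiffWithinAt_of_val h

/-! #### Tangent vectors of the manifold of arrows -/

theorem mfderiv_val (k : A.Arrows) (Z : TangentSpace 𝓘(ℝ, EN × FiberModel EG EM) k) :
    @Eq (EN × EG) (mfderiv 𝓘(ℝ, EN × FiberModel EG EM) (𝓘(ℝ, EN).prod 𝓘(ℝ, EG))
      (fun k : A.Arrows => k.1) k Z)
      (mfderiv 𝓘(ℝ, EN × FiberModel EG EM) 𝓘(ℝ, EN) A.actionGroupoid.tgt k Z,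
        mfderiv 𝓘(ℝ, EN × FiberModel EG EM) 𝓘(ℝ, EG) A.toArrow k Z) :=
  DFunLike.congr_fun (mfderiv_prodMk
    ((contMDiff_actionGroupoid_tgt (A := A)).mdifferentiable (by simp) k)
    ((contMDiff_toArrow (A := A)).mdifferentiable (by simp) k)) Z

theorem mfderiv_ψ_tgt (k : A.Arrows) (Z : TangentSpace 𝓘(ℝ, EN × FiberModel EG EM) k) :
    @Eq EM (mfderiv 𝓘(ℝ, EN) 𝓘(ℝ, EM) A.ψ k.1.1
      (mfderiv 𝓘(ℝ, EN × FiberModel EG EM) 𝓘(ℝ, EN) A.actionGroupoid.tgt k Z))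
      (mfderiv 𝓘(ℝ, EG) 𝓘(ℝ, EM) 𝒢.tgt k.1.2
        (mfderiv 𝓘(ℝ, EN × FiberModel EG EM) 𝓘(ℝ, EG) A.toArrow k Z)) := by
  have h1 := DFunLike.congr_fun (mfderiv_comp k
    (A.ψ_smooth.mdifferentiable (by simp) (A.actionGroupoid.tgt k))
    ((contMDiff_actionGroupoid_tgt (A := A)).mdifferentiable (by simp) k)) Z
  have h2 := DFunLike.congr_fun (mfderiv_comp k
    (GroupoidMaps.mdifferentiableAt_tgt (𝒢 := 𝒢) (A.toArrow k))
    ((contMDiff_toArrow (A := A)).mdifferentiable (by simp) k)) Z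
  have h3 : A.ψ ∘ A.actionGroupoid.tgt = 𝒢.tgt ∘ A.toArrow := funext fun k => k.2
  rw [h3] at h1
  exact h1.symm.trans h2

theorem mvfderiv_chart {k₀ k : A.Arrows} (hk : k.1 ∈ FiberProduct.coordDomain EN
    h𝒢.tgt_submersion k₀) (Z : TangentSpace 𝓘(ℝ, EN × FiberModel EG EM) k) :
    mvfderiv 𝓘(ℝ, EN × FiberModel EG EM) (chartAt (EN × FiberModel EG EM) k₀) k Z =
      mvfderiv (𝓘(ℝ, EN).prod 𝓘(ℝ, EG)) (FiberProduct.coord (EN := EN) h𝒢.tgt_submersion k₀) k.1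
        (mfderiv 𝓘(ℝ, EN × FiberModel EG EM) 𝓘(ℝ, EN) A.actionGroupoid.tgt k Z,
          mfderiv 𝓘(ℝ, EN × FiberModel EG EM) 𝓘(ℝ, EG) A.toArrow k Z) := by
  have h := mvfderiv_comp_mfderiv (J := 𝓘(ℝ, EN × FiberModel EG EM))
    (I' := 𝓘(ℝ, EN).prod 𝓘(ℝ, EG)) (φ := fun k : A.Arrows => k.1)
    (f := FiberProduct.coord (EN := EN) h𝒢.tgt_submersion k₀) (p := k)
    (((FiberProduct.contMDiffOn_coord (EN := EN) h𝒢.tgt_submersion k₀).contMDiffAt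
      ((FiberProduct.isOpen_coordDomain h𝒢.tgt_submersion k₀).mem_nhds hk)).mdifferentiableAt
        (by simp)) (contMDiff_val.mdifferentiable (by simp) k) Z
  exact h.trans (congrArg _ (mfderiv_val k Z))

theorem tangent_ext {k : A.Arrows} {Z Z' : TangentSpace 𝓘(ℝ, EN × FiberModel EG EM) k}
    (h₁ : mfderiv 𝓘(ℝ, EN × FiberModel EG EM) 𝓘(ℝ, EN) A.actionGroupoid.tgt k Z =
      mfderiv 𝓘(ℝ, EN × FiberModel EG EM) 𝓘(ℝ, EN) A.actionGroupoid.tgt k Z')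
    (h₂ : mfderiv 𝓘(ℝ, EN × FiberModel EG EM) 𝓘(ℝ, EG) A.toArrow k Z =
      mfderiv 𝓘(ℝ, EN × FiberModel EG EM) 𝓘(ℝ, EG) A.toArrow k Z') : Z = Z' := by
  have hk := FiberProduct.mem_coordDomain (EN := EN) h𝒢.tgt_submersion k
  refine (chartAt (EN × FiberModel EG EM) k).mvfderiv_injective
    (IsManifold.chart_mem_maximalAtlas k) (mem_chart_source _ k) ?_
  rw [mvfderiv_chart hk, mvfderiv_chart hk, h₁, h₂]

/-- Take the vector with the coordinates of `(x, ξ)`. Its image in the product and `(x, ξ)` are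
tangent pairs with equal coordinates, hence equal. -/
theorem exists_tangent {k : A.Arrows} {x : TangentSpace 𝓘(ℝ, EN) k.1.1}
    {ξ : TangentSpace 𝓘(ℝ, EG) k.1.2}
    (h : @Eq EM (mfderiv 𝓘(ℝ, EN) 𝓘(ℝ, EM) A.ψ k.1.1 x) (mfderiv 𝓘(ℝ, EG) 𝓘(ℝ, EM) 𝒢.tgt k.1.2 ξ)) :
    ∃ Z : TangentSpace 𝓘(ℝ, EN × FiberModel EG EM) k,
      mfderiv 𝓘(ℝ, EN × FiberModel EG EM) 𝓘(ℝ, EN) A.actionGroupoid.tgt k Z = x ∧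
      mfderiv 𝓘(ℝ, EN × FiberModel EG EM) 𝓘(ℝ, EG) A.toArrow k Z = ξ := by
  have hk := FiberProduct.mem_coordDomain (EN := EN) h𝒢.tgt_submersion k
  set u := mvfderiv (𝓘(ℝ, EN).prod 𝓘(ℝ, EG))
    (FiberProduct.coord (EN := EN) h𝒢.tgt_submersion k) k.1 (x, ξ)
  refine ⟨(chartAt (EN × FiberModel EG EM) k).coordField u k, ?_⟩
  have h1 := (chartAt (EN × FiberModel EG EM) k).mvfderiv_coordField
    (IsManifold.chart_mem_maximalAtlas k) (mem_chart_source _ k) u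
  exact FiberProduct.eq_of_mvfderiv_coord_eq h𝒢.tgt_submersion k (mfderiv_ψ_tgt k _) h
    ((mvfderiv_chart hk _).symm.trans h1)

/-- A vector field along a map into the arrows can be tested on its images in `TN` and `TG`, since
the chart factors through `N × G`. -/
theorem contMDiffAt_along_of_components [IsManifold J ∞ P] {b : P → A.Arrows}
    {v : ∀ p, TangentSpace 𝓘(ℝ, EN × FiberModel EG EM) (b p)} {p₀ : P}
    (h₁ : ContMDiffAt J 𝓘(ℝ, EN).tangent ∞ (fun p => (⟨(b p).1.1,
      mfderiv 𝓘(ℝ, EN × FiberModel EG EM) 𝓘(ℝ, EN) A.actionGroupoid.tgt (b p) (v p)⟩ :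
        TangentBundle 𝓘(ℝ, EN) N)) p₀)
    (h₂ : ContMDiffAt J 𝓘(ℝ, EG).tangent ∞ (fun p => (⟨(b p).1.2,
      mfderiv 𝓘(ℝ, EN × FiberModel EG EM) 𝓘(ℝ, EG) A.toArrow (b p) (v p)⟩ :
        TangentBundle 𝓘(ℝ, EG) G)) p₀) :
    ContMDiffAt J 𝓘(ℝ, EN × FiberModel EG EM).tangent ∞
      (fun p => (⟨b p, v p⟩ : TangentBundle 𝓘(ℝ, EN × FiberModel EG EM) A.Arrows)) p₀ := by
  have hb : ContMDiffAt J 𝓘(ℝ, EN × FiberModel EG EM) ∞ b p₀ := contMDiffAt_of_val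
    ((Bundle.contMDiffAt_totalSpace.1 h₁).1.prodMk (Bundle.contMDiffAt_totalSpace.1 h₂).1)
  refine (contMDiffAt_along_iff_of_chart (IsManifold.chart_mem_maximalAtlas (b p₀))
    (mem_chart_source (EN × FiberModel EG EM) (b p₀))).2 ⟨hb, ?_⟩
  have hk := FiberProduct.mem_coordDomain (EN := EN) h𝒢.tgt_submersion (b p₀)
  have h3 := ContMDiffAt.mvfderiv_apply_along (b := fun p => ((b p).1.1, (b p).1.2))
    (((FiberProduct.contMDiffOn_coord (EN := EN) h𝒢.tgt_submersion (b p₀)).contMDiffAt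
      ((FiberProduct.isOpen_coordDomain h𝒢.tgt_submersion (b p₀)).mem_nhds hk)))
    (h₁.prodMk_along h₂)
  refine h3.congr_of_eventuallyEq ?_
  filter_upwards [hb.continuousAt.preimage_mem_nhds
    (((FiberProduct.isOpen_coordDomain (EN := EN) h𝒢.tgt_submersion (b p₀)).preimage
    continuous_subtype_val).mem_nhds hk)] with p hp
  exact mvfderiv_chart hp (v p)

end RightAction

/-- Precomposing the domain chart with `σ` gives the same local expression. It yields the source of
the action groupoid, which is the target composed with inversion. -/
theorem Manifold.IsSubmersion.comp_involution {E F G M : Type*}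
    [NormedAddCommGroup E] [NormedSpace ℝ E] [NormedAddCommGroup F] [NormedSpace ℝ F]
    [TopologicalSpace G] [ChartedSpace E G] [IsManifold 𝓘(ℝ, E) ∞ G]
    [TopologicalSpace M] [ChartedSpace F M] {t : G → M} {σ : G → G}
    (ht : Manifold.IsSubmersion 𝓘(ℝ, E) 𝓘(ℝ, F) ∞ t) (hσ : ContMDiff 𝓘(ℝ, E) 𝓘(ℝ, E) ∞ σ)
    (hσσ : ∀ g, σ (σ g) = g) : Manifold.IsSubmersion 𝓘(ℝ, E) 𝓘(ℝ, F) ∞ (t ∘ σ) := by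
  obtain ⟨C, iC, jC, h⟩ := ht
  let s : G ≃ₜ G := ⟨⟨σ, σ, hσσ, hσσ⟩, hσ.continuous, hσ.continuous⟩
  refine ⟨C, iC, jC, fun x => ?_⟩
  have hx := h (σ x)
  have hd := hx.domChart_mem_maximalAtlas
  refine Manifold.IsSubmersionAtOfComplement.mk_of_charts hx.equiv
    (s.transOpenPartialHomeomorph hx.domChart) hx.codChart hx.mem_domChart_source
    hx.mem_codChart_source ?_ hx.codChart_mem_maximalAtlas
    (fun y hy => hx.source_subset_preimage_source hy) ?_
  · refine OpenPartialHomeomorph.mem_maximalAtlas_of_contMDiffOn _ ?_ ?_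
    · exact (contMDiffOn_of_mem_maximalAtlas hd).comp hσ.contMDiffOn fun y hy => hy
    · exact hσ.comp_contMDiffOn (contMDiffOn_symm_of_mem_maximalAtlas hd)
  · intro u hu
    have hu' : u ∈ (hx.domChart.extend 𝓘(ℝ, E)).target := by simpa using hu
    have h1 := hx.writtenInCharts hu'
    refine Eq.trans ?_ h1
    change _ = hx.codChart (t (hx.domChart.symm u))
    change hx.codChart (t (σ (σ (hx.domChart.symm u)))) = _
    rw [hσσ]

namespace RightAction

variable {EG EM EN G M N : Type*}
  [NormedAddCommGroup EG] [NormedSpace ℝ EG] [FiniteDimensional ℝ EG]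
  [NormedAddCommGroup EM] [NormedSpace ℝ EM] [FiniteDimensional ℝ EM]
  [NormedAddCommGroup EN] [NormedSpace ℝ EN]
  [TopologicalSpace G] [ChartedSpace EG G] [IsManifold 𝓘(ℝ, EG) ∞ G]
  [TopologicalSpace M] [ChartedSpace EM M] [IsManifold 𝓘(ℝ, EM) ∞ M]
  [TopologicalSpace N] [ChartedSpace EN N] [IsManifold 𝓘(ℝ, EN) ∞ N]
  {𝒢 : GroupoidMaps EG EM G M} [h𝒢 : IsLieGroupoid 𝒢] {A : RightAction 𝒢 EN N}

/-! #### The action groupoid is a Lie groupoid -/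

theorem arrows_ext {k l : A.Arrows} (h₁ : k.1.1 = l.1.1) (h₂ : k.1.2 = l.1.2) : k = l :=
  Subtype.ext (Prod.ext h₁ h₂)

theorem actionGroupoid_mul_val {k l : A.Arrows} (h : A.actionGroupoid.src k = A.actionGroupoid.tgt l) :
    (A.actionGroupoid.mul k l).1 = (k.1.1, 𝒢.mul k.1.2 l.1.2) := by
  have h' : A.act k.1.1 k.1.2 = l.1.1 := h
  simp [actionGroupoid, h']

theorem src_toArrow {k l : A.Arrows} (h : A.actionGroupoid.src k = A.actionGroupoid.tgt l) :
    𝒢.src k.1.2 = 𝒢.tgt l.1.2 := by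
  have h' : A.act k.1.1 k.1.2 = l.1.1 := h
  rw [← A.ψ_act _ _ k.2, h']
  exact l.2

theorem act_inv (k : A.Arrows) : A.act (A.act k.1.1 k.1.2) (𝒢.inv k.1.2) = k.1.1 := by
  rw [A.act_act _ _ _ k.2 (h𝒢.tgt_inv _).symm, h𝒢.mul_inv]
  have h : A.ψ k.1.1 = 𝒢.tgt k.1.2 := k.2
  rw [← h, A.act_one]

theorem groupoid_inv_inv (g : G) : 𝒢.inv (𝒢.inv g) = g := by
  have h1 := h𝒢.mul_assoc (𝒢.inv (𝒢.inv g)) (𝒢.inv g) g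
    ((h𝒢.src_inv _).trans rfl) (h𝒢.src_inv g)
  rw [h𝒢.inv_mul, h𝒢.inv_mul, h𝒢.src_inv, h𝒢.one_mul] at h1
  have h2 : 𝒢.src g = 𝒢.src (𝒢.inv (𝒢.inv g)) := by rw [h𝒢.src_inv, h𝒢.tgt_inv]
  rw [h2, h𝒢.mul_one] at h1
  exact h1.symm

theorem actionGroupoid_inv_inv (k : A.Arrows) :
    A.actionGroupoid.inv (A.actionGroupoid.inv k) = k :=
  arrows_ext (act_inv k) (groupoid_inv_inv k.1.2)

theorem contMDiff_actionGroupoid_src :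
    ContMDiff 𝓘(ℝ, EN × FiberModel EG EM) 𝓘(ℝ, EN) ∞ A.actionGroupoid.src :=
  contMDiffOn_univ.1 (A.act_smooth.comp (contMDiff_val (A := A)).contMDiffOn fun k _ => k.2)

theorem contMDiff_actionGroupoid_inv : ContMDiff 𝓘(ℝ, EN × FiberModel EG EM)
    𝓘(ℝ, EN × FiberModel EG EM) ∞ A.actionGroupoid.inv := fun _ =>
  contMDiffAt_of_val (contMDiff_actionGroupoid_src.contMDiffAt.prodMk
    (h𝒢.inv_smooth.comp contMDiff_toArrow).contMDiffAt)

/-- In the charts of the fibre product the target is literally the first projection. -/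
theorem isSubmersion_actionGroupoid_tgt : Manifold.IsSubmersion 𝓘(ℝ, EN × FiberModel EG EM)
    𝓘(ℝ, EN) ∞ A.actionGroupoid.tgt := by
  have h : Manifold.IsSubmersionOfComplement (FiberModel EG EM) 𝓘(ℝ, EN × FiberModel EG EM)
    𝓘(ℝ, EN) ∞ A.actionGroupoid.tgt := by
    intro k
    refine Manifold.IsSubmersionAtOfComplement.mk_of_charts (ContinuousLinearEquiv.refl ℝ _)
      (chartAt (EN × FiberModel EG EM) k) (chartAt EN k.1.1) (mem_chart_source _ k)
      (mem_chart_source EN k.1.1) (IsManifold.chart_mem_maximalAtlas k)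
      (IsManifold.chart_mem_maximalAtlas k.1.1) (fun l hl => hl.1) ?_
    intro z hz
    have hz' : z ∈ (chartAt (EN × FiberModel EG EM) k).target := by simpa using hz
    have h1 := (chartAt (EN × FiberModel EG EM) k).right_inv hz'
    exact congrArg Prod.fst h1
  exact h.isSubmersion

instance isLieGroupoid_actionGroupoid : IsLieGroupoid A.actionGroupoid where
  src_one n := A.act_one n
  tgt_one _ := rfl
  src_mul k l h := by
    have h' : A.act k.1.1 k.1.2 = l.1.1 := h
    change A.act (A.actionGroupoid.mul k l).1.1 (A.actionGroupoid.mul k l).1.2 = A.act l.1.1 l.1.2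
    rw [actionGroupoid_mul_val h]
    change A.act k.1.1 (𝒢.mul k.1.2 l.1.2) = A.act l.1.1 l.1.2
    rw [← A.act_act _ _ _ k.2 (src_toArrow h), h']
  tgt_mul k l h := by
    change (A.actionGroupoid.mul k l).1.1 = k.1.1
    rw [actionGroupoid_mul_val h]
  mul_assoc k l p h h' := by
    have h1 : A.actionGroupoid.src (A.actionGroupoid.mul k l) = A.actionGroupoid.tgt p := by
      refine Eq.trans ?_ h'
      have e : A.act k.1.1 k.1.2 = l.1.1 := h
      change A.act (A.actionGroupoid.mul k l).1.1 (A.actionGroupoid.mul k l).1.2 = A.act l.1.1 l.1.2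
      rw [actionGroupoid_mul_val h]
      change A.act k.1.1 (𝒢.mul k.1.2 l.1.2) = A.act l.1.1 l.1.2
      rw [← A.act_act _ _ _ k.2 (src_toArrow h), e]
    have h2 : A.actionGroupoid.src k = A.actionGroupoid.tgt (A.actionGroupoid.mul l p) := by
      change _ = (A.actionGroupoid.mul l p).1.1
      rw [actionGroupoid_mul_val h']
      exact h
    refine Subtype.ext ?_
    rw [actionGroupoid_mul_val h1, actionGroupoid_mul_val h2, actionGroupoid_mul_val h,
      actionGroupoid_mul_val h', h𝒢.mul_assoc _ _ _ (src_toArrow h) (src_toArrow h')]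
  one_mul k := by
    refine Subtype.ext ?_
    have h0 := (actionGroupoid_mul_val (k := A.actionGroupoid.one k.1.1) (l := k) (A.act_one k.1.1))
    refine h0.trans ?_
    have h : A.ψ k.1.1 = 𝒢.tgt k.1.2 := k.2
    change (k.1.1, 𝒢.mul (𝒢.one (A.ψ k.1.1)) k.1.2) = k.1
    rw [h, h𝒢.one_mul]
  mul_one k := by
    refine Subtype.ext ?_
    rw [actionGroupoid_mul_val rfl]
    change (k.1.1, 𝒢.mul k.1.2 (𝒢.one (A.ψ (A.act k.1.1 k.1.2)))) = k.1
    rw [A.ψ_act _ _ k.2, h𝒢.mul_one]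
  src_inv k := act_inv k
  tgt_inv _ := rfl
  mul_inv k := by
    refine Subtype.ext ?_
    rw [actionGroupoid_mul_val rfl]
    have h : A.ψ k.1.1 = 𝒢.tgt k.1.2 := k.2
    change (k.1.1, 𝒢.mul k.1.2 (𝒢.inv k.1.2)) = (k.1.1, 𝒢.one (A.ψ k.1.1))
    rw [h𝒢.mul_inv, h]
  inv_mul k := by
    refine Subtype.ext ?_
    refine (actionGroupoid_mul_val (k := A.actionGroupoid.inv k) (l := k) (act_inv k)).trans ?_
    change (A.act k.1.1 k.1.2, 𝒢.mul (𝒢.inv k.1.2) k.1.2) =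
      (A.act k.1.1 k.1.2, 𝒢.one (A.ψ (A.act k.1.1 k.1.2)))
    rw [h𝒢.inv_mul, A.ψ_act _ _ k.2]
  src_surjective n := ⟨A.actionGroupoid.one n, A.act_one n⟩
  tgt_surjective n := ⟨A.actionGroupoid.one n, rfl⟩
  src_submersion := isSubmersion_actionGroupoid_tgt.comp_involution contMDiff_actionGroupoid_inv
    actionGroupoid_inv_inv
  tgt_submersion := isSubmersion_actionGroupoid_tgt
  one_smooth _ := contMDiffAt_of_val (contMDiffAt_id.prodMk
    (h𝒢.one_smooth.comp A.ψ_smooth).contMDiffAt)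
  inv_smooth := contMDiff_actionGroupoid_inv
  mul_smooth p hp := by
    refine contMDiffWithinAt_of_val ?_
    have h1 : ContMDiff (𝓘(ℝ, EN × FiberModel EG EM).prod 𝓘(ℝ, EN × FiberModel EG EM)) 𝓘(ℝ, EN) ∞
        (fun q : A.Arrows × A.Arrows => A.actionGroupoid.tgt q.1) :=
      contMDiff_actionGroupoid_tgt.comp contMDiff_fst
    have h2 : ContMDiff (𝓘(ℝ, EN × FiberModel EG EM).prod 𝓘(ℝ, EN × FiberModel EG EM))
        (𝓘(ℝ, EG).prod 𝓘(ℝ, EG)) ∞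
        (fun q : A.Arrows × A.Arrows => (A.toArrow q.1, A.toArrow q.2)) :=
      (contMDiff_toArrow.comp contMDiff_fst).prodMk (contMDiff_toArrow.comp contMDiff_snd)
    have h3 := h𝒢.mul_smooth.comp (h2.contMDiffOn (s := A.actionGroupoid.composable))
      (fun q hq => src_toArrow hq)
    exact ((h1.contMDiffOn.prodMk h3) p hp).congr (fun q hq => actionGroupoid_mul_val hq)
      (actionGroupoid_mul_val hp)

end RightAction

/-- Splits the composability condition of the tangent groupoid into composability of the arrows and
of the vectors. -/
theorem tangentBundle_mk_injective {E H M : Type*} [NormedAddCommGroup E] [NormedSpace ℝ E]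
    [TopologicalSpace H] {I : ModelWithCorners ℝ E H} [TopologicalSpace M] [ChartedSpace H M]
    {x y : M} {v : TangentSpace I x} {w : TangentSpace I y}
    (h : (⟨x, v⟩ : TangentBundle I M) = ⟨y, w⟩) : x = y ∧ @Eq E v w :=
  ⟨congrArg Bundle.TotalSpace.proj h, congrArg (fun p : TangentBundle I M => (p.2 : E)) h⟩

theorem mem_distribution_of_eq {E G : Type*} [NormedAddCommGroup E] [NormedSpace ℝ E]
    [TopologicalSpace G] [ChartedSpace E G] (H : ∀ g : G, Submodule ℝ (TangentSpace 𝓘(ℝ, E) g))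
    {x y : G} (h : x = y) {v : TangentSpace 𝓘(ℝ, E) x} {w : TangentSpace 𝓘(ℝ, E) y}
    (hvw : @Eq E v w) (hw : w ∈ H y) : v ∈ H x := by
  subst h
  have : v = w := hvw
  rwa [this]

/-! ### Projectable vector fields of a submersion -/

section RelatedFrame

variable {EN EM N M : Type*}
  [NormedAddCommGroup EN] [NormedSpace ℝ EN] [FiniteDimensional ℝ EN]
  [NormedAddCommGroup EM] [NormedSpace ℝ EM] [FiniteDimensional ℝ EM]
  [TopologicalSpace N] [T2Space N] [ChartedSpace EN N] [IsManifold 𝓘(ℝ, EN) ∞ N]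
  [TopologicalSpace M] [T2Space M] [ChartedSpace EM M] [IsManifold 𝓘(ℝ, EM) ∞ M] {f : N → M}

/-- Around each point, a submersion admits a chart whose coordinate fields are projectable. -/
theorem Manifold.IsSubmersion.exists_projectable_frame
    (hf : Manifold.IsSubmersion 𝓘(ℝ, EN) 𝓘(ℝ, EM) ∞ f) (n₀ : N) :
    ∃ (e : OpenPartialHomeomorph N EN) (χ : N → ℝ),
      e ∈ IsManifold.maximalAtlas 𝓘(ℝ, EN) ∞ N ∧ ContMDiff 𝓘(ℝ, EN) 𝓘(ℝ, ℝ) ∞ χ ∧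
      tsupport χ ⊆ e.source ∧ χ =ᶠ[𝓝 n₀] 1 ∧ n₀ ∈ e.source ∧
      ∀ u : EN, ∃ V : VecField EM M, V.Smooth ∧ ∀ᶠ n in 𝓝 n₀,
        mfderiv 𝓘(ℝ, EN) 𝓘(ℝ, EM) f n (cutoffField χ e u n) = V (f n) := by
  let p₀ : FiberProduct f f := ⟨(n₀, n₀), rfl⟩
  set e := FiberProduct.totChart hf p₀
  set e' := FiberProduct.baseChart hf p₀
  have he := FiberProduct.totChart_mem_maximalAtlas hf p₀
  have he' := FiberProduct.baseChart_mem_maximalAtlas hf p₀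
  have hn : n₀ ∈ e.source := FiberProduct.mem_totChart_source hf p₀
  have hm : f n₀ ∈ e'.source := (FiberProduct.base_of_mem hf p₀ hn).1
  obtain ⟨χ, hχ, hχ₁, hs⟩ := exists_bump (E := EN) n₀ (e.open_source.mem_nhds hn)
  obtain ⟨χ', hχ', hχ₁', hs'⟩ := exists_bump (E := EM) (f n₀) (e'.open_source.mem_nhds hm)
  -- In straightening charts `f` is linear, so a constant field projects to the constant field with
  -- the base part of `u`. The cut-offs on `N` and `M` are unrelated, so projectability holds only
  -- where both equal `1`.
  refine ⟨e, χ, he, hχ, hs, hχ₁, hn, fun u => ⟨cutoffField χ' e' (FiberProduct.split hf p₀ u).1,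
    smooth_cutoffField he' hχ' hs' _, ?_⟩⟩
  filter_upwards [hχ₁, hf.contMDiff.continuous.continuousAt.eventually hχ₁',
    e.open_source.mem_nhds hn] with n h1 h2 h3
  refine e'.mvfderiv_injective he' (FiberProduct.base_of_mem hf p₀ h3).1 ?_
  simp only [cutoffField, h1, h2, Pi.one_apply, one_smul]
  rw [FiberProduct.mvfderiv_baseChart hf p₀ h3, e.mvfderiv_coordField he h3,
    e'.mvfderiv_coordField he' (FiberProduct.base_of_mem hf p₀ h3).1]

theorem Manifold.IsSubmersion.exists_projectable
    (hf : Manifold.IsSubmersion 𝓘(ℝ, EN) 𝓘(ℝ, EM) ∞ f) {n₀ : N} (x : TangentSpace 𝓘(ℝ, EN) n₀) :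
    ∃ (X : VecField EN N) (V : VecField EM M), X.Smooth ∧ V.Smooth ∧ X n₀ = x ∧
      ∀ᶠ n in 𝓝 n₀, mfderiv 𝓘(ℝ, EN) 𝓘(ℝ, EM) f n (X n) = V (f n) := by
  obtain ⟨e, χ, he, hχ, hs, hχ₁, hn, h⟩ := hf.exists_projectable_frame n₀
  obtain ⟨V, hV, hXV⟩ := h (mvfderiv 𝓘(ℝ, EN) e n₀ x)
  refine ⟨_, V, smooth_cutoffField he hχ hs _, hV, ?_, hXV⟩
  refine e.mvfderiv_injective he hn ?_
  simp only [cutoffField, hχ₁.self_of_nhds, Pi.one_apply, one_smul]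
  exact e.mvfderiv_coordField he hn _

end RelatedFrame

namespace RightAction

variable {EG EM EN G M N : Type*}
  [NormedAddCommGroup EG] [NormedSpace ℝ EG] [FiniteDimensional ℝ EG]
  [NormedAddCommGroup EM] [NormedSpace ℝ EM] [FiniteDimensional ℝ EM]
  [NormedAddCommGroup EN] [NormedSpace ℝ EN] [FiniteDimensional ℝ EN]
  [TopologicalSpace G] [ChartedSpace EG G] [IsManifold 𝓘(ℝ, EG) ∞ G]
  [TopologicalSpace M] [ChartedSpace EM M] [IsManifold 𝓘(ℝ, EM) ∞ M]
  [TopologicalSpace N] [ChartedSpace EN N] [IsManifold 𝓘(ℝ, EN) ∞ N]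
  {𝒢 : GroupoidMaps EG EM G M} [h𝒢 : IsLieGroupoid 𝒢] {A : RightAction 𝒢 EN N}
  {H : ∀ g : G, Submodule ℝ (TangentSpace 𝓘(ℝ, EG) g)}

theorem mdifferentiableAt_toArrow (k : A.Arrows) :
    MDifferentiableAt 𝓘(ℝ, EN × FiberModel EG EM) 𝓘(ℝ, EG) A.toArrow k :=
  contMDiff_toArrow.mdifferentiable (by simp) k

/-! #### The induced distribution is a Cartan connection -/

/-- A vertical vector is a pair `(0, ξ)` with `ξ` vertical, so it is zero if `ξ` is horizontal. For
spanning, split `(x, ξ)` as `(x, a) + (0, b)` with `a` horizontal and `b` vertical; the pair `(x,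
a)` is tangent because `dt a = dt ξ`. -/
theorem isCompl_inducedDistribution (hH : ∀ g, IsCompl (H g) (𝒢.vertical g)) (k : A.Arrows) :
    IsCompl (A.inducedDistribution H k) (A.actionGroupoid.vertical k) := by
  refine ⟨Submodule.disjoint_def.2 fun Z h1 h2 => ?_, codisjoint_iff.2 (eq_top_iff.2 fun Z _ => ?_)⟩
  · have h2' : mfderiv 𝓘(ℝ, EN × FiberModel EG EM) 𝓘(ℝ, EN) A.actionGroupoid.tgt k Z = 0 := h2
    have h1' : mfderiv 𝓘(ℝ, EN × FiberModel EG EM) 𝓘(ℝ, EG) A.toArrow k Z ∈ H (A.toArrow k) := h1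
    refine tangent_ext (h2'.trans (map_zero _).symm) ?_
    rw [map_zero]
    refine Submodule.disjoint_def.1 (hH (A.toArrow k)).disjoint _ h1' ?_
    have h3 := mfderiv_ψ_tgt k Z
    rw [h2'] at h3
    exact h3.symm.trans (map_zero _)
  · obtain ⟨a, ha, b, hb, hab⟩ := Submodule.mem_sup.1 ((hH (A.toArrow k)).sup_eq_top ▸
      Submodule.mem_top : mfderiv 𝓘(ℝ, EN × FiberModel EG EM) 𝓘(ℝ, EG) A.toArrow k Z ∈
        H (A.toArrow k) ⊔ 𝒢.vertical (A.toArrow k))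
    have hb' : mfderiv 𝓘(ℝ, EG) 𝓘(ℝ, EM) 𝒢.tgt (A.toArrow k) b = 0 := hb
    have h3 := mfderiv_ψ_tgt k Z
    have h4 : mfderiv 𝓘(ℝ, EG) 𝓘(ℝ, EM) 𝒢.tgt (A.toArrow k)
        (mfderiv 𝓘(ℝ, EN × FiberModel EG EM) 𝓘(ℝ, EG) A.toArrow k Z) =
        mfderiv 𝓘(ℝ, EG) 𝓘(ℝ, EM) 𝒢.tgt (A.toArrow k) a := by
      rw [← hab, map_add, hb', add_zero]
    obtain ⟨Y, hY1, hY2⟩ := exists_tangent (h3.trans h4)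
    refine Submodule.mem_sup.2 ⟨Y, ?_, Z - Y, ?_, add_sub_cancel _ _⟩
    · change mfderiv 𝓘(ℝ, EN × FiberModel EG EM) 𝓘(ℝ, EG) A.toArrow k Y ∈ H (A.toArrow k)
      rw [hY2]
      exact ha
    · change mfderiv 𝓘(ℝ, EN × FiberModel EG EM) 𝓘(ℝ, EN) A.actionGroupoid.tgt k (Z - Y) = 0
      rw [map_sub, hY1, sub_self]

/-- It is complementary to the kernel of the surjection `d tgt` onto `TN`. -/
theorem finrank_inducedDistribution (hH : ∀ g, IsCompl (H g) (𝒢.vertical g)) (k : A.Arrows) :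
    Module.finrank ℝ (A.inducedDistribution H k) = Module.finrank ℝ EN := by
  have : FiniteDimensional ℝ (TangentSpace 𝓘(ℝ, EN × FiberModel EG EM) k) :=
    inferInstanceAs (FiniteDimensional ℝ (EN × FiberModel EG EM))
  have h1 := Submodule.finrank_add_eq_of_isCompl (isCompl_inducedDistribution hH k)
  have h2 := LinearMap.finrank_range_add_finrank_ker
    (mfderiv 𝓘(ℝ, EN × FiberModel EG EM) 𝓘(ℝ, EN) A.actionGroupoid.tgt k).toLinearMap
  have h3 : LinearMap.range
      (mfderiv 𝓘(ℝ, EN × FiberModel EG EM) 𝓘(ℝ, EN) A.actionGroupoid.tgt k).toLinearMap = ⊤ :=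
    LinearMap.range_eq_top.2 (isSubmersion_actionGroupoid_tgt.mfderiv_surjective k)
  rw [h3, finrank_top] at h2
  have h4 : Module.finrank ℝ (TangentSpace 𝓘(ℝ, EN) (A.actionGroupoid.tgt k)) =
    Module.finrank ℝ EN := rfl
  have h5 : Module.finrank ℝ (A.actionGroupoid.vertical k) = Module.finrank ℝ (LinearMap.ker
    (mfderiv 𝓘(ℝ, EN × FiberModel EG EM) 𝓘(ℝ, EN) A.actionGroupoid.tgt k).toLinearMap) := rfl
  omega

theorem mfderiv_toArrow_horLift (hH : ∀ g, IsCompl (H g) (𝒢.vertical g)) {X : VecField EN N}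
    {V : VecField EM M} {k : A.Arrows}
    (h : mfderiv 𝓘(ℝ, EN) 𝓘(ℝ, EM) A.ψ k.1.1 (X k.1.1) = V (A.ψ k.1.1)) :
    mfderiv 𝓘(ℝ, EN × FiberModel EG EM) 𝓘(ℝ, EG) A.toArrow k
      (A.actionGroupoid.horLift (A.inducedDistribution H) X k) = 𝒢.horLift H V (A.toArrow k) := by
  have hH' := isCompl_inducedDistribution (A := A) hH
  refine GroupoidMaps.eq_horLift hH (GroupoidMaps.horLift_mem hH' X k) ?_
  refine (mfderiv_ψ_tgt k _).symm.trans ?_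
  have h1 := GroupoidMaps.mfderiv_tgt_horLift hH' X k
  rw [h1]
  exact Eq.trans h (V.apply_congr k.2)

theorem smoothAt_horLift_of_related (hH : 𝒢.IsCartanConnection H) {X : VecField EN N}
    {V : VecField EM M} (hX : X.Smooth) (hV : V.Smooth) {k : A.Arrows}
    (h : ∀ᶠ n in 𝓝 k.1.1, mfderiv 𝓘(ℝ, EN) 𝓘(ℝ, EM) A.ψ n (X n) = V (A.ψ n)) :
    (A.actionGroupoid.horLift (A.inducedDistribution H) X).SmoothAt k := by
  have hH' := isCompl_inducedDistribution (A := A) hH.isCompl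
  refine contMDiffAt_along_of_components (b := fun k => k) ?_ ?_
  · have h1 := ContMDiffAt.comp (f := A.actionGroupoid.tgt) k
      (VecField.smooth_iff.1 hX (A.actionGroupoid.tgt k))
      (contMDiff_actionGroupoid_tgt (A := A) k)
    refine h1.congr_of_eventuallyEq (Filter.Eventually.of_forall fun l => ?_)
    exact tangentBundle_mk_eq rfl (GroupoidMaps.mfderiv_tgt_horLift hH' X l)
  · have h1 := ContMDiffAt.comp k (GroupoidMaps.smooth_horLift hH hV (A.toArrow k))
      (contMDiff_toArrow (A := A) k)
    refine h1.congr_of_eventuallyEq ?_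
    filter_upwards [(contMDiff_actionGroupoid_tgt (A := A)).continuous.continuousAt.eventually h]
      with l hl
    exact tangentBundle_mk_eq rfl (mfderiv_toArrow_horLift hH.isCompl hl)

/-- Through each horizontal vector passes the horizontal lift of a field on `N` that is projectable
nearby. Its components are that field and a horizontal lift on `G`, both smooth. -/
theorem isSmoothDistribution_inducedDistribution [T2Space M] [T2Space N]
    (hψ : Manifold.IsSubmersion 𝓘(ℝ, EN) 𝓘(ℝ, EM) ∞ A.ψ) (hH : 𝒢.IsCartanConnection H) :
    GroupoidMaps.IsSmoothDistribution (A.inducedDistribution H) where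
  rank_locally_constant k := Filter.Eventually.of_forall fun l => by
    rw [finrank_inducedDistribution hH.isCompl, finrank_inducedDistribution hH.isCompl]
  exists_local_section k Z hZ := by
    have hH' := isCompl_inducedDistribution (A := A) hH.isCompl
    obtain ⟨X, V, hX, hV, hXk, hXV⟩ := hψ.exists_projectable (n₀ := k.1.1)
      (mfderiv 𝓘(ℝ, EN × FiberModel EG EM) 𝓘(ℝ, EN) A.actionGroupoid.tgt k Z)
    obtain ⟨W, hW, hWo, hkW⟩ := eventually_nhds_iff.1 hXV
    refine ⟨A.actionGroupoid.tgt ⁻¹' W,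
      hWo.preimage (contMDiff_actionGroupoid_tgt (A := A)).continuous, hkW,
      A.actionGroupoid.horLift (A.inducedDistribution H) X, fun l hl => ?_, ?_,
      fun l _ => GroupoidMaps.horLift_mem hH' X l⟩
    · have h1 : (A.actionGroupoid.horLift (A.inducedDistribution H) X).SmoothAt l :=
        smoothAt_horLift_of_related hH hX hV (Filter.eventually_of_mem (hWo.mem_nhds hl) hW)
      exact ContMDiffAt.contMDiffWithinAt h1
    · exact (GroupoidMaps.eq_horLift hH' hZ hXk.symm).symm

theorem mfderiv_toArrow_tangentMul {k l : A.Arrows}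
    (hkl : A.actionGroupoid.src k = A.actionGroupoid.tgt l)
    {v : TangentSpace 𝓘(ℝ, EN × FiberModel EG EM) k}
    {w : TangentSpace 𝓘(ℝ, EN × FiberModel EG EM) l}
    (hvw : @Eq EN (mfderiv 𝓘(ℝ, EN × FiberModel EG EM) 𝓘(ℝ, EN) A.actionGroupoid.src k v)
      (mfderiv 𝓘(ℝ, EN × FiberModel EG EM) 𝓘(ℝ, EN) A.actionGroupoid.tgt l w)) :
    @Eq EG (mfderiv 𝓘(ℝ, EN × FiberModel EG EM) 𝓘(ℝ, EG) A.toArrow (A.actionGroupoid.mul k l)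
        (A.actionGroupoid.tangentMul v w))
      (𝒢.tangentMul (mfderiv 𝓘(ℝ, EN × FiberModel EG EM) 𝓘(ℝ, EG) A.toArrow k v)
        (mfderiv 𝓘(ℝ, EN × FiberModel EG EM) 𝓘(ℝ, EG) A.toArrow l w)) := by
  have h1 : HasMFDerivAt (𝓘(ℝ, EN × FiberModel EG EM).prod 𝓘(ℝ, EN × FiberModel EG EM)) 𝓘(ℝ, EG)
      (A.toArrow ∘ Prod.fst) (k, l) _ :=
    HasMFDerivAt.comp (k, l) (mdifferentiableAt_toArrow k).hasMFDerivAt (hasMFDerivAt_fst (k, l))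
  have h2 : HasMFDerivAt (𝓘(ℝ, EN × FiberModel EG EM).prod 𝓘(ℝ, EN × FiberModel EG EM)) 𝓘(ℝ, EG)
      (A.toArrow ∘ Prod.snd) (k, l) _ :=
    HasMFDerivAt.comp (k, l) (mdifferentiableAt_toArrow l).hasMFDerivAt (hasMFDerivAt_snd (k, l))
  have h3 := HasMFDerivWithinAt.comp (g := fun p : G × G => 𝒢.mul p.1 p.2)
    (f := fun q : A.Arrows × A.Arrows => (A.toArrow q.1, A.toArrow q.2)) (k, l)
    (GroupoidMaps.hasMFDerivWithinAt_mul (src_toArrow hkl))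
    (h1.prodMk h2).hasMFDerivWithinAt (s := A.actionGroupoid.composable)
    (fun q hq => src_toArrow hq)
  exact GroupoidMaps.mfderiv_tangentMul_of_eqOn hkl (mdifferentiableAt_toArrow _) h3
    (fun q hq => congrArg Prod.snd (actionGroupoid_mul_val hq)) hvw

theorem mfderiv_ψ_src (k : A.Arrows) (Z : TangentSpace 𝓘(ℝ, EN × FiberModel EG EM) k) :
    @Eq EM (mfderiv 𝓘(ℝ, EN) 𝓘(ℝ, EM) A.ψ (A.actionGroupoid.src k)
      (mfderiv 𝓘(ℝ, EN × FiberModel EG EM) 𝓘(ℝ, EN) A.actionGroupoid.src k Z))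
      (mfderiv 𝓘(ℝ, EG) 𝓘(ℝ, EM) 𝒢.src k.1.2
        (mfderiv 𝓘(ℝ, EN × FiberModel EG EM) 𝓘(ℝ, EG) A.toArrow k Z)) := by
  have h1 := DFunLike.congr_fun (mfderiv_comp k
    (A.ψ_smooth.mdifferentiable (by simp) (A.actionGroupoid.src k))
    (GroupoidMaps.mdifferentiableAt_src (𝒢 := A.actionGroupoid) k)) Z
  have h2 := DFunLike.congr_fun (mfderiv_comp k
    (GroupoidMaps.mdifferentiableAt_src (𝒢 := 𝒢) (A.toArrow k)) (mdifferentiableAt_toArrow k)) Z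
  have h3 : A.ψ ∘ A.actionGroupoid.src = 𝒢.src ∘ A.toArrow := funext fun k => A.ψ_act _ _ k.2
  rw [h3] at h1
  exact h1.symm.trans h2

/-- The projection to `G` intertwines units, inverses and multiplication, so the preimage of a
subgroupoid under its differential is closed under them. -/
theorem isCartanConnection_inducedDistribution [T2Space M] [T2Space N]
    (hψ : Manifold.IsSubmersion 𝓘(ℝ, EN) 𝓘(ℝ, EM) ∞ A.ψ) (hH : 𝒢.IsCartanConnection H) :
    A.actionGroupoid.IsCartanConnection (A.inducedDistribution H) := by
  refine ⟨⟨isSmoothDistribution_inducedDistribution hψ hH, fun n v => ?_, fun k v hv => ?_,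
    fun k l v hv w hw hvw => ?_⟩, isCompl_inducedDistribution hH.isCompl⟩
  · have h1 := DFunLike.congr_fun (mfderiv_comp n
      (mdifferentiableAt_toArrow (A.actionGroupoid.one n))
      (GroupoidMaps.mdifferentiableAt_one (𝒢 := A.actionGroupoid) n)) v
    have h2 := DFunLike.congr_fun (mfderiv_comp n
      (GroupoidMaps.mdifferentiableAt_one (𝒢 := 𝒢) (A.ψ n))
      (A.ψ_smooth.mdifferentiable (by simp) n)) v
    have h3 : A.toArrow ∘ A.actionGroupoid.one = 𝒢.one ∘ A.ψ := rfl
    rw [h3] at h1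
    exact mem_distribution_of_eq H rfl (h1.symm.trans h2) (hH.multiplicative.one_mem _ _)
  · have h1 := DFunLike.congr_fun (mfderiv_comp k
      (mdifferentiableAt_toArrow (A.actionGroupoid.inv k))
      ((contMDiff_actionGroupoid_inv (A := A)).mdifferentiable (by simp) k)) v
    have h2 := DFunLike.congr_fun (mfderiv_comp k
      (h𝒢.inv_smooth.mdifferentiable (by simp) (A.toArrow k)) (mdifferentiableAt_toArrow k)) v
    have h3 : A.toArrow ∘ A.actionGroupoid.inv = 𝒢.inv ∘ A.toArrow := rfl
    rw [h3] at h1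
    exact mem_distribution_of_eq H rfl (h1.symm.trans h2) (hH.multiplicative.inv_mem _ _ hv)
  · obtain ⟨hkl, hvw'⟩ := tangentBundle_mk_injective hvw
    have h1 := mfderiv_toArrow_tangentMul hkl hvw'
    refine mem_distribution_of_eq H (congrArg Prod.snd (actionGroupoid_mul_val hkl)) h1
      (hH.multiplicative.mul_mem _ _ _ hv _ hw ?_)
    refine tangentBundle_mk_eq (src_toArrow hkl) ?_
    refine (mfderiv_ψ_src k v).symm.trans (Eq.trans ?_ (mfderiv_ψ_tgt l w))
    exact mfderiv_congr_apply (E := EN) (E' := EM) A.ψ hkl hvw'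

end RightAction

namespace RightAction

variable {EG EM EN G M N : Type*}
  [NormedAddCommGroup EG] [NormedSpace ℝ EG] [FiniteDimensional ℝ EG]
  [NormedAddCommGroup EM] [NormedSpace ℝ EM] [FiniteDimensional ℝ EM]
  [NormedAddCommGroup EN] [NormedSpace ℝ EN] [FiniteDimensional ℝ EN]
  [TopologicalSpace G] [ChartedSpace EG G] [IsManifold 𝓘(ℝ, EG) ∞ G]
  [TopologicalSpace M] [ChartedSpace EM M] [IsManifold 𝓘(ℝ, EM) ∞ M]
  [TopologicalSpace N] [ChartedSpace EN N] [IsManifold 𝓘(ℝ, EN) ∞ N]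
  {𝒢 : GroupoidMaps EG EM G M} [h𝒢 : IsLieGroupoid 𝒢] {A : RightAction 𝒢 EN N}
  {H : ∀ g : G, Submodule ℝ (TangentSpace 𝓘(ℝ, EG) g)}

/-! #### The identification of the fibres of the Lie algebroids -/

theorem fiberIncl_val {n : N} {g : G} (h : 𝒢.tgt g = A.ψ n) : (A.fiberIncl n g).1 = (n, g) := by
  simp [fiberIncl, h]

theorem fiberIncl_one (n : N) : A.fiberIncl n (𝒢.one (A.ψ n)) = A.actionGroupoid.one n :=
  Subtype.ext (fiberIncl_val (h𝒢.tgt_one _))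

theorem hasMFDerivWithinAt_fiberIncl (n : N) :
    HasMFDerivWithinAt 𝓘(ℝ, EG) 𝓘(ℝ, EN × FiberModel EG EM) (A.fiberIncl n)
      {g | 𝒢.tgt g = A.ψ n} (𝒢.one (A.ψ n)) (A.algebroidLift n) := by
  have h1 : ContMDiff 𝓘(ℝ, EG) (𝓘(ℝ, EN).prod 𝓘(ℝ, EG)) ∞ fun g : G => (n, g) :=
    contMDiff_const.prodMk contMDiff_id
  have h2 : ContMDiffWithinAt 𝓘(ℝ, EG) 𝓘(ℝ, EN × FiberModel EG EM) ∞ (A.fiberIncl n)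
      {g | 𝒢.tgt g = A.ψ n} (𝒢.one (A.ψ n)) :=
    contMDiffWithinAt_of_val ((h1.contMDiffAt.contMDiffWithinAt).congr
      (fun g hg => fiberIncl_val hg) (fiberIncl_val (h𝒢.tgt_one _)))
  exact (h2.mdifferentiableWithinAt (by simp)).hasMFDerivWithinAt

theorem mfderiv_tgt_algebroidLift {n : N} {ξ : TangentSpace 𝓘(ℝ, EG) (𝒢.one (A.ψ n))}
    (hξ : ξ ∈ 𝒢.vertical (𝒢.one (A.ψ n))) :
    mfderiv 𝓘(ℝ, EN × FiberModel EG EM) 𝓘(ℝ, EN) A.actionGroupoid.tgt (A.actionGroupoid.one n)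
      (A.algebroidLift n ξ) = 0 := by
  have h1 := HasMFDerivWithinAt.comp (u := univ) (𝒢.one (A.ψ n))
    (GroupoidMaps.mdifferentiableAt_tgt (𝒢 := A.actionGroupoid)
      (A.fiberIncl n (𝒢.one (A.ψ n)))).hasMFDerivAt.hasMFDerivWithinAt
    (hasMFDerivWithinAt_fiberIncl (A := A) n) (fun _ _ => mem_univ _)
  have h2 : HasMFDerivWithinAt 𝓘(ℝ, EG) 𝓘(ℝ, EN) (A.actionGroupoid.tgt ∘ A.fiberIncl n)
      {g | 𝒢.tgt g = A.ψ n} (𝒢.one (A.ψ n)) _ :=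
    (hasMFDerivAt_const n (𝒢.one (A.ψ n))).hasMFDerivWithinAt.congr_of_eventuallyEq
      (Filter.eventuallyEq_of_mem self_mem_nhdsWithin
        fun g hg => congrArg Prod.fst (fiberIncl_val hg))
      (congrArg Prod.fst (fiberIncl_val (h𝒢.tgt_one _)))
  have h3 := h1.eq_of_tangent_fiber h𝒢.tgt_submersion (h𝒢.tgt_one _) h2 hξ
  exact (mfderiv_congr_apply (E := EN × FiberModel EG EM) (E' := EN) A.actionGroupoid.tgt
    (fiberIncl_one n).symm rfl).trans h3

theorem mfderiv_toArrow_algebroidLift {n : N} {ξ : TangentSpace 𝓘(ℝ, EG) (𝒢.one (A.ψ n))}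
    (hξ : ξ ∈ 𝒢.vertical (𝒢.one (A.ψ n))) :
    mfderiv 𝓘(ℝ, EN × FiberModel EG EM) 𝓘(ℝ, EG) A.toArrow (A.actionGroupoid.one n)
      (A.algebroidLift n ξ) = ξ := by
  have h1 := HasMFDerivWithinAt.comp (u := univ) (𝒢.one (A.ψ n))
    (mdifferentiableAt_toArrow (A.fiberIncl n (𝒢.one (A.ψ n)))).hasMFDerivAt.hasMFDerivWithinAt
    (hasMFDerivWithinAt_fiberIncl (A := A) n) (fun _ _ => mem_univ _)
  have h2 : HasMFDerivWithinAt 𝓘(ℝ, EG) 𝓘(ℝ, EG) (A.toArrow ∘ A.fiberIncl n)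
      {g | 𝒢.tgt g = A.ψ n} (𝒢.one (A.ψ n)) _ :=
    (hasMFDerivAt_id (𝒢.one (A.ψ n))).hasMFDerivWithinAt.congr_of_eventuallyEq
      (Filter.eventuallyEq_of_mem self_mem_nhdsWithin
        fun g hg => congrArg Prod.snd (fiberIncl_val hg))
      (congrArg Prod.snd (fiberIncl_val (h𝒢.tgt_one _)))
  have h3 := h1.eq_of_tangent_fiber h𝒢.tgt_submersion (h𝒢.tgt_one _) h2 hξ
  exact (mfderiv_congr_apply (E := EN × FiberModel EG EM) (E' := EG) A.toArrow
    (fiberIncl_one n).symm rfl).trans h3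

theorem mfderiv_toArrow_mem_vertical {n : N}
    {Z : TangentSpace 𝓘(ℝ, EN × FiberModel EG EM) (A.actionGroupoid.one n)}
    (hZ : Z ∈ A.actionGroupoid.vertical (A.actionGroupoid.one n)) :
    mfderiv 𝓘(ℝ, EN × FiberModel EG EM) 𝓘(ℝ, EG) A.toArrow (A.actionGroupoid.one n) Z ∈
      𝒢.vertical (𝒢.one (A.ψ n)) := by
  have h := mfderiv_ψ_tgt (A.actionGroupoid.one n) Z
  have hZ' : mfderiv 𝓘(ℝ, EN × FiberModel EG EM) 𝓘(ℝ, EN) A.actionGroupoid.tgt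
    (A.actionGroupoid.one n) Z = 0 := hZ
  rw [hZ'] at h
  exact h.symm.trans (map_zero _)

/-- On vertical vectors at the units the differential of the projection to `G` inverts the
identification. Equalities in the algebroid of the action groupoid are checked in `TG` this way. -/
theorem eq_algebroidLift {n : N}
    {Z : TangentSpace 𝓘(ℝ, EN × FiberModel EG EM) (A.actionGroupoid.one n)}
    {ξ : TangentSpace 𝓘(ℝ, EG) (𝒢.one (A.ψ n))}
    (hZ : Z ∈ A.actionGroupoid.vertical (A.actionGroupoid.one n))
    (h : mfderiv 𝓘(ℝ, EN × FiberModel EG EM) 𝓘(ℝ, EG) A.toArrow (A.actionGroupoid.one n) Z = ξ) :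
    Z = A.algebroidLift n ξ := by
  have hξ : ξ ∈ 𝒢.vertical (𝒢.one (A.ψ n)) := h ▸ mfderiv_toArrow_mem_vertical hZ
  refine tangent_ext (Eq.trans hZ (mfderiv_tgt_algebroidLift hξ).symm) ?_
  exact h.trans (mfderiv_toArrow_algebroidLift hξ).symm

theorem isSection_pullbackSection {ν : 𝒢.Sec} (hν : 𝒢.IsSection ν) :
    A.actionGroupoid.IsSection (A.pullbackSection ν) := by
  refine ⟨fun n => mfderiv_tgt_algebroidLift (hν.mem_vertical _), fun n => ?_⟩
  refine contMDiffAt_along_of_components ?_ ?_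
  · refine (ContMDiffAt.zero_along contMDiffAt_id).congr_of_eventuallyEq
      (Filter.Eventually.of_forall fun n => ?_)
    exact tangentBundle_mk_eq rfl (mfderiv_tgt_algebroidLift (hν.mem_vertical _))
  · refine (ContMDiffAt.comp n (hν.smooth (A.ψ n)) (A.ψ_smooth n)).congr_of_eventuallyEq
      (Filter.Eventually.of_forall fun n => ?_)
    exact tangentBundle_mk_eq rfl (mfderiv_toArrow_algebroidLift (hν.mem_vertical _))

theorem tangentMul_one_congr {g : G} (v : TangentSpace 𝓘(ℝ, EG) g) (ν : 𝒢.Sec) {m m' : M}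
    (h : m = m') : @Eq EG (𝒢.tangentMul v (ν m)) (𝒢.tangentMul v (ν m')) := by
  subst h
  rfl

/-- Left-invariant fields are tangent products `0 · ν`, and the projection to `G` is multiplicative.
-/
theorem mfderiv_toArrow_leftInvariant {ν : 𝒢.Sec} (hν : 𝒢.IsSection ν) (k : A.Arrows) :
    mfderiv 𝓘(ℝ, EN × FiberModel EG EM) 𝓘(ℝ, EG) A.toArrow k
      (A.actionGroupoid.leftInvariant (A.pullbackSection ν) k) =
        𝒢.leftInvariant ν (A.toArrow k) := by
  have hσ := (isSection_pullbackSection (A := A) hν).mem_vertical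
  have h1 := mfderiv_congr_apply (E := EN × FiberModel EG EM) (E' := EG) A.toArrow
    ((isLieGroupoid_actionGroupoid (A := A)).mul_one k).symm
    (GroupoidMaps.leftInvariant_eq_tangentMul hσ k)
  have h2 := mfderiv_toArrow_tangentMul (GroupoidMaps.src_eq_tgt_one (𝒢 := A.actionGroupoid) k)
    (GroupoidMaps.mfderiv_src_zero_eq hσ k)
  refine h1.trans (h2.trans (Eq.trans ?_ (GroupoidMaps.leftInvariant_eq_tangentMul
    hν.mem_vertical (A.toArrow k)).symm))
  rw [map_zero]
  refine Eq.trans ?_ (tangentMul_one_congr 0 ν (A.ψ_act _ _ k.2))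
  exact congrArg (𝒢.tangentMul (0 : TangentSpace 𝓘(ℝ, EG) (A.toArrow k)))
    (mfderiv_toArrow_algebroidLift (A := A) (n := A.actionGroupoid.src k) (hν.mem_vertical _))

theorem bracket_pullbackSection {ν μ : 𝒢.Sec} (hν : 𝒢.IsSection ν) (hμ : 𝒢.IsSection μ) :
    A.actionGroupoid.bracket (A.pullbackSection ν) (A.pullbackSection μ) =
      A.pullbackSection (𝒢.bracket ν μ) := by
  have := FiniteDimensional.complete ℝ EG
  have := FiniteDimensional.complete ℝ (EN × FiberModel EG EM)
  have hσ := isSection_pullbackSection (A := A) hν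
  have hτ := isSection_pullbackSection (A := A) hμ
  funext n
  refine eq_algebroidLift ((GroupoidMaps.isSection_bracket hσ hτ).mem_vertical n) ?_
  exact mfderiv_mlieBracket_of_related (contMDiff_toArrow (A := A) _)
    (GroupoidMaps.smoothAt_leftInvariant hσ _) (GroupoidMaps.smoothAt_leftInvariant hτ _)
    (GroupoidMaps.smoothAt_leftInvariant hν _) (GroupoidMaps.smoothAt_leftInvariant hμ _)
    (Filter.Eventually.of_forall fun k => mfderiv_toArrow_leftInvariant hν k)
    (Filter.Eventually.of_forall fun k => mfderiv_toArrow_leftInvariant hμ k)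

theorem mfderiv_ψ_anchor {n : N}
    (Z : TangentSpace 𝓘(ℝ, EN × FiberModel EG EM) (A.actionGroupoid.one n)) :
    @Eq EM (mfderiv 𝓘(ℝ, EN) 𝓘(ℝ, EM) A.ψ n (mfderiv 𝓘(ℝ, EN × FiberModel EG EM) 𝓘(ℝ, EN)
        A.actionGroupoid.src (A.actionGroupoid.one n) Z))
      (mfderiv 𝓘(ℝ, EG) 𝓘(ℝ, EM) 𝒢.src (𝒢.one (A.ψ n))
        (mfderiv 𝓘(ℝ, EN × FiberModel EG EM) 𝓘(ℝ, EG) A.toArrow (A.actionGroupoid.one n) Z)) :=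
  (mfderiv_congr_apply (E := EN) (E' := EM) A.ψ (A.act_one n).symm rfl).trans
    (mfderiv_ψ_src (A.actionGroupoid.one n) Z)

theorem mfderiv_ψ_anchor_of_eq {n : N} {σ : A.actionGroupoid.Sec} {ν : 𝒢.Sec}
    (hν : ν (A.ψ n) ∈ 𝒢.vertical (𝒢.one (A.ψ n))) (h : σ n = A.algebroidLift n (ν (A.ψ n))) :
    mfderiv 𝓘(ℝ, EN) 𝓘(ℝ, EM) A.ψ n (A.actionGroupoid.anchor σ n) = 𝒢.anchor ν (A.ψ n) := by
  refine (mfderiv_ψ_anchor (σ n)).trans ?_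
  rw [h, mfderiv_toArrow_algebroidLift hν]
  rfl

/-! #### The connection induced on the action groupoid -/

/-- Both fields in the bracket that defines the connection are related to their counterparts on `G`,
so the brackets are related. -/
theorem inducedConnection_pullbackSection_of_related [T2Space M] [T2Space N]
    (hψ : Manifold.IsSubmersion 𝓘(ℝ, EN) 𝓘(ℝ, EM) ∞ A.ψ) (hH : 𝒢.IsCartanConnection H)
    {X : VecField EN N} {V : VecField EM M} {ν : 𝒢.Sec} {n : N} (hX : X.Smooth) (hV : V.Smooth)
    (hν : 𝒢.IsSection ν)
    (h : ∀ᶠ n in 𝓝 n, mfderiv 𝓘(ℝ, EN) 𝓘(ℝ, EM) A.ψ n (X n) = V (A.ψ n)) :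
    A.actionGroupoid.inducedConnection (A.inducedDistribution H) X (A.pullbackSection ν) n =
      A.algebroidLift n (𝒢.inducedConnection H V ν (A.ψ n)) := by
  have := FiniteDimensional.complete ℝ EG
  have := FiniteDimensional.complete ℝ (EN × FiberModel EG EM)
  have hK := isCartanConnection_inducedDistribution hψ hH
  have hσ := isSection_pullbackSection (A := A) hν
  refine eq_algebroidLift (((GroupoidMaps.isConnection_inducedConnection hK).isSection X _ hX
    hσ).mem_vertical n) ?_
  refine mfderiv_mlieBracket_of_related (contMDiff_toArrow (A := A) _)
    (GroupoidMaps.smooth_horLift hK hX _) (GroupoidMaps.smoothAt_leftInvariant hσ _)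
    (GroupoidMaps.smooth_horLift hH hV _) (GroupoidMaps.smoothAt_leftInvariant hν _) ?_
    (Filter.Eventually.of_forall fun k => mfderiv_toArrow_leftInvariant hν k)
  filter_upwards [((contMDiff_actionGroupoid_tgt (A := A)).continuous.tendsto
    (A.actionGroupoid.one n)).eventually h] with k hk
  exact mfderiv_toArrow_horLift hH.isCompl hk

theorem _root_.GroupoidMaps.IsConnection.congr_left [T2Space M] {D : 𝒢.ConnOp}
    (hD : 𝒢.IsConnection D) {V W : VecField EM M} {ν : 𝒢.Sec} {m : M} (hV : V.Smooth)
    (hW : W.Smooth) (hν : 𝒢.IsSection ν) (h : V m = W m) : D V ν m = D W ν m := by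
  have hT : VecField.IsTensorialAt (fun V => D V ν m) m := VecField.isTensorialAt_mk
    (fun V W hV hW => congrFun (hD.add_left V W ν hV hW hν) m)
    (fun f V hf hV => congrFun (hD.smul_left f V ν hf hV hν) m)
  exact hT.congr hV hW h

/-- Only the values of `X` at `n` and of `V` at `ψ n` matter, so both may be replaced by fields that
are related on a neighbourhood. -/
theorem isPullbackConnection_inducedConnection [T2Space M] [T2Space N]
    (hψ : Manifold.IsSubmersion 𝓘(ℝ, EN) 𝓘(ℝ, EM) ∞ A.ψ) (hH : 𝒢.IsCartanConnection H) :
    A.IsPullbackConnection (𝒢.inducedConnection H)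
      (A.actionGroupoid.inducedConnection (A.inducedDistribution H)) := by
  have hK := GroupoidMaps.isConnection_inducedConnection
    (isCartanConnection_inducedDistribution hψ hH)
  refine ⟨hK, fun X V ν n hX hV hν h => ?_⟩
  obtain ⟨X', V', hX', hV', hXX', hXV'⟩ := hψ.exists_projectable (X n)
  rw [hK.congr_left hX hX' (isSection_pullbackSection hν) hXX'.symm,
    inducedConnection_pullbackSection_of_related hψ hH hX' hV' hν hXV']
  have h1 : V' (A.ψ n) = V (A.ψ n) := by
    rw [← hXV'.self_of_nhds, hXX', h]
  rw [(GroupoidMaps.isConnection_inducedConnection hH).congr_left hV' hV hν h1]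

end RightAction

/-! ### Local frames of the Lie algebroid -/

section VerticalFrame

variable {EG EM G M : Type*}
  [NormedAddCommGroup EG] [NormedSpace ℝ EG] [FiniteDimensional ℝ EG]
  [NormedAddCommGroup EM] [NormedSpace ℝ EM] [FiniteDimensional ℝ EM]
  [TopologicalSpace G] [ChartedSpace EG G] [IsManifold 𝓘(ℝ, EG) ∞ G]
  [TopologicalSpace M] [ChartedSpace EM M] [IsManifold 𝓘(ℝ, EM) ∞ M] [T2Space M]
  {𝒢 : GroupoidMaps EG EM G M} [h𝒢 : IsLieGroupoid 𝒢]

/-- Around each point, the Lie algebroid has a frame, cut off by a function, with smooth dual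
coframe. -/
theorem GroupoidMaps.exists_frame (m₀ : M) :
    ∃ (χ : M → ℝ) (ν : Fin (Module.finrank ℝ (FiberModel EG EM)) → 𝒢.Sec)
      (c : Fin (Module.finrank ℝ (FiberModel EG EM)) → ∀ g : G, TangentSpace 𝓘(ℝ, EG) g →L[ℝ] ℝ),
      ContMDiff 𝓘(ℝ, EM) 𝓘(ℝ, ℝ) ∞ χ ∧ χ m₀ = 1 ∧ (∀ i, 𝒢.IsSection (ν i)) ∧
      (∀ m ∈ tsupport χ, ∀ ξ ∈ 𝒢.vertical (𝒢.one m),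
        χ m • ξ = ∑ i, c i (𝒢.one m) ξ • ν i m) ∧
      ∀ (EN N : Type*) [NormedAddCommGroup EN] [NormedSpace ℝ EN] [TopologicalSpace N]
        [ChartedSpace EN N] [IsManifold 𝓘(ℝ, EN) ∞ N] (b : N → M)
        (ξ : ∀ n, TangentSpace 𝓘(ℝ, EG) (𝒢.one (b n))) (n : N), b n ∈ tsupport χ →
        ContMDiffAt 𝓘(ℝ, EN) 𝓘(ℝ, EG).tangent ∞
          (fun n => (⟨𝒢.one (b n), ξ n⟩ : TangentBundle 𝓘(ℝ, EG) G)) n →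
        ∀ i, ContMDiffAt 𝓘(ℝ, EN) 𝓘(ℝ, ℝ) ∞ (fun n => c i (𝒢.one (b n)) (ξ n)) n := by
  let p₀ : FiberProduct 𝒢.tgt 𝒢.tgt := ⟨(𝒢.one m₀, 𝒢.one m₀), rfl⟩
  have ht := h𝒢.tgt_submersion
  set φ := FiberProduct.totChart ht p₀
  set sp := FiberProduct.split ht p₀
  have hφ := FiberProduct.totChart_mem_maximalAtlas ht p₀
  have h₀ : 𝒢.one m₀ ∈ φ.source := FiberProduct.mem_totChart_source ht p₀
  obtain ⟨χ, hχ, hχ₁, hs⟩ := exists_bump (E := EM) m₀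
    (h𝒢.one_smooth.continuous.continuousAt.preimage_mem_nhds (φ.open_source.mem_nhds h₀))
  let bs := Module.finBasis ℝ (FiberModel EG EM)
  -- Vertical vectors are those with vanishing base coordinate, so the fibre coordinates form a
  -- coframe on them.
  let c₀ : Fin (Module.finrank ℝ (FiberModel EG EM)) → EG →L[ℝ] ℝ := fun i =>
    (LinearMap.toContinuousLinearMap (bs.coord i)).comp
      ((ContinuousLinearMap.snd ℝ EM (FiberModel EG EM)).comp
        (sp : EG →L[ℝ] EM × FiberModel EG EM))
  refine ⟨χ, fun i m => χ m • φ.coordField (sp.symm (0, bs i)) (𝒢.one m),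
    fun i g => (c₀ i).comp (mvfderiv 𝓘(ℝ, EG) φ g), hχ, hχ₁.self_of_nhds,
    fun i => ⟨fun m => ?_, ?_⟩, fun m hm ξ hξ => ?_, ?_⟩
  · by_cases hm : m ∈ tsupport χ
    · refine Submodule.smul_mem _ _ ?_
      refine (FiberProduct.baseChart ht p₀).mvfderiv_injective
        (FiberProduct.baseChart_mem_maximalAtlas ht p₀)
        (FiberProduct.base_of_mem ht p₀ (hs hm)).1 ?_
      refine (FiberProduct.mvfderiv_baseChart ht p₀ (hs hm) _).trans ?_
      rw [φ.mvfderiv_coordField hφ (hs hm), map_zero]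
      exact congrArg Prod.fst (sp.apply_symm_apply _)
    · have h : χ m • φ.coordField (sp.symm (0, bs i)) (𝒢.one m) = 0 := by
        rw [image_eq_zero_of_notMem_tsupport hm, zero_smul]
      have h' := zero_mem (𝒢.vertical (𝒢.one m))
      rw [← h] at h'
      exact h'
  · exact contMDiff_smul_along_of_tsupport hχ h𝒢.one_smooth fun m hm =>
      φ.contMDiffAt_coordField hφ (h𝒢.one_smooth m) contMDiffAt_const (hs hm)
  · refine φ.mvfderiv_injective hφ (hs hm) (sp.injective ?_)
    have h1 : (sp (mvfderiv 𝓘(ℝ, EG) φ (𝒢.one m) ξ)).1 = 0 := by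
      have hξ' : mfderiv 𝓘(ℝ, EG) 𝓘(ℝ, EM) 𝒢.tgt (𝒢.one m) ξ = 0 := hξ
      rw [← FiberProduct.mvfderiv_baseChart ht p₀ (hs hm), hξ', map_zero]
    have h2 : sp (mvfderiv 𝓘(ℝ, EG) φ (𝒢.one m) ξ) =
        ∑ i, c₀ i (mvfderiv 𝓘(ℝ, EG) φ (𝒢.one m) ξ) • ((0 : EM), bs i) := by
      refine Prod.ext ?_ ?_
      · rw [h1, Prod.fst_sum]
        simp
      · rw [Prod.snd_sum]
        exact (bs.sum_repr _).symm
    simp only [map_smul, map_sum]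
    rw [h2, Finset.smul_sum]
    refine Finset.sum_congr rfl fun i _ => ?_
    rw [φ.mvfderiv_coordField hφ (hs hm), sp.apply_symm_apply, smul_comm]
    rfl
  · intro EN N _ _ _ _ _ b ξ n hn hξ i
    exact (c₀ i).contMDiff.contMDiffAt.comp n
      ((φ.contMDiffAt_of_mem hφ (hs hn)).mvfderiv_apply_along (b := fun n => 𝒢.one (b n)) hξ)

end VerticalFrame

/-! ### Pullback sections span the sections of the Lie algebroid -/

namespace RightAction

variable {EG EM EN G M N : Type*}
  [NormedAddCommGroup EG] [NormedSpace ℝ EG] [FiniteDimensional ℝ EG]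
  [NormedAddCommGroup EM] [NormedSpace ℝ EM] [FiniteDimensional ℝ EM]
  [NormedAddCommGroup EN] [NormedSpace ℝ EN] [FiniteDimensional ℝ EN]
  [TopologicalSpace G] [ChartedSpace EG G] [IsManifold 𝓘(ℝ, EG) ∞ G]
  [TopologicalSpace M] [ChartedSpace EM M] [IsManifold 𝓘(ℝ, EM) ∞ M] [T2Space M]
  [TopologicalSpace N] [ChartedSpace EN N] [IsManifold 𝓘(ℝ, EN) ∞ N] [T2Space N]
  {𝒢 : GroupoidMaps EG EM G M} [h𝒢 : IsLieGroupoid 𝒢] {A : RightAction 𝒢 EN N}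

/-- Around each point, the sections of the Lie algebroid of the action groupoid are combinations
of pullbacks. -/
theorem exists_pullback_decomposition (n₀ : N) :
    ∃ ν : Fin (Module.finrank ℝ (FiberModel EG EM)) → 𝒢.Sec, (∀ i, 𝒢.IsSection (ν i)) ∧
      ∀ σ : A.actionGroupoid.Sec, A.actionGroupoid.IsSection σ →
        ∃ (χ : N → ℝ) (f : Fin (Module.finrank ℝ (FiberModel EG EM)) → N → ℝ),
          ContMDiff 𝓘(ℝ, EN) 𝓘(ℝ, ℝ) ∞ χ ∧ χ n₀ = 1 ∧
          (∀ i, ContMDiff 𝓘(ℝ, EN) 𝓘(ℝ, ℝ) ∞ (f i)) ∧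
          ∀ n, χ n • σ n = ∑ i, f i n • A.pullbackSection (ν i) n := by
  obtain ⟨χ, ν, c, hχ, hχ₀, hν, hdec, hc⟩ := GroupoidMaps.exists_frame (𝒢 := 𝒢) (A.ψ n₀)
  refine ⟨ν, hν, fun σ hσ => ?_⟩
  have hχψ : ContMDiff 𝓘(ℝ, EN) 𝓘(ℝ, ℝ) ∞ (fun n => χ (A.ψ n)) := hχ.comp A.ψ_smooth
  let ξ : ∀ n, TangentSpace 𝓘(ℝ, EG) (𝒢.one (A.ψ n)) := fun n =>
    mfderiv 𝓘(ℝ, EN × FiberModel EG EM) 𝓘(ℝ, EG) A.toArrow (A.actionGroupoid.one n) (σ n)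
  have hξv : ∀ n, ξ n ∈ 𝒢.vertical (𝒢.one (A.ψ n)) := fun n =>
    mfderiv_toArrow_mem_vertical (hσ.mem_vertical n)
  have hξs : ContMDiff 𝓘(ℝ, EN) 𝓘(ℝ, EG).tangent ∞
      (fun n => (⟨𝒢.one (A.ψ n), ξ n⟩ : TangentBundle 𝓘(ℝ, EG) G)) := fun n =>
    ContMDiffAt.tangentMap_along (b := A.actionGroupoid.one) (contMDiff_toArrow (A := A) _)
      (hσ.smooth n)
  -- One factor `χ` belongs to the frame, the other makes the coefficients globally smooth.
  refine ⟨fun n => χ (A.ψ n) * χ (A.ψ n), fun i n => χ (A.ψ n) * c i (𝒢.one (A.ψ n)) (ξ n),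
    hχψ.mul hχψ, by simp [hχ₀], fun i => ?_, fun n => ?_⟩
  · refine contMDiff_mul_of_tsupport hχψ fun n hn => ?_
    exact hc EN N A.ψ ξ n (tsupport_comp_subset_preimage χ A.ψ_smooth.continuous hn) (hξs n) i
  · by_cases hn : A.ψ n ∈ tsupport χ
    · have h1 : σ n = A.algebroidLift n (ξ n) := eq_algebroidLift (hσ.mem_vertical n) rfl
      have h2 := congrArg (A.algebroidLift n) (hdec _ hn (ξ n) (hξv n))
      simp only [map_smul, map_sum] at h2
      rw [mul_smul]
      refine (congrArg (fun z => χ (A.ψ n) • χ (A.ψ n) • z) h1).trans ?_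
      refine (congrArg (fun z => χ (A.ψ n) • z) h2).trans ?_
      rw [Finset.smul_sum]
      exact Finset.sum_congr rfl fun i _ => (mul_smul _ _ _).symm
    · simp [image_eq_zero_of_notMem_tsupport hn]

end RightAction

/-- Locality follows from the Leibniz rule for `χ • ν = χ • μ` with a bump function `χ`. -/
theorem GroupoidMaps.IsConnection.congr_right {EG EM G M : Type*}
    [NormedAddCommGroup EG] [NormedSpace ℝ EG]
    [NormedAddCommGroup EM] [NormedSpace ℝ EM] [FiniteDimensional ℝ EM]
    [TopologicalSpace G] [ChartedSpace EG G] [IsManifold 𝓘(ℝ, EG) ∞ G]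
    [TopologicalSpace M] [ChartedSpace EM M] [IsManifold 𝓘(ℝ, EM) ∞ M] [T2Space M]
    {𝒢 : GroupoidMaps EG EM G M} {D : 𝒢.ConnOp} (hD : 𝒢.IsConnection D) {V : VecField EM M}
    {ν μ : 𝒢.Sec} {m : M} (hV : V.Smooth) (hν : 𝒢.IsSection ν) (hμ : 𝒢.IsSection μ)
    (h : ∀ᶠ x in 𝓝 m, ν x = μ x) : D V ν m = D V μ m := by
  obtain ⟨χ, hχ, hχ₁, hs⟩ := exists_bump (E := EM) m h
  have h1 : (fun x => χ x • ν x) = fun x => χ x • μ x := by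
    funext x
    by_cases hx : x ∈ tsupport χ
    · rw [show ν x = μ x from hs hx]
    · simp [image_eq_zero_of_notMem_tsupport hx]
  have h2 := congrFun (congrArg (D V) h1) m
  rw [hD.leibniz χ V ν hχ hV hν, hD.leibniz χ V μ hχ hV hμ] at h2
  simpa [hχ₁.self_of_nhds, h.self_of_nhds] using h2

namespace RightAction

variable {EG EM EN G M N : Type*}
  [NormedAddCommGroup EG] [NormedSpace ℝ EG] [FiniteDimensional ℝ EG]
  [NormedAddCommGroup EM] [NormedSpace ℝ EM] [FiniteDimensional ℝ EM]
  [NormedAddCommGroup EN] [NormedSpace ℝ EN] [FiniteDimensional ℝ EN]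
  [TopologicalSpace G] [ChartedSpace EG G] [IsManifold 𝓘(ℝ, EG) ∞ G]
  [TopologicalSpace M] [ChartedSpace EM M] [IsManifold 𝓘(ℝ, EM) ∞ M] [T2Space M]
  [TopologicalSpace N] [ChartedSpace EN N] [IsManifold 𝓘(ℝ, EN) ∞ N] [T2Space N]
  {𝒢 : GroupoidMaps EG EM G M} [h𝒢 : IsLieGroupoid 𝒢] {A : RightAction 𝒢 EN N}

/-! #### Reduction to projectable vector fields and pullback sections -/

variable (A) in
/-- Near `n₀`, the vector field `X` on `N` is `ψ`-related to the vector field `V` on `M`. -/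
def ProjectsNear (X : VecField EN N) (V : VecField EM M) (n₀ : N) : Prop :=
  ∀ᶠ n in 𝓝 n₀, mfderiv 𝓘(ℝ, EN) 𝓘(ℝ, EM) A.ψ n (X n) = V (A.ψ n)

theorem eq_zero_of_projectable {F : Type*} [AddCommGroup F] [Module ℝ F] {T : VecField EN N → F}
    {n₀ : N} (hψ : Manifold.IsSubmersion 𝓘(ℝ, EN) 𝓘(ℝ, EM) ∞ A.ψ)
    (hT : VecField.IsTensorialAt T n₀)
    (h : ∀ X V, X.Smooth → V.Smooth → A.ProjectsNear X V n₀ → T X = 0) {X : VecField EN N}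
    (hX : X.Smooth) : T X = 0 := by
  obtain ⟨e, χ, he, hχ, hs, hχ₁, hn, hV⟩ := hψ.exists_projectable_frame n₀
  rw [hT.eq_sum_chartCoeff he hχ hs hχ₁.self_of_nhds hX]
  refine Finset.sum_eq_zero fun i _ => ?_
  obtain ⟨V, hVs, hXV⟩ := hV (Module.finBasis ℝ EN i)
  rw [h _ V (smooth_cutoffField he hχ hs _) hVs hXV, smul_zero]

theorem eq_zero_of_pullbackSection {F : Type*} [AddCommGroup F] [Module ℝ F]
    {T : A.actionGroupoid.Sec → F} {n₀ : N}
    (hadd : ∀ σ τ, A.actionGroupoid.IsSection σ → A.actionGroupoid.IsSection τ →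
      T (σ + τ) = T σ + T τ)
    (hsmul : ∀ (f : N → ℝ) σ, ContMDiff 𝓘(ℝ, EN) 𝓘(ℝ, ℝ) ∞ f → A.actionGroupoid.IsSection σ →
      T (fun n => f n • σ n) = f n₀ • T σ)
    (h : ∀ ν, 𝒢.IsSection ν → T (A.pullbackSection ν) = 0) {σ : A.actionGroupoid.Sec}
    (hσ : A.actionGroupoid.IsSection σ) : T σ = 0 := by
  have hT : IsTensorialAt (ContMDiff 𝓘(ℝ, EN) 𝓘(ℝ, ℝ) ∞) A.actionGroupoid.IsSection T n₀ :=
    ⟨GroupoidMaps.isSection_zero, fun _ _ h h' => h.add h', fun _ _ hf h => h.smul hf, hadd, hsmul⟩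
  obtain ⟨ν, hν, hdec⟩ := exists_pullback_decomposition (A := A) n₀
  obtain ⟨χ, f, hχ, hχ₀, hf, hsum⟩ := hdec σ hσ
  rw [hT.eq_sum hχ hχ₀ hσ hf (fun i => isSection_pullbackSection (hν i)) hsum]
  exact Finset.sum_eq_zero fun i _ => by rw [h _ (hν i), smul_zero]

/-! #### Curvatures of the pullback connection -/

section Pullback

variable {D : 𝒢.ConnOp} {D' : A.actionGroupoid.ConnOp} {X Y : VecField EN N} {V W : VecField EM M}
  {n₀ : N} {ν μ : 𝒢.Sec}

theorem ProjectsNear.mlieBracket (hXV : A.ProjectsNear X V n₀) (hYW : A.ProjectsNear Y W n₀)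
    (hX : X.Smooth) (hY : Y.Smooth) (hV : V.Smooth) (hW : W.Smooth) :
    A.ProjectsNear (VectorField.mlieBracket 𝓘(ℝ, EN) X Y)
      (VectorField.mlieBracket 𝓘(ℝ, EM) V W) n₀ := by
  have := FiniteDimensional.complete ℝ EN
  have := FiniteDimensional.complete ℝ EM
  filter_upwards [hXV.eventually_nhds, hYW.eventually_nhds] with n h1 h2
  exact mfderiv_mlieBracket_of_related (A.ψ_smooth n) (VecField.smooth_iff.1 hX n)
    (VecField.smooth_iff.1 hY n) (VecField.smooth_iff.1 hV _) (VecField.smooth_iff.1 hW _) h1 h2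

theorem projectsNear_anchor (hν : 𝒢.IsSection ν) :
    A.ProjectsNear (A.actionGroupoid.anchor (A.pullbackSection ν)) (𝒢.anchor ν) n₀ :=
  Filter.Eventually.of_forall fun _ => mfderiv_ψ_anchor_of_eq (hν.mem_vertical _) rfl

theorem ProjectsNear.eventually_eq_pullbackSection (hXV : A.ProjectsNear X V n₀)
    (hD' : A.IsPullbackConnection D D') (hX : X.Smooth) (hV : V.Smooth) (hν : 𝒢.IsSection ν) :
    ∀ᶠ n in 𝓝 n₀, D' X (A.pullbackSection ν) n = A.pullbackSection (D V ν) n :=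
  hXV.mono fun n hn => hD'.2 X V ν n hX hV hν hn

theorem ProjectsNear.basicVec (hXV : A.ProjectsNear X V n₀) (hD : 𝒢.IsConnection D)
    (hD' : A.IsPullbackConnection D D') (hX : X.Smooth) (hV : V.Smooth) (hν : 𝒢.IsSection ν) :
    A.ProjectsNear (A.actionGroupoid.basicVec D' (A.pullbackSection ν) X) (𝒢.basicVec D ν V) n₀ := by
  have hσ := isSection_pullbackSection (A := A) hν
  filter_upwards [hXV.eventually_eq_pullbackSection hD' hX hV hν,
    (projectsNear_anchor hν).mlieBracket hXV (GroupoidMaps.smooth_anchor hσ) hX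
      (GroupoidMaps.smooth_anchor hν) hV] with n h1 h2
  refine (map_add _ _ _).trans (congrArg₂ (· + ·) ?_ h2)
  exact mfderiv_ψ_anchor_of_eq ((hD.isSection V ν hV hν).mem_vertical _) h1

/-- The inner derivative is a pullback section near `n₀` only, which suffices because connections
are local operators. -/
theorem ProjectsNear.connection_connection (hXV : A.ProjectsNear X V n₀)
    (hYW : A.ProjectsNear Y W n₀) (hD : 𝒢.IsConnection D) (hD' : A.IsPullbackConnection D D')
    (hX : X.Smooth) (hY : Y.Smooth) (hV : V.Smooth) (hW : W.Smooth) (hν : 𝒢.IsSection ν) :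
    D' X (D' Y (A.pullbackSection ν)) n₀ = A.algebroidLift n₀ (D V (D W ν) (A.ψ n₀)) := by
  have hWν := hD.isSection W ν hW hν
  rw [hD'.1.congr_right hX (hD'.1.isSection Y _ hY (isSection_pullbackSection hν))
    (isSection_pullbackSection hWν) (hYW.eventually_eq_pullbackSection hD' hY hW hν)]
  exact hD'.2 X V _ n₀ hX hV hWν hXV.self_of_nhds

theorem curvature_pullbackSection (hXV : A.ProjectsNear X V n₀)
    (hYW : A.ProjectsNear Y W n₀) (hD : 𝒢.IsConnection D) (hD' : A.IsPullbackConnection D D')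
    (hX : X.Smooth) (hY : Y.Smooth) (hV : V.Smooth) (hW : W.Smooth) (hν : 𝒢.IsSection ν) :
    A.actionGroupoid.curvature D' X Y (A.pullbackSection ν) n₀ =
      A.algebroidLift n₀ (𝒢.curvature D V W ν (A.ψ n₀)) := by
  simp only [GroupoidMaps.curvature, Pi.sub_apply, map_sub]
  rw [hXV.connection_connection hYW hD hD' hX hY hV hW hν,
    hYW.connection_connection hXV hD hD' hY hX hW hV hν,
    hD'.2 _ _ ν n₀ (hX.mlieBracket hY) (hV.mlieBracket hW) hν
      (hXV.mlieBracket hYW hX hY hV hW).self_of_nhds]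

theorem basicCurvature_pullbackSection (hXV : A.ProjectsNear X V n₀)
    (hD : 𝒢.IsConnection D) (hD' : A.IsPullbackConnection D D')
    (hX : X.Smooth) (hV : V.Smooth) (hν : 𝒢.IsSection ν) (hμ : 𝒢.IsSection μ) :
    A.actionGroupoid.basicCurvature D' (A.pullbackSection ν) (A.pullbackSection μ) X n₀ =
      A.algebroidLift n₀ (𝒢.basicCurvature D ν μ V (A.ψ n₀)) := by
  have hσ := isSection_pullbackSection (A := A) hν
  have hτ := isSection_pullbackSection (A := A) hμ
  have hVν := hD.isSection V ν hV hν
  have hVμ := hD.isSection V μ hV hμ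
  simp only [GroupoidMaps.basicCurvature, Pi.sub_apply, Pi.add_apply, map_sub, map_add]
  rw [bracket_pullbackSection hν hμ, hD'.2 X V _ n₀ hX hV (GroupoidMaps.isSection_bracket hν hμ)
      hXV.self_of_nhds,
    GroupoidMaps.bracket_congr (hXV.eventually_eq_pullbackSection hD' hX hV hν)
      (Filter.Eventually.of_forall fun _ => rfl),
    GroupoidMaps.bracket_congr (μ := D' X (A.pullbackSection μ))
      (Filter.Eventually.of_forall fun _ => rfl)
      (hXV.eventually_eq_pullbackSection hD' hX hV hμ),
    bracket_pullbackSection hVν hμ, bracket_pullbackSection hν hVμ,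
    hD'.2 _ _ ν n₀ (hD'.1.smooth_basicVec hτ hX) (hD.smooth_basicVec hμ hV) hν
      (hXV.basicVec hD hD' hX hV hμ).self_of_nhds,
    hD'.2 _ _ μ n₀ (hD'.1.smooth_basicVec hσ hX) (hD.smooth_basicVec hν hV) hμ
      (hXV.basicVec hD hD' hX hV hν).self_of_nhds]
  rfl

/-- Tensoriality reduces `X` to a projectable field and both sections to pullbacks, where the basic
curvature is the lift of a vanishing one. -/
theorem isAdjustment_of_isPullbackConnection
    (hψ : Manifold.IsSubmersion 𝓘(ℝ, EN) 𝓘(ℝ, EM) ∞ A.ψ) (hD : 𝒢.IsAdjustment D)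
    (hD' : A.IsPullbackConnection D D') : A.actionGroupoid.IsAdjustment D' := by
  refine ⟨hD'.1, fun σ τ X hσ hτ hX => funext fun n₀ => ?_⟩
  refine eq_zero_of_projectable (A := A)
    (T := fun X => A.actionGroupoid.basicCurvature D' σ τ X n₀) hψ
    (VecField.isTensorialAt_mk
      (fun X Y hX hY => congrFun (hD'.1.basicCurvature_add_vec hσ hτ hX hY) n₀)
      (fun f X hf hX => congrFun (hD'.1.basicCurvature_smul_vec hf hσ hτ hX) n₀)) ?_ hX
  intro X V hX hV hXV
  -- The reduction is carried out in the second slot with the first arbitrary; antisymmetry then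
  -- gives the other slot.
  have key : ∀ {σ τ}, A.actionGroupoid.IsSection σ →
      (∀ ν, 𝒢.IsSection ν → A.actionGroupoid.basicCurvature D' σ (A.pullbackSection ν) X n₀ = 0) →
      A.actionGroupoid.IsSection τ → A.actionGroupoid.basicCurvature D' σ τ X n₀ = 0 :=
    fun {σ τ} hσ h hτ => eq_zero_of_pullbackSection (n₀ := n₀)
      (T := fun τ => A.actionGroupoid.basicCurvature D' σ τ X n₀)
      (fun τ τ' hτ hτ' => congrFun (hD'.1.basicCurvature_add_right hσ hτ hτ' hX) n₀)
      (fun f τ hf hτ => congrFun (hD'.1.basicCurvature_smul_right hf hσ hτ hX) n₀) h hτ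
  refine key hσ (fun μ hμ => ?_) hτ
  have hμ' := isSection_pullbackSection (A := A) hμ
  rw [hD'.1.basicCurvature_swap hσ hμ' hX, Pi.neg_apply, neg_eq_zero]
  refine key hμ' (fun ν hν => ?_) hσ
  rw [basicCurvature_pullbackSection hXV hD.isConnection hD' hX hV hμ hν,
    hD.basicCurvature_eq_zero μ ν V hμ hν hV]
  exact map_zero _

/-! #### The pullback of two-forms -/

variable {ζ : 𝒢.Form2}

theorem pullbackForm_eval {n : N}
    (hXV : mfderiv 𝓘(ℝ, EN) 𝓘(ℝ, EM) A.ψ n (X n) = V (A.ψ n))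
    (hYW : mfderiv 𝓘(ℝ, EN) 𝓘(ℝ, EM) A.ψ n (Y n) = W (A.ψ n)) :
    (A.pullbackForm ζ).eval X Y n = A.pullbackSection (ζ.eval V W) n := by
  refine congrArg (A.algebroidLift n) (congrArg (ζ (A.ψ n)) ?_)
  funext i
  fin_cases i
  · exact hXV
  · exact hYW

/-- Smoothness of `ζ` is known only on smooth fields of `M`. Expanding `X` and `Y` in a projectable
frame near `n₀` writes the value as a smooth combination of pullback sections. -/
theorem isForm2_pullbackForm (hψ : Manifold.IsSubmersion 𝓘(ℝ, EN) 𝓘(ℝ, EM) ∞ A.ψ)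
    (hζ : 𝒢.IsForm2 ζ) : A.actionGroupoid.IsForm2 (A.pullbackForm ζ) := by
  refine ⟨fun n v => mfderiv_tgt_algebroidLift (hζ.mem_vertical _ _), fun X Y hX hY =>
    ⟨fun n => mfderiv_tgt_algebroidLift (hζ.mem_vertical _ _), fun n₀ => ?_⟩⟩
  obtain ⟨e, χ, he, hχ, hs, hχ₁, hn, hV⟩ := hψ.exists_projectable_frame n₀
  choose V hVs hXV using hV
  let bs := Module.finBasis ℝ EN
  have hsm : ContMDiffAt 𝓘(ℝ, EN) 𝓘(ℝ, EN × FiberModel EG EM).tangent ∞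
      (fun n => (⟨A.actionGroupoid.one n, ∑ i, chartCoeff χ e X i n • ∑ j, chartCoeff χ e Y j n •
        A.pullbackSection (ζ.eval (V (bs i)) (V (bs j))) n⟩ :
          TangentBundle 𝓘(ℝ, EN × FiberModel EG EM) A.Arrows)) n₀ := by
    have h1 := (isLieGroupoid_actionGroupoid (A := A)).one_smooth n₀
    refine ContMDiffAt.sum_along h1 fun i _ => ContMDiffAt.smul_along
      (contMDiff_chartCoeff he hχ hs hX i n₀) (ContMDiffAt.sum_along h1 fun j _ =>
        ContMDiffAt.smul_along (contMDiff_chartCoeff he hχ hs hY j n₀) ?_)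
    exact (isSection_pullbackSection (hζ.smooth _ _ (hVs _) (hVs _))).smooth n₀
  refine hsm.congr_of_eventuallyEq ?_
  filter_upwards [hχ₁, Filter.eventually_all.2 fun i => hXV (bs i)] with n h1 h2
  refine tangentBundle_mk_eq rfl ?_
  have hT : ∀ Y : VecField EN N, VecField.IsTensorialAt
      (fun X => (A.pullbackForm ζ).eval X Y n) n := fun Y => VecField.isTensorialAt_mk
    (fun X X' _ _ => congrFun ((A.pullbackForm ζ).eval_add_left X X' Y) n)
    (fun f X _ _ => congrFun ((A.pullbackForm ζ).eval_smul_left f X Y) n)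
  have hT' : ∀ X : VecField EN N, VecField.IsTensorialAt
      (fun Y => (A.pullbackForm ζ).eval X Y n) n := fun X => VecField.isTensorialAt_mk
    (fun Y Y' _ _ => congrFun ((A.pullbackForm ζ).eval_add_right X Y Y') n)
    (fun f Y _ _ => congrFun ((A.pullbackForm ζ).eval_smul_right f X Y) n)
  refine ((hT Y).eq_sum_chartCoeff he hχ hs h1 hX).trans
    (Finset.sum_congr rfl fun i _ => congrArg _ ?_)
  refine ((hT' _).eq_sum_chartCoeff he hχ hs h1 hY).trans
    (Finset.sum_congr rfl fun j _ => congrArg _ ?_)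
  exact pullbackForm_eval (h2 i) (h2 j)

theorem basicForm_pullbackSection (hψ : Manifold.IsSubmersion 𝓘(ℝ, EN) 𝓘(ℝ, EM) ∞ A.ψ)
    (hXV : A.ProjectsNear X V n₀)
    (hYW : A.ProjectsNear Y W n₀) (hD : 𝒢.IsConnection D) (hD' : A.IsPullbackConnection D D')
    (hζ : 𝒢.IsForm2 ζ)
    (hX : X.Smooth) (hY : Y.Smooth) (hV : V.Smooth) (hW : W.Smooth) (hν : 𝒢.IsSection ν) :
    A.actionGroupoid.basicForm D' (A.pullbackSection ν) (A.pullbackForm ζ) X Y n₀ =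
      A.algebroidLift n₀ (𝒢.basicForm D ν ζ V W (A.ψ n₀)) := by
  have hζ' := isForm2_pullbackForm hψ hζ
  have hs := hζ.smooth V W hV hW
  have hs' := hζ'.smooth X Y hX hY
  have hev : ∀ᶠ n in 𝓝 n₀, (A.pullbackForm ζ).eval X Y n = A.pullbackSection (ζ.eval V W) n := by
    filter_upwards [hXV, hYW] with n h1 h2 using pullbackForm_eval h1 h2
  simp only [GroupoidMaps.basicForm, GroupoidMaps.basicSec, Pi.sub_apply, Pi.add_apply, map_sub,
    map_add]
  rw [hD'.2 _ (𝒢.anchor (ζ.eval V W)) ν n₀ (GroupoidMaps.smooth_anchor hs')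
      (GroupoidMaps.smooth_anchor hs) hν
      (mfderiv_ψ_anchor_of_eq (hs.mem_vertical _) hev.self_of_nhds),
    GroupoidMaps.bracket_congr (Filter.Eventually.of_forall fun _ => rfl) hev,
    bracket_pullbackSection hν hs,
    pullbackForm_eval (hXV.basicVec hD hD' hX hV hν).self_of_nhds hYW.self_of_nhds,
    pullbackForm_eval hXV.self_of_nhds (hYW.basicVec hD hD' hY hW hν).self_of_nhds]
  rfl

/-- The two terms of the equation are separately tensorial in both vector fields and in the section,
and on projectable fields and pullback sections their sum is the lift of the equation on `𝒢`. -/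
theorem isCovariantAdjustment_of_isPullbackConnection
    (hψ : Manifold.IsSubmersion 𝓘(ℝ, EN) 𝓘(ℝ, EM) ∞ A.ψ) (hD : 𝒢.IsCovariantAdjustment D ζ)
    (hD' : A.IsPullbackConnection D D') :
    A.actionGroupoid.IsCovariantAdjustment D' (A.pullbackForm ζ) := by
  have hζ' := isForm2_pullbackForm hψ hD.isForm2
  refine ⟨isAdjustment_of_isPullbackConnection hψ hD.isAdjustment hD', hζ',
    fun X Y σ hX hY hσ => funext fun n₀ => ?_⟩
  have hC := hD'.1
  have key : ∀ {X Y σ}, X.Smooth → Y.Smooth → A.actionGroupoid.IsSection σ →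
      (∀ X V, X.Smooth → V.Smooth → A.ProjectsNear X V n₀ →
        (A.actionGroupoid.curvature D' X Y σ +
          A.actionGroupoid.basicForm D' σ (A.pullbackForm ζ) X Y) n₀ = 0) →
      (A.actionGroupoid.curvature D' X Y σ +
        A.actionGroupoid.basicForm D' σ (A.pullbackForm ζ) X Y) n₀ = 0 := by
    intro X Y σ hX hY hσ h
    refine eq_zero_of_projectable (T := fun X => (A.actionGroupoid.curvature D' X Y σ +
      A.actionGroupoid.basicForm D' σ (A.pullbackForm ζ) X Y) n₀) hψ
      (VecField.isTensorialAt_mk (fun X X' hX hX' => ?_) (fun f X hf hX => ?_)) h hX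
    · rw [hC.curvature_add_vec hσ hX hX' hY, hC.basicForm_add_vec hζ' hσ hX hX' hY,
        add_add_add_comm, Pi.add_apply]
    · simp only [Pi.add_apply]
      rw [hC.curvature_smul_vec hf hσ hX hY, hC.basicForm_smul_vec hζ' hf hσ hX hY, smul_add]
  refine key hX hY hσ fun X V hX hV hXV => ?_
  -- Antisymmetry moves the remaining arbitrary field into the slot handled by `key`.
  rw [hC.curvature_swap hσ hX hY, hC.basicForm_swap hζ' hσ hX hY, ← neg_add, Pi.neg_apply,
    neg_eq_zero]
  refine key hY hX hσ fun Y W hY hW hYW => ?_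
  refine eq_zero_of_pullbackSection (n₀ := n₀) (T := fun σ =>
    (A.actionGroupoid.curvature D' Y X σ +
      A.actionGroupoid.basicForm D' σ (A.pullbackForm ζ) Y X) n₀) (fun σ τ hσ hτ => ?_)
    (fun f σ hf hσ => ?_) (fun ν hν => ?_) hσ
  · rw [hC.curvature_add_sec hσ hτ hY hX, hC.basicForm_add_sec hζ' hσ hτ hY hX,
      add_add_add_comm, Pi.add_apply]
  · simp only [Pi.add_apply]
    rw [hC.curvature_smul_sec hf hσ hY hX, hC.basicForm_smul_sec hζ' hf hσ hY hX, smul_add]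
  · have hDc := hD.isAdjustment.isConnection
    rw [Pi.add_apply, curvature_pullbackSection hYW hXV hDc hD' hY hX hW hV hν,
      basicForm_pullbackSection hψ hYW hXV hDc hD' hD.isForm2 hY hX hW hV hν, ← map_add]
    have h := congrFun (hD.curvature_add W V ν hW hV hν) (A.ψ n₀)
    exact (congrArg (A.algebroidLift n₀) h).trans (map_zero _)

end Pullback

end RightAction

/-! ### Assembly -/

theorem mainTheorem8
    {EG EM EN G M N : Type*}
    [NormedAddCommGroup EG] [NormedSpace ℝ EG] [FiniteDimensional ℝ EG]
    [NormedAddCommGroup EM] [NormedSpace ℝ EM] [FiniteDimensional ℝ EM]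
    [NormedAddCommGroup EN] [NormedSpace ℝ EN] [FiniteDimensional ℝ EN]
    [TopologicalSpace G] [T2Space G] [SecondCountableTopology G]
    [ChartedSpace EG G] [IsManifold 𝓘(ℝ, EG) ∞ G]
    [TopologicalSpace M] [T2Space M] [SecondCountableTopology M]
    [ChartedSpace EM M] [IsManifold 𝓘(ℝ, EM) ∞ M]
    [TopologicalSpace N] [T2Space N] [SecondCountableTopology N]
    [ChartedSpace EN N] [IsManifold 𝓘(ℝ, EN) ∞ N]
    (𝒢 : GroupoidMaps EG EM G M) [IsLieGroupoid 𝒢]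
    (A : RightAction 𝒢 EN N) (hψ : Manifold.IsSubmersion 𝓘(ℝ, EN) 𝓘(ℝ, EM) ∞ A.ψ)
    (H : ∀ g : G, Submodule ℝ (TangentSpace 𝓘(ℝ, EG) g)) (hH : 𝒢.IsCartanConnection H)
    (D : 𝒢.ConnOp) (ζ : 𝒢.Form2) (hDζ : 𝒢.IsCovariantAdjustment D ζ)
    (hD : ∀ V ν, V.Smooth → 𝒢.IsSection ν → D V ν = 𝒢.inducedConnection H V ν) :
    IsLieGroupoid A.actionGroupoid ∧
    A.actionGroupoid.IsCartanConnection (A.inducedDistribution H) ∧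
    A.IsPullbackConnection D
      (A.actionGroupoid.inducedConnection (A.inducedDistribution H)) ∧
    A.actionGroupoid.IsCovariantAdjustment
      (A.actionGroupoid.inducedConnection (A.inducedDistribution H)) (A.pullbackForm ζ) := by
  -- `D` agrees with the induced connection only on smooth arguments, which are the ones the
  -- pullback property quantifies over.
  have hpb : A.IsPullbackConnection D
      (A.actionGroupoid.inducedConnection (A.inducedDistribution H)) := by
    obtain ⟨h₁, h₂⟩ := RightAction.isPullbackConnection_inducedConnection hψ hH
    refine ⟨h₁, fun X V ν n hX hV hν h => ?_⟩
    rw [hD V ν hV hν]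
    exact h₂ X V ν n hX hV hν h
  exact ⟨RightAction.isLieGroupoid_actionGroupoid,
    RightAction.isCartanConnection_inducedDistribution hψ hH, hpb,
    RightAction.isCovariantAdjustment_of_isPullbackConnection hψ hDζ hpb⟩
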